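/- Let $N\ge 1$, $l\ge 0$ be integers and let $R=\mathbb C[\hbar,k,z_1,\dots,z_l]$ be a polynomial ring. Indices of $s_i,y_i$ in the next paragraph are read modulo $N$ (so $s_N=s_0$). Let $H=H\!H_{N,\mathrm{deg}}[z_1,\dots,z_l]$ be the degenerate double affine Hecke algebra of type $GL_N$ over $R$: the associative unital $R$-algebra generated by $\pi^{\pm1}$, $s_0,\dots,s_{N-1}$, $y_1,\dots,y_N$ with defining relations $$s_i^2=1,\quad s_is_{i+1}s_i=s_{i+1}s_is_{i+1}\ (N\ge 3),\quad s_is_j=s_js_i\ (i-j\ne\pm1),\quad \pi s_i=s_{i+1}\pi,$$ $$[y_i,y_j]=0,\quad \pi y_i=y_{i+1}\pi\ (i\ne N),\quad \pi y_N=(y_1-\hbar)\pi,$$ $$s_iy_i=y_{i+1}s_i+k\ (i\ne0),\quad s_0y_N=(y_1-\hbar)s_0+k,\quad [s_i,y_j]=0\ (j\ne i,i+1),$$ where for $N=1$ there are no generators $s_i$ (only $\pi^{\pm1}$ and $y_1$). The degenerate cyclotomic DAHA $H\!H^l_{N,\mathrm{deg}}$ is the $R$-subalgebra of $H$ generated by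 $s_1,\dots,s_{N-1}$, $y_1,\dots,y_N$, $\pi$ and $\pi_-:=\pi^{-1}\prod_{i=1}^l(y_1-z_i)$. The elements $s_1,\dots,s_{N-1}$ define a homomorphism from the symmetric group $S_N$ to the invertible elements of $H$ sending the transposition $(i,i+1)$ to $s_i$; we denote the image of $s\in S_N$ again by $s$, and that of the transposition $(i,j)$ by $s_{ij}$ (with $s_{11}=1$). Let $X_1:=\pi(s_1\cdots s_{N-1})^{-1}$, which is invertible, and put $$X_i:=s_{1i}X_1s_{1i},\qquad D_1:=X_1^{-1}(y_1-z_1)\cdots(y_1-z_l),\qquad D_i:=s_{1i}D_1s_{1i}\qquad(1\le i\le N).$$ (a) The algebra $H\!H^l_{N,\mathrm{deg}}$ contains all $s\in S_N$, $y_i$, $X_i$, $D_i$, is generated by them over $R$, and a complete set of defining relations between these generators is given by the relations of the group $S_N$ together with \begin{gather*} s_iy_i=y_{i+1}s_i+k\ (1\le i\le N-1),\qquad s_iy_j=y_js_i\ (1\le i\le N-1,\ j\ne i,i+1),\qquad [y_i,y_j]=0,\\ sX_i=X_{s(i)}s\ (s\in S_N),\qquad [X_i,X_j]=0,\\ [y_i,X_1]=kX_1s_{1i}\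 (i>1),\qquad [y_1,X_1]=\hbar X_1-k\sum_{i>1}X_1s_{1i},\\ sD_i=D_{s(i)}s\ (s\in S_N),\qquad [D_i,D_j]=0,\\ [y_j,D_1]=-ks_{1j}D_1\ (j>1),\qquad [y_1,D_1]=-\hbar D_1+k\sum_{i>1}s_{1i}D_1,\\ [D_1,X_1]=\sum_{r=1}^{l}\prod_{i=1}^{r-1}\Big(y_1-z_i+\hbar-k\sum_{j>1}s_{1j}\Big)\Big(\hbar-k\sum_{j>1}s_{1j}\Big)\prod_{i=r+1}^l(y_1-z_i),\\ [D_1,X_m]=k\sum_{r=1}^{l}\prod_{i=1}^{r-1}\Big(y_1-z_i+\hbar-k\sum_{j>1}s_{1j}\Big)s_{1m}\prod_{i=r+1}^l(y_1-z_i)\ (m>1),\\ X_1D_1=(y_1-z_1)\cdots(y_1-z_l). \end{gather*} (b) Suppose $l\ge1$. The elements $M_XM_y\,s\,M_D$, where $M_X$ runs over all monomials in $X_1,\dots,X_N$, $M_y$ over the monomials in $y_1,\dots,y_N$ in which each $y_i$ has degree at most $l-1$, $s$ over $S_N$, and $M_D$ over all monomials in $D_1,\dots,D_N$, form a basis of $H\!H^l_{N,\mathrm{deg}}$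 over $R$. In particular $H\!H^l_{N,\mathrm{deg}}$ is a free $R$-module. -/

import Mathlib

namespace CycDAHA

/-- The product `(a - z₁)(a - z₂)⋯` over a list of scalars, in an associative `R`-algebra. -/
def prodSub {R A : Type*} [CommRing R] [Ring A] [Algebra R A] (zs : List R) (a : A) : A :=
  (zs.map fun z => a - algebraMap R A z).prod

/-- The sum `∑_{r=1}^{l} ∏_{i<r} (a - z_i) · m · ∏_{i>r} (b - z_i)`. -/
def sumInsert {R A : Type*} [CommRing R] [Ring A] [Algebra R A] {l : ℕ} (z : Fin l → R)
    (a m b : A) : A :=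
  ∑ r : Fin l, prodSub ((List.ofFn z).take r.val) a * m * prodSub ((List.ofFn z).drop (r.val + 1)) b

/-- The ordered monomial `∏_i (u i)^(a i)`. -/
def monom {N : ℕ} {A : Type*} [Ring A] (u : Fin N → A) (a : Fin N → ℕ) : A :=
  (List.ofFn fun i => u i ^ a i).prod

/-! ### The degenerate (trigonometric) double affine Hecke algebra

Indices are shifted: the classical `y₁, …, y_N` are `y 0, …, y (N-1)`, the classical
`s₁, …, s_{N-1}` are `s 0, …, s (N-2)`, and the classical affine reflection `s₀` (that is `s_N`,
indices being read mod `N`) is `s (N-1)`. Addition in `Fin N` is addition mod `N`. -/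

/-- The generators `π, π⁻¹, s_i, y_i`. -/
inductive DegGen (N : ℕ) : Type
  | pi : DegGen N
  | piInv : DegGen N
  | s (i : Fin N) : DegGen N
  | y (i : Fin N) : DegGen N

section Deg

variable (R : Type) [CommRing R] (N : ℕ) [NeZero N] (hb k : R)

/-- The free algebra on `π, π⁻¹, s_i, y_i`. -/
abbrev DegFree : Type := FreeAlgebra R (DegGen N)

variable {N} in
/-- A generator as an element of the free algebra. -/
abbrev degGen (g : DegGen N) : DegFree R N := FreeAlgebra.ι R g

open DegGen in
/-- The defining relations of the degenerate DAHA with parameters `hb` (that is `ħ`) and `k`.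

For `N = 2` there is no braid relation (the affine reflections `s₀, s₁` generate an infinite
dihedral group), and for `N = 1` there are no reflections, so that the only symbol `s 0` is
set equal to `1`. -/
inductive DegRel : DegFree R N → DegFree R N → Prop
  | pi_piInv : DegRel (degGen R pi * degGen R piInv) 1
  | piInv_pi : DegRel (degGen R piInv * degGen R pi) 1
  | s_sq (i : Fin N) : DegRel (degGen R (s i) * degGen R (s i)) 1
  | s_one (h : N = 1) (i : Fin N) : DegRel (degGen R (s i)) 1
  | s_braid (h : 2 < N) (i : Fin N) :
      DegRel (degGen R (s i) * degGen R (s (i + 1)) * degGen R (s i))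
        (degGen R (s (i + 1)) * degGen R (s i) * degGen R (s (i + 1)))
  | s_comm (i j : Fin N) (h₁ : j ≠ i + 1) (h₂ : i ≠ j + 1) :
      DegRel (degGen R (s i) * degGen R (s j)) (degGen R (s j) * degGen R (s i))
  | pi_s (i : Fin N) : DegRel (degGen R pi * degGen R (s i)) (degGen R (s (i + 1)) * degGen R pi)
  | y_comm (i j : Fin N) :
      DegRel (degGen R (y i) * degGen R (y j)) (degGen R (y j) * degGen R (y i))
  | pi_y (i : Fin N) (h : i.val + 1 < N) :
      DegRel (degGen R pi * degGen R (y i)) (degGen R (y (i + 1)) * degGen R pi)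
  | pi_y_last (i : Fin N) (h : i.val + 1 = N) :
      DegRel (degGen R pi * degGen R (y i))
        ((degGen R (y 0) - algebraMap R (DegFree R N) hb) * degGen R pi)
  | s_y (i : Fin N) (h : i.val + 1 < N) :
      DegRel (degGen R (s i) * degGen R (y i))
        (degGen R (y (i + 1)) * degGen R (s i) + algebraMap R (DegFree R N) k)
  | s_y_last (hN : 1 < N) (i : Fin N) (h : i.val + 1 = N) :
      DegRel (degGen R (s i) * degGen R (y i))
        ((degGen R (y 0) - algebraMap R (DegFree R N) hb) * degGen R (s i)
          + algebraMap R (DegFree R N) k)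
  | s_y_comm (i j : Fin N) (h₁ : j ≠ i) (h₂ : j ≠ i + 1) :
      DegRel (degGen R (s i) * degGen R (y j)) (degGen R (y j) * degGen R (s i))

/-- The degenerate DAHA over a commutative ring `R`, with parameters `hb, k : R`. -/
abbrev DegDAHA : Type := RingQuot (DegRel R N hb k)

namespace DegDAHA

variable {N}

/-- A generator as an element of the degenerate DAHA. -/
def gen (g : DegGen N) : DegDAHA R N hb k :=
  RingQuot.mkAlgHom R (DegRel R N hb k) (FreeAlgebra.ι R g)

/-- The element `y_i`. -/
def y (i : Fin N) : DegDAHA R N hb k := gen R hb k (DegGen.y i)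

variable (N) in
/-- The invertible element `π`. -/
def pi : (DegDAHA R N hb k)ˣ where
  val := gen R hb k DegGen.pi
  inv := gen R hb k DegGen.piInv
  val_inv := by
    simpa [gen] using RingQuot.mkAlgHom_rel R (DegRel.pi_piInv (R := R) (N := N) (hb := hb) (k := k))
  inv_val := by
    simpa [gen] using RingQuot.mkAlgHom_rel R (DegRel.piInv_pi (R := R) (N := N) (hb := hb) (k := k))

/-- The invertible element `s_i`. -/
def s (i : Fin N) : (DegDAHA R N hb k)ˣ where
  val := gen R hb k (DegGen.s i)
  inv := gen R hb k (DegGen.s i)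
  val_inv := by
    simpa [gen] using RingQuot.mkAlgHom_rel R (DegRel.s_sq (R := R) (hb := hb) (k := k) i)
  inv_val := by
    simpa [gen] using RingQuot.mkAlgHom_rel R (DegRel.s_sq (R := R) (hb := hb) (k := k) i)

variable (N) in
/-- The invertible element `X₁`, determined by `π = X₁ s₁ ⋯ s_{N-1}`. -/
def X₁ : (DegDAHA R N hb k)ˣ :=
  pi R N hb k * (((List.finRange N).dropLast.map (s R hb k)).prod)⁻¹

variable (N) in
/-- The element `D₁ = X₁⁻¹ (y₁ - z₁) ⋯ (y₁ - z_l)`. -/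
def D₁ {l : ℕ} (z : Fin l → R) : DegDAHA R N hb k :=
  (((X₁ R N hb k)⁻¹ : (DegDAHA R N hb k)ˣ) : DegDAHA R N hb k)
    * prodSub (List.ofFn z) (y R hb k 0)

variable (N) in
/-- The element `π₋ = π⁻¹ (y₁ - z₁) ⋯ (y₁ - z_l)`. -/
def piMinus {l : ℕ} (z : Fin l → R) : DegDAHA R N hb k :=
  (((pi R N hb k)⁻¹ : (DegDAHA R N hb k)ˣ) : DegDAHA R N hb k)
    * prodSub (List.ofFn z) (y R hb k 0)

section

variable {R hb k}

/-- Given the homomorphism `w` from the symmetric group, the element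
`X_i = s_{1i} X₁ s_{1i}`. -/
def X (w : Equiv.Perm (Fin N) →* DegDAHA R N hb k) (i : Fin N) : DegDAHA R N hb k :=
  w (Equiv.swap 0 i) * (X₁ R N hb k : DegDAHA R N hb k) * w (Equiv.swap 0 i)

/-- Given the homomorphism `w` from the symmetric group, the element
`D_i = s_{1i} D₁ s_{1i}`. -/
def D {l : ℕ} (z : Fin l → R) (w : Equiv.Perm (Fin N) →* DegDAHA R N hb k) (i : Fin N) :
    DegDAHA R N hb k :=
  w (Equiv.swap 0 i) * D₁ R N hb k z * w (Equiv.swap 0 i)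

end

end DegDAHA

open DegDAHA in
/-- The degenerate cyclotomic DAHA: the subalgebra of the degenerate DAHA generated by the
non-affine `s_i`, all `y_i`, `π` and `π₋`. -/
def cycDAHA {l : ℕ} (z : Fin l → R) : Subalgebra R (DegDAHA R N hb k) :=
  Algebra.adjoin R
    ({a | ∃ i : Fin N, i.val + 1 < N ∧ a = s R hb k i} ∪ Set.range (y R hb k)
      ∪ {(pi R N hb k : DegDAHA R N hb k), piMinus R N hb k z})

end Deg

/-! ### The algebra given by generators and relations -/

/-- The generators: the elements of the symmetric group, and `y_i, X_i, D_i`. -/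
inductive CycGen (N : ℕ) : Type
  | s (σ : Equiv.Perm (Fin N)) : CycGen N
  | y (i : Fin N) : CycGen N
  | X (i : Fin N) : CycGen N
  | D (i : Fin N) : CycGen N

section Cyc

variable (R : Type) [CommRing R] (N : ℕ) [NeZero N] (hb k : R) {l : ℕ} (z : Fin l → R)

/-- The free algebra on the elements of the symmetric group and `y_i, X_i, D_i`. -/
abbrev CycFree : Type := FreeAlgebra R (CycGen N)

variable {N} in
/-- A generator as an element of the free algebra. -/
abbrev cycGen (g : CycGen N) : CycFree R N := FreeAlgebra.ι R g

/-- The sum `∑_{j>1} s_{1j}`. -/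
def sumSwap : CycFree R N :=
  ∑ j ∈ Finset.univ.erase (0 : Fin N), cycGen R (CycGen.s (Equiv.swap 0 j))

open CycGen in
/-- The relations of the presentation (with indices starting at `0`, so that `y 0, X 0, D 0` are
the classical `y₁, X₁, D₁`, and `z` runs over `Fin l`). -/
inductive CycRel : CycFree R N → CycFree R N → Prop
  | s_one : CycRel (cycGen R (s 1)) 1
  | s_mul (σ τ : Equiv.Perm (Fin N)) :
      CycRel (cycGen R (s (σ * τ))) (cycGen R (s σ) * cycGen R (s τ))
  | s_y (i : Fin N) (h : i.val + 1 < N) :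
      CycRel (cycGen R (s (Equiv.swap i (i + 1))) * cycGen R (y i))
        (cycGen R (y (i + 1)) * cycGen R (s (Equiv.swap i (i + 1)))
          + algebraMap R (CycFree R N) k)
  | s_y_comm (i j : Fin N) (h : i.val + 1 < N) (h₁ : j ≠ i) (h₂ : j ≠ i + 1) :
      CycRel (cycGen R (s (Equiv.swap i (i + 1))) * cycGen R (y j))
        (cycGen R (y j) * cycGen R (s (Equiv.swap i (i + 1))))
  | y_comm (i j : Fin N) :
      CycRel (cycGen R (y i) * cycGen R (y j)) (cycGen R (y j) * cycGen R (y i))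
  | s_X (σ : Equiv.Perm (Fin N)) (i : Fin N) :
      CycRel (cycGen R (s σ) * cycGen R (X i)) (cycGen R (X (σ i)) * cycGen R (s σ))
  | X_comm (i j : Fin N) :
      CycRel (cycGen R (X i) * cycGen R (X j)) (cycGen R (X j) * cycGen R (X i))
  | y_X (i : Fin N) (h : i ≠ 0) :
      CycRel (cycGen R (y i) * cycGen R (X 0) - cycGen R (X 0) * cycGen R (y i))
        (k • (cycGen R (X 0) * cycGen R (s (Equiv.swap 0 i))))
  | y_X_zero :
      CycRel (cycGen R (y 0) * cycGen R (X 0) - cycGen R (X 0) * cycGen R (y 0))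
        (hb • cycGen R (X 0) - k • (cycGen R (X 0) * sumSwap R N))
  | s_D (σ : Equiv.Perm (Fin N)) (i : Fin N) :
      CycRel (cycGen R (s σ) * cycGen R (D i)) (cycGen R (D (σ i)) * cycGen R (s σ))
  | D_comm (i j : Fin N) :
      CycRel (cycGen R (D i) * cycGen R (D j)) (cycGen R (D j) * cycGen R (D i))
  | y_D (j : Fin N) (h : j ≠ 0) :
      CycRel (cycGen R (y j) * cycGen R (D 0) - cycGen R (D 0) * cycGen R (y j))
        (-(k • (cycGen R (s (Equiv.swap 0 j)) * cycGen R (D 0))))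
  | y_D_zero :
      CycRel (cycGen R (y 0) * cycGen R (D 0) - cycGen R (D 0) * cycGen R (y 0))
        (-(hb • cycGen R (D 0)) + k • (sumSwap R N * cycGen R (D 0)))
  | D_X_zero :
      CycRel (cycGen R (D 0) * cycGen R (X 0) - cycGen R (X 0) * cycGen R (D 0))
        (sumInsert z
          (cycGen R (y 0) + algebraMap R (CycFree R N) hb - k • sumSwap R N)
          (algebraMap R (CycFree R N) hb - k • sumSwap R N)
          (cycGen R (y 0)))
  | D_X (m : Fin N) (h : m ≠ 0) :
      CycRel (cycGen R (D 0) * cycGen R (X m) - cycGen R (X m) * cycGen R (D 0))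
        (k • sumInsert z
          (cycGen R (y 0) + algebraMap R (CycFree R N) hb - k • sumSwap R N)
          (cycGen R (s (Equiv.swap 0 m)))
          (cycGen R (y 0)))
  | X_D : CycRel (cycGen R (X 0) * cycGen R (D 0)) (prodSub (List.ofFn z) (cycGen R (y 0)))

/-- The algebra presented by the above generators and relations. -/
abbrev CycPres : Type := RingQuot (CycRel R N hb k z)

variable {N} in
/-- A generator as an element of the presented algebra. -/
def CycPres.gen (g : CycGen N) : CycPres R N hb k z :=
  RingQuot.mkAlgHom R (CycRel R N hb k z) (FreeAlgebra.ι R g)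

end Cyc

/-! ### Indeterminate parameters -/

/-- Names of the parameters `ħ, k, z₁, …, z_l`. -/
inductive Param (l : ℕ) : Type
  | hb : Param l
  | k : Param l
  | z (i : Fin l) : Param l

/-- The polynomial ring `ℂ[ħ, k, z₁, …, z_l]`. -/
abbrev PRing (l : ℕ) : Type := MvPolynomial (Param l) ℂ

noncomputable section

/-- The indeterminate `ħ`. -/
def hbVar (l : ℕ) : PRing l := MvPolynomial.X Param.hb

/-- The indeterminate `k`. -/
def kVar (l : ℕ) : PRing l := MvPolynomial.X Param.k

/-- The indeterminates `z_i`. -/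
def zVar (l : ℕ) (i : Fin l) : PRing l := MvPolynomial.X (Param.z i)

/-- The degenerate DAHA `HH_{N,deg}[z₁, …, z_l]` with indeterminate parameters. -/
abbrev HH (N l : ℕ) [NeZero N] : Type := DegDAHA (PRing l) N (hbVar l) (kVar l)

/-- The degenerate cyclotomic DAHA `HH^l_{N,deg}` with indeterminate parameters. -/
abbrev HHcyc (N l : ℕ) [NeZero N] : Subalgebra (PRing l) (HH N l) :=
  cycDAHA (PRing l) N (hbVar l) (kVar l) (zVar l)

/-- The presented algebra with indeterminate parameters. -/
abbrev HHpres (N l : ℕ) [NeZero N] : Type := CycPres (PRing l) N (hbVar l) (kVar l) (zVar l)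

/-- A generator of the presented algebra with indeterminate parameters. -/
abbrev presGen {N : ℕ} (l : ℕ) [NeZero N] (g : CycGen N) : HHpres N l :=
  CycPres.gen (PRing l) (hbVar l) (kVar l) (zVar l) g

/-- The element `s_i` of `HH_{N,deg}[z]`. -/
abbrev sElt {N : ℕ} (l : ℕ) [NeZero N] (i : Fin N) : HH N l :=
  (DegDAHA.s (PRing l) (hbVar l) (kVar l) i : HH N l)

/-- The element `y_i` of `HH_{N,deg}[z]`. -/
abbrev yElt {N : ℕ} (l : ℕ) [NeZero N] (i : Fin N) : HH N l :=
  DegDAHA.y (PRing l) (hbVar l) (kVar l) i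

end

end CycDAHA

/-! Let `B` be the algebra presented by the generators and relations of (a), and `H` the degenerate
DAHA. Since the relations hold in `H`, there is a homomorphism from `B` to `H`; its range is the
cyclotomic subalgebra, because π = X₁ s₁⋯s_{N-1} and π₋ = (s₁⋯s_{N-1})⁻¹ D₁. For l ≥ 1 both parts
follow from two facts: the monomials M_X M_y s M_D span `B` (`IsCyclotomic.span_monomials_eq_top`),
and their images in `H` are linearly independent (`linearIndependent_basis_monomials`). A linear map
carrying a spanning family to an independent one is injective, and the images form a basis of the
range.

Relations. The corrected elements y_i + k ∑_{j<i} s_{ij} (`balanced`) are honestly permuted by S_N,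
which turns the relations for π into relations for X₁. Commutativity of the X_i, and of the D_i,
reduces by equivariance to a single pair, where it encodes π² s_{N-1} = s₁ π². The commutators of D₁
with the X_m come from conjugating by X₁⁻¹ and telescoping (`prodSub_mul_sub`).

Spanning. The exchange relations move the X_i to the left and the D_i to the right, so `B` is the
product of the spans of the X-algebra, the degenerate affine Hecke algebra and the D-algebra
(`IsCyclotomic.triangular_eq_top`). Since X_i D_i equals y_i^l up to lower order, exponents of y_i
at or above l can be eliminated.

Independence. `H` acts on functions on the extended affine symmetric group: π by translation, y_i by
multiplication by -ħ g(i)/N, and s_i by Demazure-Lusztig operators (`affPerm.rep`). Writing k = ħt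
keeps the coefficients polynomial in t. At t = 0 a monomial becomes a translation multiplied by a
product of one-variable polynomials, one for each i; those with the same translation are separated
by their degrees, which combine the exponents of y and D as b + l c. Hence the coefficients of a
linear relation vanish at t = 0; dividing by t and repeating kills them altogether
(`affPerm.coeff_eq_zero_of_sum_eq_zero`).

For l = 0 the D_i are inverse to the X_i. Multiplying by a monomial in the X_i moves any element of
`B` into the span of the X^a y^b s, whose images are independent, and injectivity follows again. -/

namespace CycDAHA

open Equiv

/-! ### The Coxeter presentation of the symmetric group. -/

section SymmetricGroup

/-- The transposition `(i, i+1)`. -/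
def adjSwap {n : ℕ} (i : ℕ) (hi : i < n) : Perm (Fin (n + 1)) :=
  swap ⟨i, by omega⟩ ⟨i + 1, by omega⟩

theorem decomposeFin_symm_eq {n : ℕ} (p : Fin (n + 1)) (e : Perm (Fin n)) :
    Perm.decomposeFin.symm (p, e) = swap 0 p * Perm.decomposeFin.symm (0, e) := by
  ext x
  refine Fin.cases ?_ (fun x => ?_) x <;> simp

theorem decomposeFin_symm_zero_mul {n : ℕ} (e f : Perm (Fin n)) :
    Perm.decomposeFin.symm (0, e * f)
      = Perm.decomposeFin.symm (0, e) * Perm.decomposeFin.symm (0, f) := by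
  ext x
  refine Fin.cases ?_ (fun x => ?_) x <;> simp

theorem decomposeFin_symm_zero_swap {n : ℕ} (a b : Fin n) :
    Perm.decomposeFin.symm (0, swap a b) = swap a.succ b.succ := by
  ext x
  refine Fin.cases ?_ (fun x => ?_) x
  · rw [swap_apply_of_ne_of_ne] <;> simp [Fin.ext_iff]
  · simp only [Perm.decomposeFin_symm_apply_succ, swap_self, refl_apply, swap_apply_def,
      Fin.succ_inj]
    split_ifs <;> rfl

variable {G : Type*} [Monoid G]

/-- The words `s_{p-1} ⋯ s₁ s₀ s₁ ⋯ s_{p-1}`, which represent the transpositions `(0, p)`. -/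
def starWord (s : ℕ → G) : ℕ → G
  | 0 => 1
  | 1 => s 0
  | p + 2 => s (p + 1) * starWord s (p + 1) * s (p + 1)

variable {n : ℕ} {s : ℕ → G}

theorem starWord_succ {p : ℕ} (hp : 0 < p) : starWord s (p + 1) = s p * starWord s p * s p := by
  obtain ⟨q, rfl⟩ := Nat.exists_eq_succ_of_ne_zero hp.ne'
  rfl

theorem starWord_comm_of_lt (comm : ∀ i j, i + 1 < j → j < n → s i * s j = s j * s i) {i : ℕ}
    (hi : i < n) (p : ℕ) (h : p < i) : s i * starWord s p = starWord s p * s i := by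
  induction p with
  | zero => simp [starWord]
  | succ p ih =>
    have hc : Commute (s i) (s p) := (comm p i h hi).symm
    rcases Nat.eq_zero_or_pos p with rfl | hp
    · exact hc
    · rw [starWord_succ hp]
      exact (hc.mul_right (ih (by omega))).mul_right hc

/-- Here (i, i+1) fixes both 0 and p. For p = i + 2 the braid relation carries s_i through the outer
letters, turning it into s_{i+1}, which commutes with the inner word; larger p only add letters
commuting with s_i. -/
theorem starWord_comm_of_gt (braid : ∀ i, i + 1 < n → s i * s (i + 1) * s i = s (i + 1) * s i * s (i + 1))
    (comm : ∀ i j, i + 1 < j → j < n → s i * s j = s j * s i) {i : ℕ}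
    (hi : 0 < i) (p : ℕ) (h : i + 2 ≤ p) (hp : p ≤ n) :
    s i * starWord s p = starWord s p * s i := by
  induction p, h using Nat.le_induction with
  | base =>
    have hb := braid i (by omega)
    have hc := starWord_comm_of_lt (s := s) comm (i := i + 1) (by omega) i (by omega)
    rw [starWord_succ (by omega), starWord_succ hi]
    calc _ = (s i * s (i + 1) * s i) * starWord s i * s i * s (i + 1) := by simp only [mul_assoc]
      _ = s (i + 1) * s i * (s (i + 1) * starWord s i) * s i * s (i + 1) := by
        rw [hb]; simp only [mul_assoc]
      _ = s (i + 1) * s i * starWord s i * (s (i + 1) * s i * s (i + 1)) := by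
        rw [hc]; simp only [mul_assoc]
      _ = _ := by rw [← hb]; simp only [mul_assoc]
  | succ p hip ih =>
    have hc : Commute (s i) (s p) := comm i p (by omega) (by omega)
    rw [starWord_succ (by omega)]
    exact (hc.mul_right (ih (by omega))).mul_right hc

theorem swap_mul_swap_zero {m : ℕ} (i j : Fin (m + 1)) (h : j ≠ 0) (h' : i ≠ 0) (p : Fin (m + 1)) :
    swap i j * swap 0 p = swap 0 (swap i j p) * swap i j := by
  rw [mul_swap_eq_swap_mul, swap_apply_of_ne_of_ne h'.symm h.symm]

theorem swap_mul_swap_left_eq {α : Type*} [DecidableEq α] {a b c : α} (hab : b ≠ a) (hbc : b ≠ c) :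
    swap a b * swap a c = swap a c * swap b c := by
  rw [mul_swap_eq_swap_mul (swap a c), swap_apply_right, swap_apply_of_ne_of_ne hab hbc,
    swap_comm a b]

/-- Induction over the cosets of the stabilizer of 0: a permutation is uniquely (0, p) times a
permutation fixing 0. The second factor is handled by the inductive hypothesis for the shifted
letters s_{i+1}, the first by a word. Multiplicativity need only be checked for left multiplication
by adjacent transpositions, which generate as a monoid. -/
theorem exists_permHom_of_braid (n : ℕ) : ∀ (s : ℕ → G) (_ : ∀ i, i < n → s i * s i = 1)
    (_ : ∀ i, i + 1 < n → s i * s (i + 1) * s i = s (i + 1) * s i * s (i + 1))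
    (_ : ∀ i j, i + 1 < j → j < n → s i * s j = s j * s i),
    ∃ w : Perm (Fin (n + 1)) →* G, ∀ i (hi : i < n), w (adjSwap i hi) = s i := by
  induction n with
  | zero => exact fun s _ _ _ => ⟨1, fun i hi => by omega⟩
  | succ n ih =>
    intro s sq braid comm
    obtain ⟨w', hw'⟩ := ih (fun i => s (i + 1)) (fun i hi => sq _ (by omega))
      (fun i hi => braid _ (by omega)) (fun i j hi hj => comm _ _ (by omega) (by omega))
    let e0 : Perm (Fin (n + 1)) → Perm (Fin (n + 2)) := fun e => Perm.decomposeFin.symm (0, e)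
    let W : Perm (Fin (n + 2)) → G := fun σ =>
      starWord s (Perm.decomposeFin σ).1 * w' (Perm.decomposeFin σ).2
    have hW : ∀ (p : Fin (n + 2)) (e : Perm (Fin (n + 1))),
        W (swap 0 p * e0 e) = starWord s p * w' e := by
      intro p e
      simp only [W, e0, ← decomposeFin_symm_eq, apply_symm_apply]
    have hadj : ∀ i (hi : i + 1 < n + 1), adjSwap (i + 1) hi = e0 (adjSwap (n := n) i (by omega)) := by
      intro i hi
      simp only [e0, adjSwap, decomposeFin_symm_zero_swap]
      rfl
    -- The word counterpart of (0, 1)(0, p+1) = (0, p+1)(1, p+1); `w'` sees (1, p+1) as (0, p). This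
    -- is the only case where s₀ changes the factor fixing 0.
    have hstar : ∀ p (hp0 : 1 ≤ p) (hp : p < n + 1), s 0 * starWord s (p + 1)
        = starWord s (p + 1) * w' (swap 0 ⟨p, hp⟩) := by
      intro p hp0
      induction p, hp0 using Nat.le_induction with
      | base =>
        intro hp
        have h1 : w' (swap 0 ⟨1, hp⟩) = s 1 := hw' 0 (by omega)
        have hb := braid 0 (by omega)
        simp only [zero_add] at hb
        rw [h1, starWord_succ one_pos]
        simp only [starWord]
        rw [mul_assoc _ (s 1) (s 1), sq 1 (by omega), mul_one, ← hb, ← mul_assoc, ← mul_assoc,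
          sq 0 (by omega), one_mul]
      | succ p hp0 ihp =>
        intro hp
        have hc : Commute (s 0) (s (p + 1)) := comm 0 (p + 1) (by omega) (by omega)
        have hs : (swap 0 ⟨p + 1, hp⟩ : Perm (Fin (n + 1)))
            = adjSwap p (by omega) * swap 0 ⟨p, by omega⟩ * adjSwap p (by omega) := by
          rw [adjSwap, swap_mul_swap_zero _ _ (by simp [Fin.ext_iff])
            (by simp [Fin.ext_iff]; omega), swap_apply_left, mul_assoc, swap_mul_self, mul_one]
        rw [starWord_succ (by omega), hs, map_mul, map_mul, hw', mul_assoc, ← mul_assoc (s 0),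
          hc.eq, mul_assoc, ← mul_assoc (s 0), ihp (by omega)]
        simp only [mul_assoc]
        rw [← mul_assoc (s (p + 1)) (s (p + 1)) (_ * _), sq (p + 1) (by omega), one_mul]
    have hgen : ∀ i (hi : i < n + 1) (τ : Perm (Fin (n + 2))), W (adjSwap i hi * τ) = s i * W τ := by
      intro i hi τ
      obtain ⟨⟨p, e⟩, rfl⟩ := Perm.decomposeFin.symm.surjective τ
      rw [decomposeFin_symm_eq]
      change W (_ * (_ * e0 e)) = s i * W (_ * e0 e)
      rw [hW]
      rcases i with _ | i
      · have h01 : adjSwap 0 hi = (swap 0 1 : Perm (Fin (n + 2))) := rfl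
        rcases p with ⟨_ | _ | p, hp⟩
        · have : W (adjSwap 0 hi * (swap 0 ⟨0, hp⟩ * e0 e)) = W (swap 0 1 * e0 e) := by
            rw [h01]
            congr 2
            change swap 0 0 * e0 e = _
            rw [swap_self]
            rfl
          rw [this, hW]
          simp [starWord]
        · have : W (adjSwap 0 hi * (swap 0 ⟨0 + 1, hp⟩ * e0 e)) = W (swap 0 0 * e0 e) := by
            rw [h01]
            congr 1
            change swap 0 1 * (swap 0 1 * _) = _
            rw [swap_mul_self_mul, swap_self]
            rfl
          rw [this, hW]
          simp only [Fin.val_zero, starWord, one_mul]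
          rw [← mul_assoc, sq 0 (by omega), one_mul]
        · have : adjSwap 0 hi * (swap 0 ⟨p + 1 + 1, hp⟩ * e0 e)
              = swap 0 ⟨p + 1 + 1, hp⟩ * e0 (swap 0 ⟨p + 1, by omega⟩ * e) := by
            simp only [e0, decomposeFin_symm_zero_mul, decomposeFin_symm_zero_swap]
            rw [h01, ← mul_assoc, ← mul_assoc]
            congr 1
            exact swap_mul_swap_left_eq (by simp) (by simp)
          rw [this, hW, map_mul, ← mul_assoc, ← mul_assoc, hstar]
          omega
      · have hne : (⟨i + 1, by omega⟩ : Fin (n + 2)) ≠ 0 := by simp [Fin.ext_iff]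
        have hne' : (⟨i + 1 + 1, by omega⟩ : Fin (n + 2)) ≠ 0 := by simp [Fin.ext_iff]
        -- A transposition fixing 0 moves p and then multiplies the factor fixing 0, so only its
        -- exchange with the word for p remains to be checked.
        have : adjSwap (i + 1) hi * (swap 0 p * e0 e)
            = swap 0 (adjSwap (i + 1) hi p) * e0 (adjSwap i (by omega) * e) := by
          rw [← mul_assoc]
          simp only [e0, decomposeFin_symm_zero_mul]
          change _ = _ * (e0 _ * _)
          rw [← hadj, adjSwap, swap_mul_swap_zero _ _ hne' hne, mul_assoc]
          omega
        rw [this, hW, map_mul, hw', ← mul_assoc, ← mul_assoc]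
        congr 1
        obtain ⟨p, hp⟩ := p
        have hval : (adjSwap (i + 1) hi ⟨p, hp⟩ : Fin (n + 2)).val
            = if p = i + 1 then i + 2 else if p = i + 2 then i + 1 else p := by
          simp only [adjSwap, swap_apply_def, Fin.mk.injEq]
          split_ifs <;> rfl
        rw [hval]
        dsimp only
        split_ifs with h1 h2
        · subst h1
          rw [starWord_succ (by omega), mul_assoc, sq _ hi, mul_one]
        · subst h2
          rw [starWord_succ (Nat.succ_pos i), ← mul_assoc, ← mul_assoc, sq _ hi, one_mul]
        · rcases lt_or_gt_of_ne h1 with h | h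
          · exact (starWord_comm_of_lt comm hi p h).symm
          · exact (starWord_comm_of_gt braid comm (by omega) p (by omega) (by omega)).symm
    have hW1 : W 1 = 1 := by
      have := hW 0 1
      have h1 : swap 0 0 * e0 1 = (1 : Perm (Fin (n + 2))) := by
        simp only [e0, Perm.decomposeFin_symm_of_one, swap_self]
        rfl
      rw [h1] at this
      simpa [starWord] using this
    have hadjW : ∀ i (hi : i < n + 1), W (adjSwap i hi) = s i := fun i hi => by
      simpa [hW1] using hgen i hi 1
    have hmul : ∀ σ τ, W (σ * τ) = W σ * W τ := by
      intro σ
      have hσ : σ ∈ Submonoid.closure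
          (Set.range fun i : Fin (n + 1) => (swap i.castSucc i.succ : Perm (Fin (n + 2)))) := by
        rw [Perm.mclosure_swap_castSucc_succ]
        trivial
      induction hσ using Submonoid.closure_induction with
      | mem x hx =>
        obtain ⟨i, rfl⟩ := hx
        intro τ
        exact (hgen i i.2 τ).trans (congrArg (· * _) (hadjW i i.2).symm)
      | one => simp [hW1]
      | mul a b _ _ ha hb => intro τ; rw [mul_assoc, ha, hb, ha, mul_assoc (W a)]
    exact ⟨⟨⟨W, hW1⟩, hmul⟩, hadjW⟩

/-- To prove a statement about all permutations of `Fin (n + 1)`, it is enough to treat products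
and adjacent transpositions. -/
theorem perm_induction_adjSwap {P : Perm (Fin (n + 1)) → Prop} (σ : Perm (Fin (n + 1)))
    (one : P 1) (mul : ∀ σ τ, P σ → P τ → P (σ * τ)) (adj : ∀ i hi, P (adjSwap i hi)) : P σ := by
  have hσ : σ ∈ Submonoid.closure
      (Set.range fun i : Fin n => (swap i.castSucc i.succ : Perm (Fin (n + 1)))) := by
    rw [Perm.mclosure_swap_castSucc_succ]
    trivial
  induction hσ using Submonoid.closure_induction with
  | mem x hx =>
    obtain ⟨i, rfl⟩ := hx
    exact adj i i.2
  | one => exact one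
  | mul a b _ _ ha hb => exact mul a b ha hb

/-- To prove a statement about all permutations of `Fin (n + 1)` fixing `0`, it is enough to treat
products and adjacent transpositions fixing `0`. -/
theorem perm_induction_of_fix_zero {P : Perm (Fin (n + 1)) → Prop} (σ : Perm (Fin (n + 1)))
    (hσ : σ 0 = 0) (one : P 1) (mul : ∀ σ τ, P σ → P τ → P (σ * τ))
    (adj : ∀ i hi, 0 < i → P (adjSwap i hi)) : P σ := by
  obtain ⟨⟨p, e⟩, rfl⟩ := Perm.decomposeFin.symm.surjective σ
  obtain rfl : p = 0 := by simpa using hσ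
  rcases n with _ | n
  · rwa [Subsingleton.elim (Perm.decomposeFin.symm (0, e)) 1]
  induction e using perm_induction_adjSwap with
  | one =>
    rw [Perm.decomposeFin_symm_of_one, swap_self]
    exact one
  | mul a b ha hb =>
    rw [decomposeFin_symm_zero_mul]
    exact mul _ _ (ha (by simp)) (hb (by simp))
  | adj i hi =>
    rw [adjSwap, decomposeFin_symm_zero_swap]
    exact adj (i + 1) (by omega) (by omega)

theorem adjSwap_val (i : Fin (n + 1)) (h : i.val + 1 < n + 1) :
    adjSwap i.val (by omega) = swap i (i + 1) := by
  have : (⟨i.val + 1, h⟩ : Fin (n + 1)) = i + 1 :=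
    Fin.ext (Fin.val_add_one_of_lt' h).symm
  rw [adjSwap, this]

theorem adjSwap_eq (i : ℕ) (h : i < n) :
    adjSwap i h = swap (⟨i, by omega⟩ : Fin (n + 1)) (⟨i, by omega⟩ + 1) :=
  adjSwap_val ⟨i, by omega⟩ (by simpa using h)

/-- The Coxeter presentation of the symmetric group: existence of the homomorphism. -/
theorem exists_permHom (s : Fin (n + 1) → G) (sq : ∀ i, s i * s i = 1)
    (braid : ∀ i, i.val + 2 < n + 1 → s i * s (i + 1) * s i = s (i + 1) * s i * s (i + 1))
    (comm : ∀ i j, i.val + 1 < j.val → j.val + 1 < n + 1 → s i * s j = s j * s i) :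
    ∃ w : Perm (Fin (n + 1)) →* G, ∀ i, i.val + 1 < n + 1 → w (swap i (i + 1)) = s i := by
  obtain ⟨w, hw⟩ := exists_permHom_of_braid n (fun j => s (Fin.ofNat (n + 1) j))
    (fun i _ => sq _)
    (fun i hi => by
      have h1 : Fin.ofNat (n + 1) (i + 1) = Fin.ofNat (n + 1) i + 1 := by
        simp [Fin.ext_iff, Fin.val_add]
      rw [h1]
      refine braid _ ?_
      simp only [Fin.val_ofNat]
      rw [Nat.mod_eq_of_lt] <;> omega)
    (fun i j hij hj => by
      have h1 : i % (n + 1) = i := Nat.mod_eq_of_lt (by omega)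
      have h2 : j % (n + 1) = j := Nat.mod_eq_of_lt (by omega)
      apply comm <;> simp only [Fin.val_ofNat, h1, h2] <;> omega)
  refine ⟨w, fun i hi => ?_⟩
  rw [← adjSwap_val i hi, hw]
  simp

theorem perm_induction {P : Perm (Fin (n + 1)) → Prop} (σ : Perm (Fin (n + 1)))
    (one : P 1) (mul : ∀ σ τ, P σ → P τ → P (σ * τ))
    (adj : ∀ i : Fin (n + 1), i.val + 1 < n + 1 → P (swap i (i + 1))) : P σ :=
  perm_induction_adjSwap σ one mul fun i hi => by
    rw [adjSwap_eq]
    exact adj _ (by simpa using hi)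

theorem perm_induction_fix_zero {P : Perm (Fin (n + 1)) → Prop} (σ : Perm (Fin (n + 1)))
    (hσ : σ 0 = 0) (one : P 1) (mul : ∀ σ τ, P σ → P τ → P (σ * τ))
    (adj : ∀ i : Fin (n + 1), i.val + 1 < n + 1 → 0 < i.val → P (swap i (i + 1))) : P σ :=
  perm_induction_of_fix_zero σ hσ one mul fun i hi h0 => by
    rw [adjSwap_eq]
    exact adj _ (by simpa using hi) h0

theorem prod_adjSwap_apply (m : ℕ) (hm : m ≤ n) (j : Fin (n + 1)) :
    ((((List.finRange n).take m).map fun i : Fin n =>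
      (swap i.castSucc i.succ : Perm (Fin (n + 1)))).prod j).val
      = if j.val < m then j.val + 1 else if j.val = m then 0 else j.val := by
  induction m generalizing j with
  | zero =>
    simp only [List.take_zero, List.map_nil, List.prod_nil, Perm.coe_one, id, not_lt_zero,
      if_false]
    split_ifs with h
    · exact h
    · rfl
  | succ m ih =>
    rw [List.take_succ_eq_append_getElem (by simpa using hm), List.map_append, List.prod_append,
      Perm.mul_apply, ih (by omega)]
    simp only [List.getElem_finRange, List.map_cons, List.map_nil, List.prod_cons, List.prod_nil,
      mul_one, swap_apply_def, Fin.ext_iff, Fin.val_castSucc, Fin.val_succ, Fin.val_cast]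
    split_ifs <;> simp_all <;> omega

/-- Identifies the group element in π = X₁ s₁⋯s_{N-1} as the cycle i ↦ i + 1, so that later
computations with π need no words. -/
theorem prod_adjSwap_eq_finRotate :
    ((List.finRange (n + 1)).dropLast.map fun i =>
      (swap i (i + 1) : Perm (Fin (n + 1)))).prod = finRotate (n + 1) := by
  have h1 : (List.finRange (n + 1)).dropLast = (List.finRange n).map Fin.castSucc := by
    rw [List.finRange_succ_last, List.dropLast_concat]
  have h2 : ((List.finRange (n + 1)).dropLast.map fun i => (swap i (i + 1) : Perm (Fin (n + 1))))
      = ((List.finRange n).take n).map fun i => swap i.castSucc i.succ := by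
    rw [h1, List.map_map, List.take_of_length_le (by simp)]
    exact List.map_congr_left fun i _ => by simp
  rw [h2]
  ext j
  rw [prod_adjSwap_apply n le_rfl, finRotate_apply, Fin.val_add_one]
  split_ifs <;> simp_all [Fin.ext_iff] <;> omega

end SymmetricGroup
end CycDAHA

namespace CycDAHA

open Equiv

/-! ### Families permuted by the symmetric group. -/

section Equivariant

variable {A : Type*} [Ring A] {n : ℕ} (w : Perm (Fin (n + 1)) →* A)

theorem permHom_inv_mul (σ : Perm (Fin (n + 1))) : w σ⁻¹ * w σ = 1 := by
  rw [← map_mul, inv_mul_cancel, map_one]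

theorem permHom_mul_inv (σ : Perm (Fin (n + 1))) : w σ * w σ⁻¹ = 1 := by
  rw [← map_mul, mul_inv_cancel, map_one]

theorem permHom_swap_mul_self (i j : Fin (n + 1)) : w (swap i j) * w (swap i j) = 1 := by
  rw [← map_mul, swap_mul_self, map_one]

theorem permHom_mul_right_cancel (σ : Perm (Fin (n + 1))) {a b : A} (h : a * w σ = b * w σ) :
    a = b := by
  have := congrArg (· * w σ⁻¹) h
  simpa only [mul_assoc, permHom_mul_inv, mul_one] using this

theorem permHom_mul_left_cancel (σ : Perm (Fin (n + 1))) {a b : A} (h : w σ * a = w σ * b) :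
    a = b := by
  have := congrArg (w σ⁻¹ * ·) h
  simpa only [← mul_assoc, permHom_inv_mul, one_mul] using this

/-- A family of elements permuted by the symmetric group. -/
def IsEquivariant (x : Fin (n + 1) → A) : Prop :=
  ∀ σ i, w σ * x i = x (σ i) * w σ

variable {w}

theorem isEquivariant_of_adj {x : Fin (n + 1) → A}
    (h : ∀ i : Fin (n + 1), i.val + 1 < n + 1 → ∀ j,
      w (swap i (i + 1)) * x j = x (swap i (i + 1) j) * w (swap i (i + 1))) :
    IsEquivariant w x := by
  intro σ
  induction σ using perm_induction with
  | one => simp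
  | mul σ τ hσ hτ => intro i; rw [map_mul, mul_assoc, hτ, ← mul_assoc, hσ, Perm.mul_apply, mul_assoc]
  | adj i hi => exact h i hi

theorem comm_permHom_of_fix_zero {a : A}
    (h : ∀ i : Fin (n + 1), i.val + 1 < n + 1 → 0 < i.val →
      w (swap i (i + 1)) * a = a * w (swap i (i + 1)))
    (σ : Perm (Fin (n + 1))) (hσ : σ 0 = 0) : w σ * a = a * w σ := by
  refine perm_induction_fix_zero (P := fun σ => w σ * a = a * w σ) σ hσ (by simp) ?_ h
  intro σ τ hσ hτ
  rw [map_mul, mul_assoc, hτ, ← mul_assoc, hσ, mul_assoc]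

/-- Write σ = (0, σ i) τ (0, i); then τ fixes 0 and therefore commutes with `a`. This produces the
families X_i and D_i from X₁ and D₁. -/
theorem isEquivariant_conj_swap {a : A}
    (h : ∀ σ : Perm (Fin (n + 1)), σ 0 = 0 → w σ * a = a * w σ) :
    IsEquivariant w fun i => w (swap 0 i) * a * w (swap 0 i) := by
  intro σ i
  have h1 : σ = swap 0 (σ i) * (swap 0 (σ i) * σ * swap 0 i) * swap 0 i := by
    simp [mul_assoc]
  have h2 := h (swap 0 (σ i) * σ * swap 0 i) (by simp)
  dsimp only
  calc w σ * (w (swap 0 i) * a * w (swap 0 i))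
      = w (swap 0 (σ i)) * (w (swap 0 (σ i) * σ * swap 0 i) * a) * w (swap 0 i) := by
        conv_lhs => rw [h1]
        simp only [map_mul, mul_assoc]
        rw [← mul_assoc (w (swap 0 i)) (w (swap 0 i)), permHom_swap_mul_self, one_mul]
    _ = w (swap 0 (σ i)) * a * w (swap 0 (σ i)) * w σ := by
        rw [h2]
        simp only [map_mul, mul_assoc, permHom_swap_mul_self, mul_one]

theorem IsEquivariant.eq_conj_swap {x : Fin (n + 1) → A} (hx : IsEquivariant w x)
    (i : Fin (n + 1)) : x i = w (swap 0 i) * x 0 * w (swap 0 i) := by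
  rw [hx, swap_apply_left, mul_assoc, permHom_swap_mul_self, mul_one]

theorem exists_perm_apply_pair {α : Type*} [DecidableEq α] {a b c d : α} (hab : a ≠ b)
    (hcd : c ≠ d) : ∃ σ : Perm α, σ a = c ∧ σ b = d := by
  refine ⟨swap (swap a c b) d * swap a c, ?_, by simp⟩
  rw [Perm.mul_apply, swap_apply_left]
  refine swap_apply_of_ne_of_ne (fun h => hab ?_) hcd
  rw [← (swap a c).injective.eq_iff, ← h, swap_apply_left]

/-- The symmetric group is 2-transitive, so one commuting pair with distinct indices conjugates to
every other pair. -/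
theorem IsEquivariant.commute {x : Fin (n + 1) → A} (hx : IsEquivariant w x)
    {a b : Fin (n + 1)} (hab : a ≠ b) (h : Commute (x a) (x b)) (i j : Fin (n + 1)) :
    Commute (x i) (x j) := by
  rcases eq_or_ne i j with rfl | hij
  · exact Commute.refl _
  obtain ⟨σ, rfl, rfl⟩ := exists_perm_apply_pair hab hij
  refine permHom_mul_right_cancel w σ ?_
  rw [mul_assoc, ← hx, ← mul_assoc, ← hx, mul_assoc, h.eq, ← mul_assoc, hx, mul_assoc, hx,
    ← mul_assoc]

/-- If `x 0 * x 1` commutes with the transposition `(0, 1)`, then the family `x` is commutative. -/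
theorem IsEquivariant.commute_of_swap {x : Fin (n + 1) → A} (hx : IsEquivariant w x)
    (h : w (swap 0 1) * (x 0 * x 1) = x 0 * x 1 * w (swap 0 1)) (i j : Fin (n + 1)) :
    Commute (x i) (x j) := by
  rcases n with _ | n
  · obtain rfl : i = j := by omega
    exact Commute.refl _
  refine hx.commute (zero_ne_one) (permHom_mul_right_cancel w (swap 0 1) ?_) i j
  rw [← h, ← mul_assoc, hx, mul_assoc, hx, swap_apply_left, swap_apply_right, mul_assoc]

end Equivariant

/-! ### The degenerate affine Hecke algebra. -/

section Hecke

variable {R A : Type*} [CommRing R] [Ring A] [Algebra R A] {n : ℕ}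

/-- The relations of the degenerate affine Hecke algebra of type `GL`. -/
structure IsDegHecke (k : R) (w : Perm (Fin (n + 1)) →* A) (y : Fin (n + 1) → A) : Prop where
  s_y (i : Fin (n + 1)) : i.val + 1 < n + 1 →
    w (swap i (i + 1)) * y i = y (i + 1) * w (swap i (i + 1)) + algebraMap R A k
  s_y_comm (i j : Fin (n + 1)) : i.val + 1 < n + 1 → j ≠ i → j ≠ i + 1 →
    w (swap i (i + 1)) * y j = y j * w (swap i (i + 1))
  y_comm (i j : Fin (n + 1)) : y i * y j = y j * y i

/-- The element `y_i + k ∑_{j < i} s_{ij}`; these elements are permuted by the symmetric group. -/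
def balanced (k : R) (w : Perm (Fin (n + 1)) →* A) (y : Fin (n + 1) → A) (i : Fin (n + 1)) : A :=
  y i + k • ∑ j ∈ Finset.Iio i, w (swap j i)

variable {k : R} {w : Perm (Fin (n + 1)) →* A} {y : Fin (n + 1) → A}

theorem balanced_zero : balanced k w y 0 = y 0 := by
  have : Finset.Iio (0 : Fin (n + 1)) = ∅ := by ext; simp
  simp [balanced, this]

theorem permHom_mul_swap (σ : Perm (Fin (n + 1))) (i j : Fin (n + 1)) :
    w σ * w (swap i j) = w (swap (σ i) (σ j)) * w σ := by
  rw [← map_mul, mul_swap_eq_swap_mul, map_mul]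

/-- Passing from i to i + 1 adds the summand k s_{i,i+1}; multiplied by s_{i,i+1} on the right it is
exactly the scalar k in s_i y_i = y_{i+1} s_i + k. -/
theorem IsDegHecke.isEquivariant_balanced (h : IsDegHecke k w y) :
    IsEquivariant w (balanced k w y) := by
  refine isEquivariant_of_adj fun i hi => ?_
  have hi1 : (i + 1).val = i.val + 1 := Fin.val_add_one_of_lt' hi
  have key : w (swap i (i + 1)) * balanced k w y i
      = balanced k w y (i + 1) * w (swap i (i + 1)) := by
    have hI : Finset.Iio (i + 1) = insert i (Finset.Iio i) := by
      ext j
      simp only [Finset.mem_Iio, Finset.mem_insert, Fin.lt_def, Fin.ext_iff, hi1]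
      omega
    have hs : w (swap i (i + 1)) * ∑ j ∈ Finset.Iio i, w (swap j i)
        = (∑ j ∈ Finset.Iio i, w (swap j (i + 1))) * w (swap i (i + 1)) := by
      rw [Finset.mul_sum, Finset.sum_mul]
      refine Finset.sum_congr rfl fun j hj => ?_
      rw [permHom_mul_swap, swap_apply_left, swap_apply_of_ne_of_ne (a := i)] <;>
        simp only [Finset.mem_Iio, Fin.lt_def, ne_eq, Fin.ext_iff, hi1] at hj ⊢ <;> omega
    simp only [balanced, hI, Finset.sum_insert, Finset.mem_Iio, lt_irrefl, not_false_eq_true,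
      mul_add, add_mul, h.s_y i hi, mul_smul_comm, smul_mul_assoc, smul_add, hs,
      permHom_swap_mul_self, add_assoc, Algebra.algebraMap_eq_smul_one]
  intro j
  rcases eq_or_ne j i with rfl | hji
  · rw [key, swap_apply_left]
  rcases eq_or_ne j (i + 1) with rfl | hji1
  · rw [swap_apply_right]
    refine permHom_mul_right_cancel w (swap i (i + 1)) ?_
    rw [mul_assoc, ← key, ← mul_assoc, permHom_swap_mul_self, one_mul, mul_assoc,
      permHom_swap_mul_self, mul_one]
  · rw [swap_apply_of_ne_of_ne hji hji1]
    have hs : w (swap i (i + 1)) * ∑ m ∈ Finset.Iio j, w (swap m j)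
        = (∑ m ∈ Finset.Iio j, w (swap m j)) * w (swap i (i + 1)) := by
      rw [Finset.mul_sum, Finset.sum_mul]
      refine Finset.sum_equiv (swap i (i + 1)) (fun m => ?_) fun m _ => ?_
      · simp only [ne_eq, Fin.ext_iff, hi1] at hji hji1
        simp only [Finset.mem_Iio, Fin.lt_def, swap_apply_def, Fin.ext_iff]
        split_ifs <;> omega
      · rw [permHom_mul_swap, swap_apply_of_ne_of_ne hji hji1]
    simp only [balanced, mul_add, add_mul, h.s_y_comm i j hi hji hji1, mul_smul_comm,
      smul_mul_assoc, hs]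

/-- Rotation sends the transpositions (j, i) with j < i to (j+1, i+1), which are all those occurring
at index i + 1 except (0, i+1). Comparing with π y_i = y_{i+1} π will give the commutator of y_{i+1}
with X₁. -/
theorem IsDegHecke.finRotate_mul_y (h : IsDegHecke k w y) {i : Fin (n + 1)}
    (hi : i.val + 1 < n + 1) :
    w (finRotate (n + 1)) * y i
      = (y (i + 1) + k • w (swap 0 (i + 1))) * w (finRotate (n + 1)) := by
  have hi1 : (i + 1).val = i.val + 1 := Fin.val_add_one_of_lt' hi
  have h1 := h.isEquivariant_balanced (finRotate (n + 1)) i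
  have hI : Finset.Iio (i + 1) = insert 0 ((Finset.Iio i).map (finRotate (n + 1)).toEmbedding) := by
    ext j
    simp only [Finset.mem_Iio, Finset.mem_insert, Finset.mem_map_equiv, Fin.lt_def, Fin.ext_iff, hi1]
    obtain ⟨j, rfl⟩ := (finRotate (n + 1)).surjective j
    rw [symm_apply_apply, finRotate_apply, Fin.val_add_one]
    split_ifs <;> simp
  have h0 : (0 : Fin (n + 1)) ∉ (Finset.Iio i).map (finRotate (n + 1)).toEmbedding := by
    simp only [Finset.mem_map_equiv, Finset.mem_Iio]
    have : (finRotate (n + 1)).symm 0 = Fin.last n := by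
      rw [symm_apply_eq, finRotate_apply, Fin.last_add_one]
    rw [this]
    exact not_lt.2 (Fin.le_last i)
  simp only [balanced, finRotate_apply, hI, Finset.sum_insert h0, mul_add, add_mul, mul_smul_comm,
    smul_mul_assoc, smul_add, Finset.mul_sum, Finset.sum_mul, permHom_mul_swap,
    Finset.sum_map, Equiv.coe_toEmbedding, ← add_assoc] at h1
  simpa [add_mul] using h1

/-- Rotation carries the last index to 0, where there is no correction term, so the whole sum of
transpositions appears on the other side. -/
theorem IsDegHecke.finRotate_mul_y_last (h : IsDegHecke k w y) :
    w (finRotate (n + 1)) * y (Fin.last n)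
      = (y 0 - k • ∑ j ∈ Finset.univ.erase 0, w (swap 0 j)) * w (finRotate (n + 1)) := by
  have h1 := h.isEquivariant_balanced (finRotate (n + 1)) (Fin.last n)
  have hl : finRotate (n + 1) (Fin.last n) = 0 := by rw [finRotate_apply, Fin.last_add_one]
  have hE : Finset.univ.erase (0 : Fin (n + 1))
      = (Finset.Iio (Fin.last n)).map (finRotate (n + 1)).toEmbedding := by
    ext j
    simp only [Finset.mem_erase, Finset.mem_univ, and_true, Finset.mem_map_equiv, Finset.mem_Iio]
    obtain ⟨j, rfl⟩ := (finRotate (n + 1)).surjective j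
    rw [symm_apply_apply, ← hl, (finRotate (n + 1)).injective.ne_iff, Fin.lt_last_iff_ne_last]
  rw [hl, balanced_zero, balanced, mul_add, mul_smul_comm, Finset.mul_sum] at h1
  rw [eq_sub_of_add_eq h1, hE, sub_mul, Finset.sum_map, smul_mul_assoc, Finset.sum_mul]
  congr 2
  refine Finset.sum_congr rfl fun j _ => ?_
  rw [permHom_mul_swap, hl, swap_comm]
  rfl

end Hecke

end CycDAHA

namespace CycDAHA

open Equiv

/-! ### Products of linear factors and their exchange rules. -/

section ProdSub

variable {R A : Type*} [CommRing R] [Ring A] [Algebra R A]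

@[simp]
theorem prodSub_nil (a : A) : prodSub ([] : List R) a = 1 := rfl

@[simp]
theorem prodSub_cons (z : R) (zs : List R) (a : A) :
    prodSub (z :: zs) a = (a - algebraMap R A z) * prodSub zs a := by
  simp [prodSub]

theorem map_prodSub {B : Type*} [Ring B] [Algebra R B] (f : A →ₐ[R] B) (zs : List R) (a : A) :
    f (prodSub zs a) = prodSub zs (f a) := by
  induction zs with
  | nil => simp
  | cons z zs ih => simp [ih]

theorem map_sumInsert {B : Type*} [Ring B] [Algebra R B] (f : A →ₐ[R] B) {l : ℕ} (z : Fin l → R)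
    (a m b : A) : f (sumInsert z a m b) = sumInsert z (f a) (f m) (f b) := by
  simp [sumInsert, map_prodSub]

theorem mul_prodSub_of_mul_eq {x a b : A} (h : x * a = b * x) (zs : List R) :
    x * prodSub zs a = prodSub zs b * x := by
  induction zs with
  | nil => simp
  | cons z zs ih =>
    rw [prodSub_cons, prodSub_cons, ← mul_assoc, mul_sub, h, ← Algebra.commutes z x, ← sub_mul,
      mul_assoc, ih, mul_assoc]

theorem commute_prodSub {x a : A} (h : Commute x a) (zs : List R) : Commute x (prodSub zs a) :=
  mul_prodSub_of_mul_eq h zs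

/-- Telescoping: `x` is moved through the factors one at a time and leaves `m` behind at each place.
This is the source of the sums in the relations for D₁ and X_m. -/
theorem prodSub_mul_sub {l : ℕ} (z : Fin l → R) {x a b m : A} (h : a * x = x * b + m) :
    prodSub (List.ofFn z) a * x - x * prodSub (List.ofFn z) b = sumInsert z a m b := by
  induction l with
  | zero => simp [sumInsert]
  | succ l ih =>
    have h1 := ih fun i => z i.succ
    have h2 : sumInsert z a m b = m * prodSub (List.ofFn fun i => z i.succ) b
        + (a - algebraMap R A (z 0)) * sumInsert (fun i => z i.succ) a m b := by
      simp only [sumInsert, Fin.sum_univ_succ, List.ofFn_succ, Finset.mul_sum]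
      simp [mul_assoc]
    have h3 : m = (a - algebraMap R A (z 0)) * x - x * (b - algebraMap R A (z 0)) := by
      rw [sub_mul, mul_sub, h, Algebra.commutes]
      abel
    rw [h2, ← h1, List.ofFn_succ, prodSub_cons, prodSub_cons, h3]
    simp only [sub_mul, mul_sub, mul_assoc]
    abel

end ProdSub

namespace DegDAHA

/-! ### The relations for X and y in the degenerate DAHA. -/

section Relations

variable {R : Type} [CommRing R] {n : ℕ} {hb k : R}

local notation "𝓗" => DegDAHA R (n + 1) hb k
local notation "πe" => ((pi R (n + 1) hb k : (DegDAHA R (n + 1) hb k)ˣ) : DegDAHA R (n + 1) hb k)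

theorem s_mul_self (i : Fin (n + 1)) : (s (N := n + 1) R hb k i : 𝓗) * s (N := n + 1) R hb k i = 1 :=
  (s (N := n + 1) R hb k i).val_inv

theorem s_braid (h : 2 < n + 1) (i : Fin (n + 1)) :
    (s (N := n + 1) R hb k i : 𝓗) * s (N := n + 1) R hb k (i + 1) * s (N := n + 1) R hb k i
      = s (N := n + 1) R hb k (i + 1) * s (N := n + 1) R hb k i * s (N := n + 1) R hb k (i + 1) := by
  simpa [s, gen] using RingQuot.mkAlgHom_rel R (DegRel.s_braid (R := R) (hb := hb) (k := k) h i)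

theorem s_comm (i j : Fin (n + 1)) (h₁ : j ≠ i + 1) (h₂ : i ≠ j + 1) :
    (s (N := n + 1) R hb k i : 𝓗) * s (N := n + 1) R hb k j = s (N := n + 1) R hb k j * s (N := n + 1) R hb k i := by
  simpa [s, gen] using RingQuot.mkAlgHom_rel R (DegRel.s_comm (R := R) (hb := hb) (k := k) i j h₁ h₂)

theorem pi_mul_s (i : Fin (n + 1)) : πe * s (N := n + 1) R hb k i = s (N := n + 1) R hb k (i + 1) * πe := by
  simpa [s, pi, gen] using RingQuot.mkAlgHom_rel R (DegRel.pi_s (R := R) (hb := hb) (k := k) i)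

theorem y_comm (i j : Fin (n + 1)) : (y (N := n + 1) R hb k i : 𝓗) * y (N := n + 1) R hb k j = y (N := n + 1) R hb k j * y (N := n + 1) R hb k i := by
  simpa [y, gen] using RingQuot.mkAlgHom_rel R (DegRel.y_comm (R := R) (hb := hb) (k := k) i j)

theorem pi_mul_y (i : Fin (n + 1)) (h : i.val + 1 < n + 1) :
    πe * y (N := n + 1) R hb k i = y (N := n + 1) R hb k (i + 1) * πe := by
  simpa [y, pi, gen] using RingQuot.mkAlgHom_rel R (DegRel.pi_y (R := R) (hb := hb) (k := k) i h)

theorem pi_mul_y_last :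
    πe * y (N := n + 1) R hb k (Fin.last n) = (y (N := n + 1) R hb k 0 - algebraMap R 𝓗 hb) * πe := by
  simpa [y, pi, gen] using RingQuot.mkAlgHom_rel R
    (DegRel.pi_y_last (R := R) (hb := hb) (k := k) (Fin.last n) rfl)

theorem s_mul_y (i : Fin (n + 1)) (h : i.val + 1 < n + 1) :
    (s (N := n + 1) R hb k i : 𝓗) * y (N := n + 1) R hb k i = y (N := n + 1) R hb k (i + 1) * s (N := n + 1) R hb k i + algebraMap R 𝓗 k := by
  simpa [s, y, gen] using RingQuot.mkAlgHom_rel R (DegRel.s_y (R := R) (hb := hb) (k := k) i h)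

theorem s_mul_y_comm (i j : Fin (n + 1)) (h₁ : j ≠ i) (h₂ : j ≠ i + 1) :
    (s (N := n + 1) R hb k i : 𝓗) * y (N := n + 1) R hb k j = y (N := n + 1) R hb k j * s (N := n + 1) R hb k i := by
  simpa [s, y, gen] using
    RingQuot.mkAlgHom_rel R (DegRel.s_y_comm (R := R) (hb := hb) (k := k) i j h₁ h₂)

variable (R n hb k) in
theorem exists_symmHom : ∃ w : Perm (Fin (n + 1)) →* 𝓗,
    ∀ i : Fin (n + 1), i.val + 1 < n + 1 → w (swap i (i + 1)) = s R hb k i := by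
  refine exists_permHom _ s_mul_self (fun i hi => s_braid (by omega) i) fun i j hij hj => ?_
  have h1 : (i + 1).val = i.val + 1 := Fin.val_add_one_of_lt' (by omega)
  have h2 : (j + 1).val = j.val + 1 := Fin.val_add_one_of_lt' (by omega)
  refine s_comm _ _ ?_ ?_ <;> rw [ne_eq, Fin.ext_iff] <;> omega

/-- A homomorphism from the symmetric group extends the non-affine `s_i`. -/
def ExtendsS (w : Perm (Fin (n + 1)) →* 𝓗) : Prop :=
  ∀ i : Fin (n + 1), i.val + 1 < n + 1 → w (swap i (i + 1)) = s R hb k i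

variable {w : Perm (Fin (n + 1)) →* DegDAHA R (n + 1) hb k}

theorem ExtendsS.isDegHecke (hw : ExtendsS w) : IsDegHecke k w (y (N := n + 1) R hb k) where
  s_y i hi := by rw [hw i hi, s_mul_y i hi]
  s_y_comm i j hi h₁ h₂ := by rw [hw i hi, s_mul_y_comm i j h₁ h₂]
  y_comm := y_comm

theorem ExtendsS.val_prod (hw : ExtendsS w) :
    ((((List.finRange (n + 1)).dropLast.map (s (N := n + 1) R hb k)).prod : 𝓗ˣ) : 𝓗)
      = w (finRotate (n + 1)) := by
  rw [← prod_adjSwap_eq_finRotate, ← Units.coeHom_apply, map_list_prod, map_list_prod,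
    List.map_map, List.map_map]
  congr 1
  refine List.map_congr_left fun i hi => ?_
  have h1 : (List.finRange (n + 1)).dropLast = (List.finRange n).map Fin.castSucc := by
    rw [List.finRange_succ_last, List.dropLast_concat]
  rw [h1, List.mem_map] at hi
  obtain ⟨j, -, rfl⟩ := hi
  exact (hw _ (by simp)).symm

/-- The value of the unit `X₁`. -/
local notation "Xe" => ((X₁ R (n + 1) hb k : (DegDAHA R (n + 1) hb k)ˣ) : DegDAHA R (n + 1) hb k)

local notation "Xi" =>
  (((X₁ R (n + 1) hb k)⁻¹ : (DegDAHA R (n + 1) hb k)ˣ) : DegDAHA R (n + 1) hb k)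

theorem ExtendsS.X₁_mul (hw : ExtendsS w) : Xe * w (finRotate (n + 1)) = πe := by
  rw [← hw.val_prod, ← Units.val_mul, X₁, inv_mul_cancel_right]

/-- Both π and the rotation carry s_j to s_{j+1} by conjugation, so their quotient X₁ commutes with
the adjacent transpositions that fix 0. -/
theorem ExtendsS.permHom_mul_X₁ (hw : ExtendsS w) (σ : Perm (Fin (n + 1))) (hσ : σ 0 = 0) :
    w σ * Xe = Xe * w σ := by
  refine comm_permHom_of_fix_zero (fun i hi h0 => ?_) σ hσ
  refine permHom_mul_right_cancel w (finRotate (n + 1)) ?_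
  obtain ⟨j, rfl⟩ : ∃ j : Fin (n + 1), i = j + 1 := ⟨i - 1, by simp⟩
  have hj : j.val + 1 < n + 1 := by
    rw [Fin.val_add_one] at h0
    split_ifs at h0 with h
    · omega
    · have := j.2
      rw [Fin.ext_iff, Fin.val_last] at h
      omega
  have h1 : Xe * w (finRotate (n + 1)) * s R hb k j
      = s (N := n + 1) R hb k (j + 1) * (Xe * w (finRotate (n + 1))) := by
    rw [hw.X₁_mul, pi_mul_s]
  rw [← hw _ hj, ← hw _ hi, mul_assoc, permHom_mul_swap, finRotate_apply, finRotate_apply] at h1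
  simpa only [mul_assoc] using h1.symm

theorem ExtendsS.isEquivariant_X (hw : ExtendsS w) : IsEquivariant w (X w) :=
  isEquivariant_conj_swap hw.permHom_mul_X₁

theorem X_zero : X w 0 = Xe := by
  rw [X, swap_self]
  change w 1 * _ * w 1 = _
  simp

theorem pi_sq_mul_s (j : Fin (n + 1)) :
    πe * πe * s (N := n + 1) R hb k j = s (N := n + 1) R hb k (j + 1 + 1) * (πe * πe) := by
  rw [mul_assoc, pi_mul_s, ← mul_assoc, pi_mul_s, mul_assoc]

/-- With r the rotation, π² = X₁X₂r². Conjugation by π² sends the last adjacent transposition,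
through the affine reflection, to (0, 1), and so does conjugation by r². Hence X₁X₂ commutes with
(0, 1), which says X₁X₂ = X₂X₁. -/
theorem ExtendsS.X_comm (hw : ExtendsS w) (i j : Fin (n + 1)) : Commute (X w i) (X w j) := by
  rcases n with _ | n
  · obtain rfl : i = j := by omega
    exact Commute.refl _
  refine hw.isEquivariant_X.commute_of_swap ?_ i j
  set r := finRotate (n + 1 + 1) with hr
  have hl1 : (Fin.last n).castSucc + 1 = Fin.last (n + 1) := by simp
  have hl2 : Fin.last (n + 1) + 1 = 0 := Fin.last_add_one _
  have hsq : (pi R (n + 1 + 1) hb k : DegDAHA R (n + 1 + 1) hb k) * pi R (n + 1 + 1) hb k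
      = X w 0 * X w 1 * (w r * w r) := by
    rw [← hw.X₁_mul, ← X_zero (w := w), ← hr, mul_assoc, ← mul_assoc (w r), hw.isEquivariant_X]
    simp [r, mul_assoc]
  have h1 := pi_sq_mul_s (R := R) (hb := hb) (k := k) (Fin.last n).castSucc
  rw [hl1, hl2, hsq, ← hw _ (by simp), ← hw _ (by simp), hl1, mul_assoc, mul_assoc (w r),
    permHom_mul_swap, ← mul_assoc (w r), permHom_mul_swap] at h1
  simp only [r, finRotate_apply, hl1, hl2, zero_add] at h1
  refine permHom_mul_right_cancel w r (permHom_mul_right_cancel w r ?_)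
  simpa only [mul_assoc] using h1.symm

theorem ExtendsS.y_mul_X₁ (hw : ExtendsS w) (j : Fin (n + 1)) (hj : j ≠ 0) :
    y (N := n + 1) R hb k j * Xe = Xe * (y (N := n + 1) R hb k j + k • w (swap 0 j)) := by
  refine permHom_mul_right_cancel w (finRotate (n + 1)) ?_
  obtain ⟨i, rfl⟩ : ∃ i : Fin (n + 1), j = i + 1 := ⟨j - 1, by simp⟩
  have hi : i.val + 1 < n + 1 := by
    have h2 := i.2
    have h : i ≠ Fin.last n := fun h => hj (by rw [h, Fin.last_add_one])
    rw [ne_eq, Fin.ext_iff, Fin.val_last] at h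
    omega
  rw [mul_assoc, hw.X₁_mul, ← pi_mul_y i hi, ← hw.X₁_mul, mul_assoc,
    hw.isDegHecke.finRotate_mul_y hi, mul_assoc]

theorem ExtendsS.y_zero_mul_X₁ (hw : ExtendsS w) :
    y (N := n + 1) R hb k 0 * Xe = Xe * (y (N := n + 1) R hb k 0 + algebraMap R 𝓗 hb
      - k • ∑ j ∈ Finset.univ.erase 0, w (swap 0 j)) := by
  refine permHom_mul_right_cancel w (finRotate (n + 1)) ?_
  have h1 := pi_mul_y_last (R := R) (n := n) (hb := hb) (k := k)
  rw [sub_mul, eq_sub_iff_add_eq, ← hw.X₁_mul, mul_assoc, hw.isDegHecke.finRotate_mul_y_last] at h1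
  rw [mul_assoc, ← h1, Algebra.commutes]
  simp only [mul_add, mul_sub, add_mul, sub_mul, mul_assoc, Algebra.commutes hb (w _)]
  abel

/-- All transpositions in the corrected element at m other than (0, m) fix 0 and hence commute with
X₁. In this form the relation can be conjugated by (0, m), which replaces the corrected element by
y₁. -/
theorem ExtendsS.balanced_mul_X₁ (hw : ExtendsS w) (m : Fin (n + 1)) (hm : m ≠ 0) :
    balanced k w (y (N := n + 1) R hb k) m * Xe
      = Xe * balanced k w (y (N := n + 1) R hb k) m + k • (X w m * w (swap 0 m)) := by
  have hI : Finset.Iio m = insert 0 ((Finset.Iio m).erase 0) := by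
    rw [Finset.insert_erase]
    simpa using Fin.pos_iff_ne_zero.2 hm
  have h0 : w (swap 0 m) * Xe = X w m * w (swap 0 m) := by
    rw [← X_zero (w := w), hw.isEquivariant_X, swap_apply_left]
  have hs : (∑ j ∈ (Finset.Iio m).erase 0, w (swap j m)) * Xe
      = Xe * ∑ j ∈ (Finset.Iio m).erase 0, w (swap j m) := by
    rw [Finset.mul_sum, Finset.sum_mul]
    refine Finset.sum_congr rfl fun j hj => hw.permHom_mul_X₁ _ ?_
    exact swap_apply_of_ne_of_ne (Finset.ne_of_mem_erase hj).symm hm.symm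
  rw [balanced, hI, Finset.sum_insert (Finset.notMem_erase _ _), add_mul, hw.y_mul_X₁ m hm,
    smul_mul_assoc, add_mul, hs, h0]
  simp only [mul_add, mul_smul_comm, smul_add]
  abel

theorem ExtendsS.y_zero_mul_X (hw : ExtendsS w) (m : Fin (n + 1)) (hm : m ≠ 0) :
    y (N := n + 1) R hb k 0 * X w m = X w m * y (N := n + 1) R hb k 0 + k • (Xe * w (swap 0 m)) := by
  refine permHom_mul_right_cancel w (swap 0 m) ?_
  have h1 := congrArg (w (swap 0 m) * ·) (hw.balanced_mul_X₁ m hm)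
  have hu := hw.isDegHecke.isEquivariant_balanced
  have hX := hw.isEquivariant_X
  rw [← X_zero (w := w)] at h1 ⊢
  simp only [mul_add, mul_smul_comm, ← mul_assoc, hu _ m, hX _ m, hX _ 0, swap_apply_left,
    swap_apply_right, balanced_zero] at h1
  simp only [add_mul, smul_mul_assoc, mul_assoc, permHom_swap_mul_self, mul_one, hX _ 0, hu _ m,
    swap_apply_left, swap_apply_right, balanced_zero] at h1 ⊢
  exact h1

theorem Xi_mul_Xe : Xi * Xe = 1 := (X₁ R (n + 1) hb k).inv_val

theorem Xe_mul_Xi : Xe * Xi = 1 := (X₁ R (n + 1) hb k).val_inv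

theorem mul_Xi_of_mul_Xe {a b : 𝓗} (h : a * Xe = Xe * b) : Xi * a = b * Xi := by
  have := congrArg (fun t => Xi * t * Xi) h
  simpa only [mul_assoc, Xe_mul_Xi, mul_one, ← mul_assoc Xi Xe, Xi_mul_Xe, one_mul] using this

/-! ### The relations for D in the degenerate DAHA. -/

section Cyclotomic

variable {l : ℕ} (z : Fin l → R)

local notation "Pe" => prodSub (List.ofFn z) (y (N := n + 1) R hb k 0)

theorem D_zero : D z w 0 = D₁ R (n + 1) hb k z := by
  rw [D, swap_self]
  change w 1 * _ * w 1 = _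
  simp

theorem X_zero_mul_D_zero : X w 0 * D z w 0 = Pe := by
  rw [X_zero, D_zero, D₁, ← mul_assoc, Xe_mul_Xi, one_mul]

theorem ExtendsS.permHom_mul_y_zero (hw : ExtendsS w) (σ : Perm (Fin (n + 1))) (hσ : σ 0 = 0) :
    w σ * y (N := n + 1) R hb k 0 = y (N := n + 1) R hb k 0 * w σ := by
  have := hw.isDegHecke.isEquivariant_balanced σ 0
  rwa [hσ, balanced_zero] at this

theorem ExtendsS.isEquivariant_D (hw : ExtendsS w) : IsEquivariant w (D z w) := by
  refine isEquivariant_conj_swap fun σ hσ => ?_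
  have h1 := mul_Xi_of_mul_Xe (hw.permHom_mul_X₁ σ hσ)
  rw [D₁, ← mul_assoc, ← h1, mul_assoc, mul_assoc]
  congr 1
  exact commute_prodSub (hw.permHom_mul_y_zero σ hσ) _

theorem ExtendsS.y_mul_D_zero (hw : ExtendsS w) (j : Fin (n + 1)) (hj : j ≠ 0) :
    y (N := n + 1) R hb k j * D z w 0 - D z w 0 * y (N := n + 1) R hb k j
      = -(k • (w (swap 0 j) * D z w 0)) := by
  have h1 := mul_Xi_of_mul_Xe (hw.y_mul_X₁ j hj)
  have h2 : Commute (y (N := n + 1) R hb k j) Pe := commute_prodSub (y_comm j 0) _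
  rw [D_zero, D₁, mul_assoc Xi, ← h2.eq, ← mul_assoc Xi, h1, add_mul, add_mul, smul_mul_assoc,
    smul_mul_assoc]
  simp only [mul_assoc]
  abel

theorem ExtendsS.y_zero_mul_D_zero (hw : ExtendsS w) :
    y (N := n + 1) R hb k 0 * D z w 0 - D z w 0 * y (N := n + 1) R hb k 0
      = -(hb • D z w 0) + k • ((∑ j ∈ Finset.univ.erase 0, w (swap 0 j)) * D z w 0) := by
  have h1 := mul_Xi_of_mul_Xe hw.y_zero_mul_X₁
  have h2 : Commute (y (N := n + 1) R hb k 0) Pe := commute_prodSub (y_comm 0 0) _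
  rw [D_zero, D₁, mul_assoc Xi, ← h2.eq, ← mul_assoc Xi, h1]
  simp only [add_mul, sub_mul, smul_mul_assoc, mul_assoc, Algebra.smul_def hb]
  abel

/-- Apply the telescoping formula to x = X₁⁻¹X_m, which intertwines y₁ + ħ - k∑s_{1j} and y₁ up to k
s_{1m}; here X_m and X₁⁻¹ commute. -/
theorem ExtendsS.D_zero_mul_X (hw : ExtendsS w) (m : Fin (n + 1)) (hm : m ≠ 0) :
    D z w 0 * X w m - X w m * D z w 0 = k • sumInsert z
      (y (N := n + 1) R hb k 0 + algebraMap R 𝓗 hb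
        - k • ∑ j ∈ Finset.univ.erase 0, w (swap 0 j))
      (w (swap 0 m)) (y (N := n + 1) R hb k 0) := by
  have h1 := mul_Xi_of_mul_Xe hw.y_zero_mul_X₁
  have h2 := congrArg (Xi * ·) (hw.y_zero_mul_X m hm)
  simp only [mul_add, mul_smul_comm] at h2
  rw [← mul_assoc, h1, ← mul_assoc Xi (X w m), ← mul_assoc Xi Xe, Xi_mul_Xe, one_mul,
    mul_assoc] at h2
  have h3 := prodSub_mul_sub z h2
  have h4 : k • sumInsert z (y (N := n + 1) R hb k 0 + algebraMap R 𝓗 hb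
        - k • ∑ j ∈ Finset.univ.erase 0, w (swap 0 j)) (w (swap 0 m)) (y (N := n + 1) R hb k 0)
      = sumInsert z (y (N := n + 1) R hb k 0 + algebraMap R 𝓗 hb
        - k • ∑ j ∈ Finset.univ.erase 0, w (swap 0 j)) (k • w (swap 0 m))
        (y (N := n + 1) R hb k 0) := by
    simp [sumInsert, Finset.smul_sum]
  have hc : X w m * Xi = Xi * X w m := by
    refine (mul_Xi_of_mul_Xe ?_).symm
    rw [← X_zero (w := w)]
    exact hw.X_comm m 0
  rw [h4, ← h3, D_zero, D₁, ← mul_assoc (X w m), hc, mul_prodSub_of_mul_eq h1, mul_assoc _ Xi]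

/-- Conjugation by X₁⁻¹ turns P(y₁) into P(y₁ + ħ - k∑s_{1j}), so the commutator is a difference of
two values of P: the telescoping formula with x = 1. -/
theorem ExtendsS.D_zero_mul_X_zero (hw : ExtendsS w) :
    D z w 0 * X w 0 - X w 0 * D z w 0 = sumInsert z
      (y (N := n + 1) R hb k 0 + algebraMap R 𝓗 hb
        - k • ∑ j ∈ Finset.univ.erase 0, w (swap 0 j))
      (algebraMap R 𝓗 hb - k • ∑ j ∈ Finset.univ.erase 0, w (swap 0 j))
      (y (N := n + 1) R hb k 0) := by
  have h1 := mul_Xi_of_mul_Xe hw.y_zero_mul_X₁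
  rw [X_zero_mul_D_zero, X_zero, D_zero, D₁, mul_prodSub_of_mul_eq h1, mul_assoc, Xi_mul_Xe,
    ← prodSub_mul_sub z (x := 1), one_mul]
  rw [mul_one, one_mul]
  abel

/-- The sum and the product of y₁ and y₂ commute with s₁, and therefore so does each symmetric
factor (y₂ - c)(y₁ - c); the commuting factors are regrouped in such pairs. -/
theorem ExtendsS.permHom_mul_prodSub (hw : ExtendsS w) (h01 : (0 : Fin (n + 1)).val + 1 < n + 1)
    (zs : List R) :
    w (swap 0 1) * (prodSub zs (y (N := n + 1) R hb k 1) * prodSub zs (y (N := n + 1) R hb k 0))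
      = prodSub zs (y (N := n + 1) R hb k 1) * prodSub zs (y (N := n + 1) R hb k 0)
        * w (swap 0 1) := by
  induction zs with
  | nil => simp
  | cons c zs ih =>
    have h1 := hw.isDegHecke.s_y 0 h01
    rw [zero_add] at h1
    have h2 : w (swap 0 1) * y (N := n + 1) R hb k 1
        = y (N := n + 1) R hb k 0 * w (swap 0 1) - algebraMap R 𝓗 k := by
      refine permHom_mul_left_cancel w (swap 0 1) ?_
      rw [mul_sub, ← mul_assoc, ← mul_assoc, h1, permHom_swap_mul_self, add_mul, one_mul,
        mul_assoc, permHom_swap_mul_self, mul_one, Algebra.commutes]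
      abel
    set s := w (swap 0 1)
    set a := y (N := n + 1) R hb k 1
    set b := y (N := n + 1) R hb k 0
    set c' := algebraMap R 𝓗 c
    have hk : ∀ t, algebraMap R 𝓗 k * t = t * algebraMap R 𝓗 k := Algebra.commutes k
    have hc : ∀ t, c' * t = t * c' := Algebra.commutes c
    have hab : a * b = b * a := y_comm 1 0
    have h3 : s * ((a - c') * (b - c')) = (a - c') * (b - c') * s := by
      have h4 : (a - c') * (b - c') = a * b - (a + b) * c' + c' * c' := by
        rw [sub_mul, mul_sub, mul_sub, hc b, add_mul]
        abel
      have h5 : s * (a * b) = a * b * s := by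
        rw [← mul_assoc, h2, sub_mul, mul_assoc, h1, mul_add, hk, ← mul_assoc, hab]
        abel
      have h6 : s * (a + b) = (a + b) * s := by
        rw [mul_add, h1, h2, add_mul]
        abel
      have hcs : Commute s c' := (hc s).symm
      rw [h4]
      exact (((show Commute s (a * b) from h5).sub_right
        ((show Commute s (a + b) from h6).mul_right hcs)).add_right (hcs.mul_right hcs)).eq
    have h7 : (b - c') * prodSub zs a = prodSub zs a * (b - c') :=
      commute_prodSub (Commute.sub_left hab.symm (hc a)) zs
    rw [prodSub_cons, prodSub_cons, mul_assoc, ← mul_assoc (prodSub zs a), ← h7, mul_assoc,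
      ← mul_assoc (a - c'), ← mul_assoc, h3, mul_assoc _ s, ih]
    simp only [mul_assoc]

/-- Since D₁ = r π⁻¹ P(y₁), moving P past π⁻¹ gives D₂D₁ = r² π⁻² P(y₂)P(y₁). The last product
commutes with (0, 1), while π⁻² carries (0, 1) to the last adjacent transposition and r² carries it
back. So D₂D₁ commutes with (0, 1), which is commutativity. -/
theorem ExtendsS.D_comm (hw : ExtendsS w) (i j : Fin (n + 1)) : Commute (D z w i) (D z w j) := by
  rcases n with _ | n
  · obtain rfl : i = j := by omega
    exact Commute.refl _
  have hD := hw.isEquivariant_D z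
  refine hD.commute (zero_ne_one) ?_ i j
  set r := finRotate (n + 1 + 1) with hr
  set p := ((pi R (n + 1 + 1) hb k : (DegDAHA R (n + 1 + 1) hb k)ˣ) : DegDAHA R (n + 1 + 1) hb k)
    with hp
  set q := (((pi R (n + 1 + 1) hb k)⁻¹ : (DegDAHA R (n + 1 + 1) hb k)ˣ) :
    DegDAHA R (n + 1 + 1) hb k) with hq
  have hqp : q * p = 1 := (pi R (n + 1 + 1) hb k).inv_val
  have hpq : p * q = 1 := (pi R (n + 1 + 1) hb k).val_inv
  set P := prodSub (List.ofFn z) (y (N := n + 1 + 1) R hb k 0) with hP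
  set P' := prodSub (List.ofFn z) (y (N := n + 1 + 1) R hb k 1) with hP'
  have hD0 : D z w 0 = w r * (q * P) := by
    have : ((X₁ R (n + 1 + 1) hb k)⁻¹ : (DegDAHA R (n + 1 + 1) hb k)ˣ) = w r * q := by
      rw [← hw.val_prod, hq, ← Units.val_mul, X₁, mul_inv_rev, inv_inv]
    rw [D_zero, D₁, this, mul_assoc]
  have hl1 : (Fin.last n).castSucc + 1 = Fin.last (n + 1) := by simp
  have hl2 : Fin.last (n + 1) + 1 = 0 := Fin.last_add_one _
  have hPq : P * q = q * P' := by
    have h1 : p * P = P' * p := by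
      refine mul_prodSub_of_mul_eq ?_ _
      have := pi_mul_y (R := R) (hb := hb) (k := k) (0 : Fin (n + 1 + 1)) (by simp)
      rwa [zero_add] at this
    have := congrArg (fun t => q * t * q) h1
    simpa only [mul_assoc, hpq, mul_one, ← mul_assoc q p, hqp, one_mul] using this
  have hqs : q * q * w (swap 0 1)
      = w (swap (Fin.last n).castSucc (Fin.last (n + 1))) * (q * q) := by
    have h1 := pi_sq_mul_s (R := R) (hb := hb) (k := k) (Fin.last n).castSucc
    rw [hl1, hl2, ← hw _ (by simp), ← hw _ (by simp), hl1, zero_add] at h1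
    have := congrArg (fun t => q * q * t * (q * q)) h1
    have e1 : q * q * (p * p) = 1 := by
      rw [mul_assoc, ← mul_assoc q p, hqp, one_mul, hqp]
    have e2 : p * p * (q * q) = 1 := by
      rw [mul_assoc, ← mul_assoc p q, hpq, one_mul, hpq]
    change q * q * (p * p * _) * (q * q) = q * q * (_ * (p * p)) * (q * q) at this
    rw [← mul_assoc (q * q), e1, one_mul, mul_assoc (q * q), mul_assoc _ (p * p), e2, mul_one] at this
    exact this.symm
  have hsym : w (swap 0 1) * (P' * P) = P' * P * w (swap 0 1) :=
    hw.permHom_mul_prodSub (by simp) _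
  have hsq : q * P * (q * P) = q * q * (P' * P) := by
    rw [mul_assoc, ← mul_assoc P, hPq]
    simp only [mul_assoc]
  have h10 : D z w 1 * D z w 0 = w r * w r * (q * q * (P' * P)) := by
    have : D z w 1 = w r * D z w 0 * w r⁻¹ := by
      rw [hD, mul_assoc, permHom_mul_inv, mul_one]
      simp [r]
    rw [this, mul_assoc, hD0, ← mul_assoc (w r⁻¹), permHom_inv_mul, one_mul, ← hsq]
    simp only [mul_assoc]
  have hsD : w (swap 0 1) * (D z w 1 * D z w 0) = D z w 1 * D z w 0 * w (swap 0 1) := by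
    have hrr : w r * w r * w (swap (Fin.last n).castSucc (Fin.last (n + 1)))
        = w (swap 0 1) * (w r * w r) := by
      rw [mul_assoc, permHom_mul_swap, ← mul_assoc, permHom_mul_swap, mul_assoc]
      simp only [r, finRotate_apply, hl1, hl2, zero_add]
    rw [h10, ← mul_assoc, ← hrr, mul_assoc (w r * w r), ← mul_assoc _ (q * q), ← hqs,
      mul_assoc (q * q), hsym]
    simp only [mul_assoc]
  refine permHom_mul_right_cancel w (swap 0 1) ?_
  rw [← hsD, ← mul_assoc (w _), hD, mul_assoc _ (w (swap 0 1)), hD, swap_apply_left,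
    swap_apply_right, mul_assoc]

end Cyclotomic

end Relations
end DegDAHA
end CycDAHA

/-! ### The homomorphism from the presented algebra and its range. -/

namespace CycDAHA

open Equiv

theorem CycPres.eq_top_of_gen_mem {R : Type} [CommRing R] {N : ℕ} [NeZero N] {hb k : R} {l : ℕ}
    {z : Fin l → R} (T : Subalgebra R (CycPres R N hb k z))
    (h : ∀ g, CycPres.gen R hb k z g ∈ T) : T = ⊤ := by
  rw [eq_top_iff]
  intro x _
  obtain ⟨x, rfl⟩ := RingQuot.mkAlgHom_surjective R (CycRel R N hb k z) x
  have h1 : (⊤ : Subalgebra R (FreeAlgebra R (CycGen N)))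
      ≤ T.comap (RingQuot.mkAlgHom R (CycRel R N hb k z)) := by
    rw [← FreeAlgebra.adjoin_range_ι, Algebra.adjoin_le_iff]
    rintro _ ⟨g, rfl⟩
    exact h g
  exact h1 Algebra.mem_top

namespace DegDAHA

variable {R : Type} [CommRing R] {n : ℕ} {hb k : R} {l : ℕ} (z : Fin l → R)
  {w : Perm (Fin (n + 1)) →* DegDAHA R (n + 1) hb k}

/-- The images of the generators of the presented algebra. -/
def genImage (w : Perm (Fin (n + 1)) →* DegDAHA R (n + 1) hb k) :
    CycGen (n + 1) → DegDAHA R (n + 1) hb k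
  | .s σ => w σ
  | .y i => y R hb k i
  | .X i => X w i
  | .D i => D z w i

theorem lift_genImage_sumSwap :
    FreeAlgebra.lift R (genImage z w) (sumSwap R (n + 1))
      = ∑ j ∈ Finset.univ.erase 0, w (swap 0 j) := by
  simp [sumSwap, genImage]

theorem ExtendsS.lift_genImage_rel (hw : ExtendsS w) ⦃a b : CycFree R (n + 1)⦄
    (h : CycRel R (n + 1) hb k z a b) :
    FreeAlgebra.lift R (genImage z w) a = FreeAlgebra.lift R (genImage z w) b := by
  have hH := hw.isDegHecke
  have hX := hw.isEquivariant_X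
  have hD := hw.isEquivariant_D z
  cases h <;> simp only [map_mul, map_add, map_sub, map_neg, map_smul, map_one, map_prodSub,
    map_sumInsert, lift_genImage_sumSwap, FreeAlgebra.lift_ι_apply, genImage, AlgHom.commutes]
  case s_y i h => exact hH.s_y i h
  case s_y_comm i j h h₁ h₂ => exact hH.s_y_comm i j h h₁ h₂
  case y_comm i j => exact hH.y_comm i j
  case s_X σ i => exact hX σ i
  case X_comm i j => exact hw.X_comm i j
  case y_X i h =>
    rw [X_zero, hw.y_mul_X₁ i h, mul_add, mul_smul_comm]
    abel
  case y_X_zero =>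
    rw [X_zero, hw.y_zero_mul_X₁, mul_sub, mul_add, mul_smul_comm, ← Algebra.commutes,
      ← Algebra.smul_def]
    abel
  case s_D σ i => exact hD σ i
  case D_comm i j => exact hw.D_comm z i j
  case y_D j h => exact hw.y_mul_D_zero z j h
  case y_D_zero => exact hw.y_zero_mul_D_zero z
  case D_X_zero => exact hw.D_zero_mul_X_zero z
  case D_X m h => exact hw.D_zero_mul_X z m h
  case X_D => exact X_zero_mul_D_zero z

/-- The homomorphism from the presented algebra to the degenerate DAHA. -/
def ExtendsS.presHom (hw : ExtendsS w) :
    CycPres R (n + 1) hb k z →ₐ[R] DegDAHA R (n + 1) hb k :=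
  RingQuot.liftAlgHom R ⟨FreeAlgebra.lift R (genImage z w), hw.lift_genImage_rel z⟩

theorem ExtendsS.presHom_gen (hw : ExtendsS w) (g : CycGen (n + 1)) :
    hw.presHom z (CycPres.gen R hb k z g) = genImage z w g := by
  rw [ExtendsS.presHom, CycPres.gen, RingQuot.liftAlgHom_mkAlgHom_apply, FreeAlgebra.lift_ι_apply]

theorem ExtendsS.permHom_mem_cycDAHA (hw : ExtendsS w) (σ : Perm (Fin (n + 1))) :
    w σ ∈ cycDAHA R (n + 1) hb k z := by
  induction σ using perm_induction with
  | one => rw [map_one]; exact one_mem _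
  | mul σ τ hσ hτ => rw [map_mul]; exact mul_mem hσ hτ
  | adj i hi => exact Algebra.subset_adjoin (Or.inl (Or.inl ⟨i, hi, hw i hi⟩))

theorem ExtendsS.D₁_eq (hw : ExtendsS w) :
    D₁ R (n + 1) hb k z = w (finRotate (n + 1)) * piMinus R (n + 1) hb k z := by
  have : ((X₁ R (n + 1) hb k)⁻¹ : (DegDAHA R (n + 1) hb k)ˣ)
      = w (finRotate (n + 1)) * ((pi R (n + 1) hb k)⁻¹ : (DegDAHA R (n + 1) hb k)ˣ) := by
    rw [← hw.val_prod, ← Units.val_mul, X₁, mul_inv_rev, inv_inv]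
  rw [D₁, this, mul_assoc, piMinus]

theorem ExtendsS.genImage_mem_cycDAHA (hw : ExtendsS w) (g : CycGen (n + 1)) :
    genImage z w g ∈ cycDAHA R (n + 1) hb k z := by
  have hσ := hw.permHom_mem_cycDAHA z
  rcases g with σ | i | i | i
  · exact hσ σ
  · exact Algebra.subset_adjoin (Or.inl (Or.inr ⟨i, rfl⟩))
  · refine mul_mem (mul_mem (hσ _) ?_) (hσ _)
    have h1 : (X₁ R (n + 1) hb k : DegDAHA R (n + 1) hb k)
        = pi R (n + 1) hb k * w (finRotate (n + 1))⁻¹ := by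
      rw [← hw.X₁_mul, mul_assoc, permHom_mul_inv, mul_one]
    rw [h1]
    exact mul_mem (Algebra.subset_adjoin (Or.inr (Or.inl rfl))) (hσ _)
  · refine mul_mem (mul_mem (hσ _) ?_) (hσ _)
    rw [hw.D₁_eq z]
    exact mul_mem (hσ _) (Algebra.subset_adjoin (Or.inr (Or.inr rfl)))

theorem ExtendsS.range_presHom (hw : ExtendsS w) :
    (hw.presHom z).range = cycDAHA R (n + 1) hb k z := by
  have hgen : ∀ g, genImage z w g ∈ (hw.presHom z).range :=
    fun g => ⟨CycPres.gen R hb k z g, hw.presHom_gen z g⟩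
  apply le_antisymm
  · have h1 := CycPres.eq_top_of_gen_mem ((cycDAHA R (n + 1) hb k z).comap (hw.presHom z))
      fun g => by
        rw [Subalgebra.mem_comap, hw.presHom_gen]
        exact hw.genImage_mem_cycDAHA z g
    rintro _ ⟨x, rfl⟩
    have : x ∈ (cycDAHA R (n + 1) hb k z).comap (hw.presHom z) := by rw [h1]; trivial
    exact this
  · rw [cycDAHA, Algebra.adjoin_le_iff]
    rintro _ ((⟨i, hi, rfl⟩ | ⟨i, rfl⟩) | (rfl | rfl))
    · rw [← hw i hi]
      exact hgen (.s _)
    · exact hgen (.y i)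
    · rw [← hw.X₁_mul, ← X_zero (w := w)]
      exact mul_mem (hgen (.X 0)) (hgen (.s _))
    · have h1 : piMinus R (n + 1) hb k z = w (finRotate (n + 1))⁻¹ * D z w 0 := by
        rw [D_zero, hw.D₁_eq z, ← mul_assoc, permHom_inv_mul, one_mul]
      rw [h1]
      exact mul_mem (hgen (.s _)) (hgen (.D 0))

end DegDAHA
end CycDAHA

namespace CycDAHA

open Equiv

/-! ### Ordered monomials in commuting elements. -/

section Monom

variable {A : Type*} [Ring A]

theorem prod_ofFn_mul_prod_ofFn {N : ℕ} {f g : Fin N → A} (h : ∀ i j, Commute (f i) (g j)) :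
    (List.ofFn f).prod * (List.ofFn g).prod = (List.ofFn fun i => f i * g i).prod := by
  induction N with
  | zero => simp
  | succ N ih =>
    simp only [List.ofFn_succ, List.prod_cons]
    rw [← ih fun i j => h _ _]
    have h1 : Commute (List.ofFn fun i : Fin N => f i.succ).prod (g 0) := by
      refine Commute.list_prod_left _ _ fun x hx => ?_
      obtain ⟨i, rfl⟩ := List.mem_ofFn.1 hx
      exact h _ _
    rw [mul_assoc, ← mul_assoc _ (g 0), h1.eq]
    simp only [mul_assoc]

variable {N : ℕ} {u : Fin N → A}

theorem monom_mul_monom (h : ∀ i j, Commute (u i) (u j)) (a b : Fin N → ℕ) :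
    monom u a * monom u b = monom u (a + b) := by
  rw [monom, monom, prod_ofFn_mul_prod_ofFn fun i j => (h i j).pow_pow _ _, monom]
  simp only [pow_add, Pi.add_apply]

@[simp]
theorem monom_zero : monom u 0 = 1 := by simp [monom, List.prod_replicate, List.ofFn_const]

theorem monom_single (i : Fin N) (m : ℕ) : monom u (Pi.single i m) = u i ^ m := by
  induction N with
  | zero => exact i.elim0
  | succ N ih =>
    rw [monom, List.ofFn_succ, List.prod_cons]
    refine Fin.cases ?_ (fun i => ?_) i
    · have h2 : (List.ofFn fun j : Fin N => u j.succ ^ (Pi.single 0 m : Fin (N + 1) → ℕ) j.succ)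
          = List.ofFn fun _ : Fin N => 1 := by
        congr 1
        ext j
        simp
      rw [h2]
      simp [List.ofFn_const]
    · have h1 := ih (u := fun j => u j.succ) i
      rw [monom] at h1
      rw [Pi.single_eq_of_ne (Fin.succ_ne_zero i).symm, pow_zero, one_mul, ← h1]
      congr 2
      ext j
      rcases eq_or_ne j i with rfl | hj
      · simp
      · rw [Pi.single_eq_of_ne hj, Pi.single_eq_of_ne (by simpa using hj)]

theorem monom_map {B F : Type*} [Ring B] [FunLike F A B] [MonoidHomClass F A B] (f : F)
    (a : Fin N → ℕ) : f (monom u a) = monom (fun i => f (u i)) a := by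
  simp [monom, map_list_prod, List.map_ofFn, Function.comp_def]

end Monom

/-! ### Exchanging the order of factors in products of submodules. -/

section Span

variable {R A : Type*} [CommRing R] [Ring A] [Algebra R A]

theorem span_range_mul_le {ι κ : Type*} {u : ι → A} {v : κ → A} {V : Submodule R A}
    (h : ∀ i j, u i * v j ∈ V) :
    Submodule.span R (Set.range u) * Submodule.span R (Set.range v) ≤ V := by
  rw [Submodule.span_mul_span, Submodule.span_le]
  rintro _ ⟨_, ⟨i, rfl⟩, _, ⟨j, rfl⟩, rfl⟩
  exact h i j

/-- The linear span of the subalgebra generated by a family. -/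
abbrev adjoinSpan (R : Type*) {A : Type*} [CommRing R] [Ring A] [Algebra R A] (s : Set A) :
    Submodule R A := Subalgebra.toSubmodule (Algebra.adjoin R s)

theorem adjoinSpan_mul_self (s : Set A) : adjoinSpan R s * adjoinSpan R s = adjoinSpan R s :=
  Subalgebra.isIdempotentElem_toSubmodule _

theorem one_le_adjoinSpan (s : Set A) : 1 ≤ adjoinSpan R s := by
  rw [Submodule.one_le]
  exact one_mem (Algebra.adjoin R s)

/-- It suffices to move `V` past the generators: a product of generators is passed one factor at a
time, and the factors emerging on the left recombine because the subalgebra is closed under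
multiplication. -/
theorem mul_adjoinSpan_le {s : Set A} {V : Submodule R A}
    (h : ∀ a ∈ s, ∀ v ∈ V, v * a ∈ adjoinSpan R s * V) :
    V * adjoinSpan R s ≤ adjoinSpan R s * V := by
  have key : ∀ x ∈ Algebra.adjoin R s, ∀ v ∈ V, v * x ∈ adjoinSpan R s * V := by
    intro x hx
    induction hx using Algebra.adjoin_induction with
    | mem x hx => exact h x hx
    | algebraMap r =>
      intro v hv
      rw [← Algebra.commutes]
      exact Submodule.mul_mem_mul (algebraMap_mem (Algebra.adjoin R s) r) hv
    | add x y _ _ hx hy => intro v hv; rw [mul_add]; exact add_mem (hx v hv) (hy v hv)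
    | mul x y _ _ hx hy =>
      intro v hv
      rw [← mul_assoc]
      have h1 : ∀ t ∈ adjoinSpan R s * V, t * y ∈ adjoinSpan R s * V := by
        intro t ht
        induction ht using Submodule.mul_induction_on' with
        | mem_mul_mem m hm n hn =>
          rw [mul_assoc]
          have := Submodule.mul_mem_mul hm (hy n hn)
          rwa [← mul_assoc (adjoinSpan R s), adjoinSpan_mul_self] at this
        | add a _ b _ ha hb => rw [add_mul]; exact add_mem ha hb
      exact h1 _ (hx v hv)
  exact Submodule.mul_le.2 fun v hv x hx => key x hx v hv

theorem adjoinSpan_mul_le {s : Set A} {V : Submodule R A}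
    (h : ∀ a ∈ s, ∀ v ∈ V, a * v ∈ V * adjoinSpan R s) :
    adjoinSpan R s * V ≤ V * adjoinSpan R s := by
  have key : ∀ x ∈ Algebra.adjoin R s, ∀ v ∈ V, x * v ∈ V * adjoinSpan R s := by
    intro x hx
    induction hx using Algebra.adjoin_induction with
    | mem x hx => exact h x hx
    | algebraMap r =>
      intro v hv
      rw [Algebra.commutes]
      exact Submodule.mul_mem_mul hv (algebraMap_mem (Algebra.adjoin R s) r)
    | add x y _ _ hx hy => intro v hv; rw [add_mul]; exact add_mem (hx v hv) (hy v hv)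
    | mul x y _ _ hx hy =>
      intro v hv
      rw [mul_assoc]
      have h1 : ∀ t ∈ V * adjoinSpan R s, x * t ∈ V * adjoinSpan R s := by
        intro t ht
        induction ht using Submodule.mul_induction_on' with
        | mem_mul_mem m hm n hn =>
          rw [← mul_assoc]
          have := Submodule.mul_mem_mul (hx m hm) hn
          rwa [mul_assoc V, adjoinSpan_mul_self] at this
        | add a _ b _ ha hb => rw [mul_add]; exact add_mem ha hb
      exact h1 _ (hy v hv)
  exact Submodule.mul_le.2 fun x hx v hv => key x hx v hv

theorem mul_pow_le {V U : Submodule R A} (h : V * U ≤ U * V) (m : ℕ) : V * U ^ m ≤ U ^ m * V := by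
  induction m with
  | zero => simp
  | succ m ih =>
    calc V * U ^ (m + 1) = V * U ^ m * U := by rw [pow_succ, mul_assoc]
      _ ≤ U ^ m * V * U := mul_le_mul' ih le_rfl
      _ = U ^ m * (V * U) := mul_assoc _ _ _
      _ ≤ U ^ m * (U * V) := mul_le_mul' le_rfl h
      _ = U ^ (m + 1) * V := by rw [pow_succ, mul_assoc]

theorem adjoinSpan_range_le_span_monom {N : ℕ} {u : Fin N → A} (h : ∀ i j, Commute (u i) (u j)) :
    adjoinSpan R (Set.range u) ≤ Submodule.span R (Set.range (monom u)) := by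
  have hmul : ∀ x y, x ∈ Submodule.span R (Set.range (monom u)) →
      y ∈ Submodule.span R (Set.range (monom u)) →
      x * y ∈ Submodule.span R (Set.range (monom u)) := by
    intro x y hx hy
    refine span_range_mul_le (fun a b => ?_) (Submodule.mul_mem_mul hx hy)
    rw [monom_mul_monom h]
    exact Submodule.subset_span ⟨_, rfl⟩
  have hone : (1 : A) ∈ Submodule.span R (Set.range (monom u)) :=
    Submodule.subset_span ⟨0, monom_zero⟩
  have : Algebra.adjoin R (Set.range u)
      ≤ (Submodule.span R (Set.range (monom u))).toSubalgebra hone hmul := by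
    rw [Algebra.adjoin_le_iff]
    rintro _ ⟨i, rfl⟩
    exact Submodule.subset_span ⟨Pi.single i 1, by rw [monom_single, pow_one]⟩
  exact this

end Span

end CycDAHA

namespace CycDAHA

open Equiv

/-! ### The triangular decomposition. -/

section Spanning

variable {R A : Type*} [CommRing R] [Ring A] [Algebra R A] {n : ℕ}

/-- The relations between the generators of the degenerate cyclotomic DAHA. -/
structure IsCyclotomic (hb k : R) {l : ℕ} (z : Fin l → R) (w : Perm (Fin (n + 1)) →* A)
    (y X D : Fin (n + 1) → A) : Prop where
  hecke : IsDegHecke k w y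
  equiv_X : IsEquivariant w X
  X_comm (i j : Fin (n + 1)) : Commute (X i) (X j)
  y_X (i : Fin (n + 1)) : i ≠ 0 → y i * X 0 - X 0 * y i = k • (X 0 * w (swap 0 i))
  y_X_zero : y 0 * X 0 - X 0 * y 0
    = hb • X 0 - k • (X 0 * ∑ j ∈ Finset.univ.erase 0, w (swap 0 j))
  equiv_D : IsEquivariant w D
  D_comm (i j : Fin (n + 1)) : Commute (D i) (D j)
  y_D (j : Fin (n + 1)) : j ≠ 0 → y j * D 0 - D 0 * y j = -(k • (w (swap 0 j) * D 0))
  y_D_zero : y 0 * D 0 - D 0 * y 0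
    = -(hb • D 0) + k • ((∑ j ∈ Finset.univ.erase 0, w (swap 0 j)) * D 0)
  D_X_zero : D 0 * X 0 - X 0 * D 0 = sumInsert z
    (y 0 + algebraMap R A hb - k • ∑ j ∈ Finset.univ.erase 0, w (swap 0 j))
    (algebraMap R A hb - k • ∑ j ∈ Finset.univ.erase 0, w (swap 0 j)) (y 0)
  D_X (m : Fin (n + 1)) : m ≠ 0 → D 0 * X m - X m * D 0 = k • sumInsert z
    (y 0 + algebraMap R A hb - k • ∑ j ∈ Finset.univ.erase 0, w (swap 0 j)) (w (swap 0 m)) (y 0)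
  X_D : X 0 * D 0 = prodSub (List.ofFn z) (y 0)

theorem mul_le_mul_mid {P A₁ B C E Q : Submodule R A} (h : A₁ * B ≤ C * E) :
    P * A₁ * B * Q ≤ P * C * E * Q := by
  rw [mul_assoc P A₁ B, mul_assoc P C E]
  exact mul_le_mul' (mul_le_mul' le_rfl h) le_rfl

theorem adjoinSpan_le_of_mul_mem {s : Set A} {T : Submodule R A} (h1 : (1 : A) ∈ T)
    (h : ∀ a ∈ s, ∀ t ∈ T, a * t ∈ T) : adjoinSpan R s ≤ T := by
  have key : ∀ x ∈ Algebra.adjoin R s, ∀ t ∈ T, x * t ∈ T := by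
    intro x hx
    induction hx using Algebra.adjoin_induction with
    | mem x hx => exact h x hx
    | algebraMap r => intro t ht; rw [← Algebra.smul_def]; exact T.smul_mem r ht
    | add x y _ _ hx hy => intro t ht; rw [add_mul]; exact add_mem (hx t ht) (hy t ht)
    | mul x y _ _ hx hy => intro t ht; rw [mul_assoc]; exact hx _ (hy t ht)
  intro x hx
  simpa using key x hx 1 h1

variable (R) in
/-- The span of the image of the symmetric group. -/
abbrev permSpan (w : Perm (Fin (n + 1)) →* A) : Submodule R A := Submodule.span R (Set.range w)

variable (R) in
/-- The span of `1` and a family. -/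
abbrev unitSpan (y : Fin (n + 1) → A) : Submodule R A := 1 ⊔ Submodule.span R (Set.range y)

variable (R) in
/-- The span of the subalgebra generated by the symmetric group and a family. -/
abbrev heckeSpan (w : Perm (Fin (n + 1)) →* A) (y : Fin (n + 1) → A) : Submodule R A :=
  adjoinSpan R (Set.range w ∪ Set.range y)

variable {w : Perm (Fin (n + 1)) →* A}

theorem permHom_mem_permSpan (σ : Perm (Fin (n + 1))) : w σ ∈ permSpan R w :=
  Submodule.subset_span ⟨σ, rfl⟩

theorem permSpan_mul_self_le : permSpan R w * permSpan R w ≤ permSpan R w :=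
  span_range_mul_le fun σ τ => by rw [← map_mul]; exact permHom_mem_permSpan _

theorem one_mem_permSpan : (1 : A) ∈ permSpan R w := by
  rw [← map_one w]; exact permHom_mem_permSpan _

theorem mul_mem_permSpan {a b : A} (ha : a ∈ permSpan R w) (hb : b ∈ permSpan R w) :
    a * b ∈ permSpan R w := permSpan_mul_self_le (Submodule.mul_mem_mul ha hb)

theorem permSpan_mul_self : permSpan R w * permSpan R w = permSpan R w :=
  le_antisymm permSpan_mul_self_le
    (le_mul_of_one_le_left' (Submodule.one_le.2 one_mem_permSpan))

theorem IsEquivariant.permSpan_mul_le {x : Fin (n + 1) → A} (hx : IsEquivariant w x) :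
    permSpan R w * Submodule.span R (Set.range x)
      ≤ Submodule.span R (Set.range x) * permSpan R w :=
  span_range_mul_le fun σ i => by
    rw [hx]
    exact Submodule.mul_mem_mul (Submodule.subset_span ⟨_, rfl⟩) (permHom_mem_permSpan _)

theorem IsEquivariant.mul_permSpan_le {x : Fin (n + 1) → A} (hx : IsEquivariant w x) :
    Submodule.span R (Set.range x) * permSpan R w
      ≤ permSpan R w * Submodule.span R (Set.range x) :=
  span_range_mul_le fun i σ => by
    have : x i * w σ = w σ * x (σ⁻¹ i) := by rw [hx]; simp
    rw [this]
    exact Submodule.mul_mem_mul (permHom_mem_permSpan _) (Submodule.subset_span ⟨_, rfl⟩)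

theorem span_le_adjoinSpan (s : Set A) : Submodule.span R s ≤ adjoinSpan R s :=
  Algebra.span_le_adjoin R s

theorem IsEquivariant.permSpan_mul_adjoinSpan_le {x : Fin (n + 1) → A} (hx : IsEquivariant w x) :
    permSpan R w * adjoinSpan R (Set.range x) ≤ adjoinSpan R (Set.range x) * permSpan R w :=
  mul_adjoinSpan_le fun _ ha _ hv => mul_le_mul' (span_le_adjoinSpan _) le_rfl
    (hx.permSpan_mul_le (Submodule.mul_mem_mul hv (Submodule.subset_span ha)))

variable {y X D : Fin (n + 1) → A} {hb k : R} {l : ℕ} {z : Fin l → R}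

theorem mem_unitSpan (i : Fin (n + 1)) : y i ∈ unitSpan R y :=
  Submodule.mem_sup_right (Submodule.subset_span ⟨i, rfl⟩)

theorem one_le_unitSpan : (1 : Submodule R A) ≤ unitSpan R y := le_sup_left

theorem permSpan_le_unitSpan_mul : permSpan R w ≤ unitSpan R y * permSpan R w :=
  le_mul_of_one_le_left' one_le_unitSpan

theorem exists_balanced_eq (i : Fin (n + 1)) : ∃ c ∈ permSpan R w, balanced k w y i = y i + c :=
  ⟨_, Submodule.smul_mem _ _ (Submodule.sum_mem _ fun _ _ => permHom_mem_permSpan _), rfl⟩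

/-- The corrected elements are permuted exactly and differ from the y_i by elements of the group
span. The 1 in `unitSpan` is there to absorb these differences. -/
theorem IsDegHecke.permSpan_mul_unitSpan_le (h : IsDegHecke k w y) :
    permSpan R w * unitSpan R y ≤ unitSpan R y * permSpan R w := by
  rw [Submodule.mul_sup, mul_one]
  refine sup_le permSpan_le_unitSpan_mul (span_range_mul_le fun σ i => ?_)
  obtain ⟨c, hc, hci⟩ := exists_balanced_eq (R := R) (k := k) (w := w) (y := y) i
  obtain ⟨d, hd, hdi⟩ := exists_balanced_eq (R := R) (k := k) (w := w) (y := y) (σ i)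
  have h1 := h.isEquivariant_balanced σ i
  rw [hci, hdi, mul_add, add_mul] at h1
  rw [eq_sub_of_add_eq h1]
  exact sub_mem (add_mem (Submodule.mul_mem_mul (mem_unitSpan _) (permHom_mem_permSpan _))
    (permSpan_le_unitSpan_mul (mul_mem_permSpan hd (permHom_mem_permSpan _))))
    (permSpan_le_unitSpan_mul (mul_mem_permSpan (permHom_mem_permSpan _) hc))

theorem IsDegHecke.unitSpan_mul_permSpan_le (h : IsDegHecke k w y) :
    unitSpan R y * permSpan R w ≤ permSpan R w * unitSpan R y := by
  have h0 : permSpan R w ≤ permSpan R w * unitSpan R y := le_mul_of_one_le_right' one_le_unitSpan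
  rw [Submodule.sup_mul, one_mul]
  refine sup_le h0 (span_range_mul_le fun i σ => ?_)
  obtain ⟨c, hc, hci⟩ := exists_balanced_eq (R := R) (k := k) (w := w) (y := y) i
  obtain ⟨d, hd, hdi⟩ := exists_balanced_eq (R := R) (k := k) (w := w) (y := y) (σ⁻¹ i)
  have h1 := h.isEquivariant_balanced σ (σ⁻¹ i)
  rw [hdi, show σ (σ⁻¹ i) = i by simp, hci, mul_add, add_mul] at h1
  rw [eq_sub_of_add_eq h1.symm]
  exact sub_mem (add_mem (Submodule.mul_mem_mul (permHom_mem_permSpan _) (mem_unitSpan _))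
    (h0 (mul_mem_permSpan (permHom_mem_permSpan _) hd)))
    (h0 (mul_mem_permSpan hc (permHom_mem_permSpan _)))

theorem permSpan_le_heckeSpan : permSpan R w ≤ heckeSpan R w y :=
  (Submodule.span_mono Set.subset_union_left).trans (span_le_adjoinSpan _)

theorem unitSpan_le_heckeSpan : unitSpan R y ≤ heckeSpan R w y :=
  sup_le (one_le_adjoinSpan _)
    ((Submodule.span_mono Set.subset_union_right).trans (span_le_adjoinSpan _))

theorem unitSpan_mul_permSpan_le_heckeSpan :
    unitSpan R y * permSpan R w ≤ heckeSpan R w y :=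
  (mul_le_mul' unitSpan_le_heckeSpan permSpan_le_heckeSpan).trans (adjoinSpan_mul_self _).le

theorem unitSpan_le_adjoinSpan : unitSpan R y ≤ adjoinSpan R (Set.range y) :=
  sup_le (one_le_adjoinSpan _) (span_le_adjoinSpan _)

theorem IsDegHecke.heckeSpan_le (h : IsDegHecke k w y) :
    heckeSpan R w y ≤ adjoinSpan R (Set.range y) * permSpan R w := by
  have hS : permSpan R w * adjoinSpan R (Set.range y)
      ≤ adjoinSpan R (Set.range y) * permSpan R w := by
    refine mul_adjoinSpan_le ?_
    rintro _ ⟨i, rfl⟩ v hv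
    exact mul_le_mul' unitSpan_le_adjoinSpan le_rfl
      (h.permSpan_mul_unitSpan_le (Submodule.mul_mem_mul hv (mem_unitSpan i)))
  refine adjoinSpan_le_of_mul_mem ?_ ?_
  · simpa using Submodule.mul_mem_mul (one_mem (Algebra.adjoin R (Set.range y)) :
      (1 : A) ∈ adjoinSpan R (Set.range y)) (one_mem_permSpan (R := R) (w := w))
  · rintro _ (⟨σ, rfl⟩ | ⟨i, rfl⟩) t ht
    · have h1 : permSpan R w * (adjoinSpan R (Set.range y) * permSpan R w)
          ≤ adjoinSpan R (Set.range y) * permSpan R w := by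
        rw [← mul_assoc]
        refine (mul_le_mul' hS le_rfl).trans ?_
        rw [mul_assoc, permSpan_mul_self]
      exact h1 (Submodule.mul_mem_mul (permHom_mem_permSpan _) ht)
    · have h1 : adjoinSpan R (Set.range y) * (adjoinSpan R (Set.range y) * permSpan R w)
          ≤ adjoinSpan R (Set.range y) * permSpan R w := by
        rw [← mul_assoc, adjoinSpan_mul_self]
      exact h1 (Submodule.mul_mem_mul (unitSpan_le_adjoinSpan (mem_unitSpan i)) ht)

namespace IsCyclotomic

theorem sumSwap_mem : (∑ j ∈ Finset.univ.erase 0, w (swap 0 j)) ∈ permSpan R w :=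
  Submodule.sum_mem _ fun _ _ => permHom_mem_permSpan _

theorem algebraMap_mem_permSpan (r : R) : algebraMap R A r ∈ permSpan R w := by
  rw [Algebra.algebraMap_eq_smul_one]
  exact Submodule.smul_mem _ _ one_mem_permSpan

theorem exists_y_mul_X (h : IsCyclotomic hb k z w y X D) (i : Fin (n + 1)) :
    ∃ c ∈ permSpan R w, y i * X 0 = X 0 * (y i + c) := by
  rcases eq_or_ne i 0 with rfl | hi
  · refine ⟨algebraMap R A hb - k • ∑ j ∈ Finset.univ.erase 0, w (swap 0 j),
      sub_mem (algebraMap_mem_permSpan hb) (Submodule.smul_mem _ _ sumSwap_mem), ?_⟩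
    rw [eq_add_of_sub_eq h.y_X_zero, mul_add, mul_sub, ← Algebra.commutes, ← Algebra.smul_def,
      mul_smul_comm]
    abel
  · refine ⟨k • w (swap 0 i), Submodule.smul_mem _ _ (permHom_mem_permSpan _), ?_⟩
    rw [eq_add_of_sub_eq (h.y_X i hi), mul_add, mul_smul_comm]
    abel

theorem exists_D_mul_y (h : IsCyclotomic hb k z w y X D) (i : Fin (n + 1)) :
    ∃ c ∈ permSpan R w, D 0 * y i = (y i + c) * D 0 := by
  rcases eq_or_ne i 0 with rfl | hi
  · refine ⟨algebraMap R A hb - k • ∑ j ∈ Finset.univ.erase 0, w (swap 0 j),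
      sub_mem (algebraMap_mem_permSpan hb) (Submodule.smul_mem _ _ sumSwap_mem), ?_⟩
    rw [eq_sub_of_add_eq' (eq_add_of_sub_eq h.y_D_zero).symm, add_mul, sub_mul,
      ← Algebra.smul_def, smul_mul_assoc]
    abel
  · refine ⟨k • w (swap 0 i), Submodule.smul_mem _ _ (permHom_mem_permSpan _), ?_⟩
    rw [eq_sub_of_add_eq' (eq_add_of_sub_eq (h.y_D i hi)).symm, add_mul, smul_mul_assoc]
    abel

theorem X_mem (i : Fin (n + 1)) : X i ∈ adjoinSpan R (Set.range X) :=
  Algebra.subset_adjoin ⟨i, rfl⟩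

theorem mem_unitSpan_mul (i : Fin (n + 1)) {c : A} (hc : c ∈ permSpan R w) :
    y i + c ∈ unitSpan R y * permSpan R w := by
  refine add_mem ?_ (permSpan_le_unitSpan_mul hc)
  simpa using Submodule.mul_mem_mul (mem_unitSpan (R := R) (y := y) i)
    (one_mem_permSpan (R := R) (w := w))

theorem unitSpan_permSpan_mul_self (h : IsDegHecke k w y) :
    permSpan R w * (unitSpan R y * permSpan R w) ≤ unitSpan R y * permSpan R w := by
  rw [← mul_assoc]
  refine (mul_le_mul' h.permSpan_mul_unitSpan_le le_rfl).trans ?_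
  rw [mul_assoc, permSpan_mul_self]

/-- The relations only give y_i X₁, so X_j is written as a conjugate of X₁ by a transposition, and
the group elements on either side are moved through. -/
theorem mul_X_mem (h : IsCyclotomic hb k z w y X D) (j : Fin (n + 1)) {v : A}
    (hv : v ∈ unitSpan R y * permSpan R w) :
    v * X j ∈ adjoinSpan R (Set.range X) * (unitSpan R y * permSpan R w) := by
  set S := permSpan R w
  set U := unitSpan R y
  set 𝒳 := adjoinSpan R (Set.range X)
  set x0 := Submodule.span R (Set.range fun _ : Unit => X 0)
  have hx0 : X 0 ∈ x0 := Submodule.subset_span ⟨(), rfl⟩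
  have h0 : U * x0 ≤ 𝒳 * (U * S) := by
    rw [Submodule.sup_mul, one_mul]
    refine sup_le (Submodule.span_le.2 ?_) (span_range_mul_le fun i _ => ?_)
    · rintro _ ⟨_, rfl⟩
      simpa using Submodule.mul_mem_mul (X_mem (R := R) (X := X) 0)
        (permSpan_le_unitSpan_mul (y := y) (one_mem_permSpan (R := R) (w := w)))
    · obtain ⟨c, hc, hci⟩ := h.exists_y_mul_X i
      rw [hci]
      exact Submodule.mul_mem_mul (X_mem 0) (mem_unitSpan_mul i hc)
  have hXj : v * X j ∈ U * S * (S * x0 * S) := by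
    refine Submodule.mul_mem_mul hv ?_
    rw [h.equiv_X.eq_conj_swap]
    exact Submodule.mul_mem_mul (Submodule.mul_mem_mul (permHom_mem_permSpan _) hx0)
      (permHom_mem_permSpan _)
  have key : U * S * (S * x0 * S) ≤ 𝒳 * (U * S) :=
    calc U * S * (S * x0 * S) = U * (S * S) * x0 * S := by simp only [mul_assoc]
      _ = U * S * x0 * S := by rw [permSpan_mul_self]
      _ ≤ S * U * x0 * S :=
        mul_le_mul' (mul_le_mul' h.hecke.unitSpan_mul_permSpan_le le_rfl) le_rfl
      _ ≤ S * 𝒳 * (U * S) * S := mul_le_mul_mid h0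
      _ ≤ 𝒳 * S * (U * S) * S :=
        mul_le_mul' (mul_le_mul' h.equiv_X.permSpan_mul_adjoinSpan_le le_rfl) le_rfl
      _ = 𝒳 * (S * (U * S)) * S := by simp only [mul_assoc]
      _ ≤ 𝒳 * (U * S) * S :=
        mul_le_mul' (mul_le_mul' le_rfl (unitSpan_permSpan_mul_self h.hecke)) le_rfl
      _ = 𝒳 * (U * S) := by rw [mul_assoc 𝒳, mul_assoc U, permSpan_mul_self]
  exact key hXj

/-- The analogue for D: only D₁ y_i is given, and the conjugating transpositions are moved past y_i
and D_i. -/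
theorem span_D_mul_unitSpan_le (h : IsCyclotomic hb k z w y X D) :
    Submodule.span R (Set.range D) * unitSpan R y
      ≤ unitSpan R y * permSpan R w * Submodule.span R (Set.range D) := by
  set S := permSpan R w
  set U := unitSpan R y
  set LD := Submodule.span R (Set.range D)
  set d0 := Submodule.span R (Set.range fun _ : Unit => D 0)
  have hd0 : D 0 ∈ d0 := Submodule.subset_span ⟨(), rfl⟩
  have hd : d0 ≤ LD := Submodule.span_mono (by rintro _ ⟨_, rfl⟩; exact ⟨0, rfl⟩)
  have hD : LD ≤ S * d0 * S := by
    refine Submodule.span_le.2 ?_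
    rintro _ ⟨i, rfl⟩
    rw [h.equiv_D.eq_conj_swap]
    exact Submodule.mul_mem_mul (Submodule.mul_mem_mul (permHom_mem_permSpan _) hd0)
      (permHom_mem_permSpan _)
  have h0 : d0 * U ≤ U * S * LD := by
    rw [Submodule.mul_sup, mul_one]
    refine sup_le (hd.trans (le_mul_of_one_le_left' ?_)) (span_range_mul_le fun _ i => ?_)
    · exact Submodule.one_le.2 (permSpan_le_unitSpan_mul (one_mem_permSpan (R := R) (w := w)))
    · obtain ⟨c, hc, hci⟩ := h.exists_D_mul_y i
      rw [hci]
      exact Submodule.mul_mem_mul (mem_unitSpan_mul i hc) (hd hd0)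
  calc LD * U ≤ S * d0 * S * U := mul_le_mul' hD le_rfl
    _ = S * d0 * (S * U) := by simp only [mul_assoc]
    _ ≤ S * d0 * (U * S) := mul_le_mul' le_rfl h.hecke.permSpan_mul_unitSpan_le
    _ = S * (d0 * U) * S := by simp only [mul_assoc]
    _ ≤ S * (U * S * LD) * S := mul_le_mul' (mul_le_mul' le_rfl h0) le_rfl
    _ = (S * (U * S)) * (LD * S) := by simp only [mul_assoc]
    _ ≤ (U * S) * (S * LD) :=
      mul_le_mul' (unitSpan_permSpan_mul_self h.hecke) h.equiv_D.mul_permSpan_le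
    _ = U * (S * S) * LD := by simp only [mul_assoc]
    _ = U * S * LD := by rw [permSpan_mul_self]

theorem span_D_mul_heckeSpan_le (h : IsCyclotomic hb k z w y X D) :
    Submodule.span R (Set.range D) * heckeSpan R w y
      ≤ heckeSpan R w y * Submodule.span R (Set.range D) := by
  refine mul_adjoinSpan_le ?_
  rintro _ (⟨σ, rfl⟩ | ⟨i, rfl⟩) v hv
  · exact mul_le_mul' permSpan_le_heckeSpan le_rfl
      (h.equiv_D.mul_permSpan_le (Submodule.mul_mem_mul hv (permHom_mem_permSpan σ)))
  · exact mul_le_mul' unitSpan_mul_permSpan_le_heckeSpan le_rfl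
      (h.span_D_mul_unitSpan_le (Submodule.mul_mem_mul hv (mem_unitSpan i)))

theorem heckeSpan_mul_X_le (h : IsCyclotomic hb k z w y X D) :
    heckeSpan R w y * adjoinSpan R (Set.range X)
      ≤ adjoinSpan R (Set.range X) * heckeSpan R w y := by
  refine adjoinSpan_mul_le ?_
  have key : unitSpan R y * permSpan R w * adjoinSpan R (Set.range X)
      ≤ adjoinSpan R (Set.range X) * heckeSpan R w y := by
    refine (mul_adjoinSpan_le ?_).trans (mul_le_mul' le_rfl unitSpan_mul_permSpan_le_heckeSpan)
    rintro _ ⟨j, rfl⟩ v hv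
    exact h.mul_X_mem j hv
  rintro a ha v hv
  refine key (Submodule.mul_mem_mul ?_ hv)
  rcases ha with ⟨σ, rfl⟩ | ⟨i, rfl⟩
  · exact permSpan_le_unitSpan_mul (permHom_mem_permSpan σ)
  · simpa using mem_unitSpan_mul (R := R) (w := w) (y := y) i (zero_mem _)

theorem prodSub_mem {B : Subalgebra R A} {a : A} (ha : a ∈ B) (zs : List R) :
    prodSub zs a ∈ B := by
  induction zs with
  | nil => exact one_mem B
  | cons c zs ih =>
    rw [prodSub_cons]
    exact mul_mem (sub_mem ha (algebraMap_mem B c)) ih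

theorem sumInsert_mem {B : Subalgebra R A} {a m b : A} (ha : a ∈ B) (hm : m ∈ B) (hb : b ∈ B) :
    sumInsert z a m b ∈ B :=
  sum_mem fun _ _ => mul_mem (mul_mem (prodSub_mem ha _) hm) (prodSub_mem hb _)

/-- Conjugation by (0, i) reduces to i = 0, where the commutator is given by the relations in terms
of y₁ and permutations only. -/
theorem D_mul_X_sub_mem (h : IsCyclotomic hb k z w y X D) (i j : Fin (n + 1)) :
    D i * X j - X j * D i ∈ heckeSpan R w y := by
  have hw : ∀ σ, w σ ∈ Algebra.adjoin R (Set.range w ∪ Set.range y) :=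
    fun σ => Algebra.subset_adjoin (Or.inl ⟨σ, rfl⟩)
  have hy : ∀ i, y i ∈ Algebra.adjoin R (Set.range w ∪ Set.range y) :=
    fun i => Algebra.subset_adjoin (Or.inr ⟨i, rfl⟩)
  have hs : k • ∑ j ∈ Finset.univ.erase 0, w (swap 0 j)
      ∈ Algebra.adjoin R (Set.range w ∪ Set.range y) :=
    Subalgebra.smul_mem _ (sum_mem fun _ _ => hw _) _
  have hB : ∀ r : R, algebraMap R A r ∈ Algebra.adjoin R (Set.range w ∪ Set.range y) :=
    fun r => algebraMap_mem _ r
  have h0 : ∀ m, D 0 * X m - X m * D 0 ∈ Algebra.adjoin R (Set.range w ∪ Set.range y) := by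
    intro m
    rcases eq_or_ne m 0 with rfl | hm
    · rw [h.D_X_zero]
      exact sumInsert_mem (sub_mem (add_mem (hy 0) (hB _)) hs) (sub_mem (hB _) hs) (hy 0)
    · rw [h.D_X m hm]
      exact Subalgebra.smul_mem _
        (sumInsert_mem (sub_mem (add_mem (hy 0) (hB _)) hs) (hw _) (hy 0)) _
  have h1 : D i * X j - X j * D i
      = w (swap 0 i) * (D 0 * X (swap 0 i j) - X (swap 0 i j) * D 0) * w (swap 0 i) := by
    rw [mul_sub, sub_mul, ← mul_assoc, ← mul_assoc, h.equiv_D, h.equiv_X, mul_assoc (D _),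
      h.equiv_X, mul_assoc (X _), h.equiv_D]
    simp only [swap_apply_left, swap_apply_self, mul_assoc, permHom_swap_mul_self, mul_one]
  rw [h1]
  exact (Algebra.adjoin R _).mul_mem ((Algebra.adjoin R _).mul_mem (hw _) (h0 _)) (hw _)

/-- Exchanging D_i with X_j leaves a commutator in the Hecke part, so only the sum of the D-span and
the Hecke part can be moved past the X-algebra. -/
theorem span_D_sup_mul_X_le (h : IsCyclotomic hb k z w y X D) :
    (Submodule.span R (Set.range D) ⊔ heckeSpan R w y) * adjoinSpan R (Set.range X)
      ≤ adjoinSpan R (Set.range X) * (Submodule.span R (Set.range D) ⊔ heckeSpan R w y) := by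
  refine mul_adjoinSpan_le ?_
  rintro _ ⟨j, rfl⟩ v hv
  have key : (Submodule.span R (Set.range D) ⊔ heckeSpan R w y)
        * Submodule.span R (Set.range fun _ : Unit => X j)
      ≤ adjoinSpan R (Set.range X) * (Submodule.span R (Set.range D) ⊔ heckeSpan R w y) := by
    rw [Submodule.sup_mul]
    refine sup_le (span_range_mul_le fun i _ => ?_) ?_
    · rw [← sub_add_cancel (D i * X j) (X j * D i)]
      refine add_mem ?_ (Submodule.mul_mem_mul (X_mem j)
        (Submodule.mem_sup_left (Submodule.subset_span ⟨i, rfl⟩)))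
      exact le_mul_of_one_le_left' (one_le_adjoinSpan _)
        (Submodule.mem_sup_right (h.D_mul_X_sub_mem i j))
    · refine (mul_le_mul' le_rfl ((Submodule.span_mono ?_).trans (span_le_adjoinSpan
        (Set.range X)))).trans (h.heckeSpan_mul_X_le.trans (mul_le_mul' le_rfl le_sup_right))
      rintro _ ⟨_, rfl⟩
      exact ⟨j, rfl⟩
  exact key (Submodule.mul_mem_mul hv (Submodule.subset_span ⟨(), rfl⟩))

/-- The triangular decomposition of an algebra generated by elements satisfying the cyclotomic
relations. -/
theorem triangular_eq_top (h : IsCyclotomic hb k z w y X D)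
    (hgen : Algebra.adjoin R (Set.range w ∪ Set.range y ∪ Set.range X ∪ Set.range D) = ⊤) :
    adjoinSpan R (Set.range X) * heckeSpan R w y * adjoinSpan R (Set.range D) = ⊤ := by
  set 𝒳 := adjoinSpan R (Set.range X)
  set ℋ := heckeSpan R w y
  set 𝒟 := adjoinSpan R (Set.range D)
  set LD := Submodule.span R (Set.range D)
  have hX1 : 1 ≤ 𝒳 := one_le_adjoinSpan _
  have hH1 : 1 ≤ ℋ := one_le_adjoinSpan _
  have hD1 : 1 ≤ 𝒟 := one_le_adjoinSpan _
  have hXT : 𝒳 * (𝒳 * ℋ * 𝒟) ≤ 𝒳 * ℋ * 𝒟 := by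
    rw [← mul_assoc, ← mul_assoc, adjoinSpan_mul_self]
  have hHT : ℋ * (𝒳 * ℋ * 𝒟) ≤ 𝒳 * ℋ * 𝒟 :=
    calc ℋ * (𝒳 * ℋ * 𝒟) = ℋ * 𝒳 * ℋ * 𝒟 := by simp only [mul_assoc]
      _ ≤ 𝒳 * ℋ * ℋ * 𝒟 := mul_le_mul' (mul_le_mul' h.heckeSpan_mul_X_le le_rfl) le_rfl
      _ = 𝒳 * (ℋ * ℋ) * 𝒟 := by simp only [mul_assoc]
      _ = 𝒳 * ℋ * 𝒟 := by rw [adjoinSpan_mul_self]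
  have hDT : LD * (𝒳 * ℋ * 𝒟) ≤ 𝒳 * ℋ * 𝒟 :=
    calc LD * (𝒳 * ℋ * 𝒟) = LD * 𝒳 * ℋ * 𝒟 := by simp only [mul_assoc]
      _ ≤ (LD ⊔ ℋ) * 𝒳 * ℋ * 𝒟 :=
        mul_le_mul' (mul_le_mul' (mul_le_mul' le_sup_left le_rfl) le_rfl) le_rfl
      _ ≤ 𝒳 * (LD ⊔ ℋ) * ℋ * 𝒟 :=
        mul_le_mul' (mul_le_mul' h.span_D_sup_mul_X_le le_rfl) le_rfl
      _ = 𝒳 * (LD * ℋ ⊔ ℋ * ℋ) * 𝒟 := by rw [mul_assoc 𝒳, Submodule.sup_mul]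
      _ ≤ 𝒳 * (ℋ * 𝒟) * 𝒟 := by
        refine mul_le_mul' (mul_le_mul' le_rfl (sup_le ?_ ?_)) le_rfl
        · exact h.span_D_mul_heckeSpan_le.trans (mul_le_mul' le_rfl (span_le_adjoinSpan _))
        · rw [adjoinSpan_mul_self]
          exact le_mul_of_one_le_right' hD1
      _ = 𝒳 * ℋ * (𝒟 * 𝒟) := by simp only [mul_assoc]
      _ = 𝒳 * ℋ * 𝒟 := by rw [adjoinSpan_mul_self]
  -- The product of the three spans contains 1 and is stable under left multiplication by every
  -- generator.
  have htop : adjoinSpan R (Set.range w ∪ Set.range y ∪ Set.range X ∪ Set.range D)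
      ≤ 𝒳 * ℋ * 𝒟 := by
    refine adjoinSpan_le_of_mul_mem ?_ ?_
    · refine Submodule.one_le.1 ?_
      calc (1 : Submodule R A) = 1 * 1 * 1 := by simp
        _ ≤ 𝒳 * ℋ * 𝒟 := mul_le_mul' (mul_le_mul' hX1 hH1) hD1
    · rintro _ (((⟨σ, rfl⟩ | ⟨i, rfl⟩) | ⟨i, rfl⟩) | ⟨i, rfl⟩) t ht
      · exact hHT (Submodule.mul_mem_mul (permSpan_le_heckeSpan (permHom_mem_permSpan σ)) ht)
      · exact hHT (Submodule.mul_mem_mul (unitSpan_le_heckeSpan (mem_unitSpan i)) ht)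
      · exact hXT (Submodule.mul_mem_mul (X_mem i) ht)
      · exact hDT (Submodule.mul_mem_mul (Submodule.subset_span ⟨i, rfl⟩) ht)
  rw [eq_top_iff]
  refine le_trans ?_ htop
  intro x _
  change x ∈ Algebra.adjoin R _
  rw [hgen]
  trivial

end IsCyclotomic

end Spanning

end CycDAHA

namespace CycDAHA

open Equiv

/-! ### Reducing the exponents of y below l. -/

section Restricted

variable {R A : Type*} [CommRing R] [Ring A] [Algebra R A] {n : ℕ} {w : Perm (Fin (n + 1)) →* A}
  {y X D : Fin (n + 1) → A} {hb k : R} {l : ℕ} {z : Fin l → R}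

theorem monom_mem_pow (b : Fin (n + 1) → ℕ) :
    monom y b ∈ unitSpan R y ^ ∑ i, b i := by
  have : ∀ (m : ℕ) (f : Fin m → ℕ) (v : Fin m → A) (U : Submodule R A),
      (∀ i, v i ∈ U) → (List.ofFn fun i => v i ^ f i).prod ∈ U ^ ∑ i, f i := by
    intro m
    induction m with
    | zero => intro f v U _; simpa using Submodule.one_le.1 (le_refl (1 : Submodule R A))
    | succ m ih =>
      intro f v U hv
      rw [List.ofFn_succ, List.prod_cons, Fin.sum_univ_succ, pow_add]
      exact Submodule.mul_mem_mul (Submodule.pow_mem_pow _ (hv 0) _)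
        (ih _ (fun i => v i.succ) U fun i => hv _)
  exact this _ b y _ fun i => mem_unitSpan i

theorem unitSpan_pow_le (hy : ∀ i j, Commute (y i) (y j)) (m : ℕ) :
    unitSpan R y ^ m ≤ Submodule.span R (monom y '' {b | ∑ i, b i ≤ m}) := by
  induction m with
  | zero =>
    rw [pow_zero, Submodule.one_le]
    exact Submodule.subset_span ⟨0, by simp, monom_zero⟩
  | succ m ih =>
    rw [pow_succ]
    refine (mul_le_mul' ih le_rfl).trans ?_
    rw [Submodule.mul_sup, mul_one, Submodule.span_mul_span]
    refine sup_le (Submodule.span_mono (Set.image_mono fun b hb => ?_)) (Submodule.span_mono ?_)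
    · exact le_trans hb (Nat.le_succ m)
    · rintro _ ⟨_, ⟨b, hb, rfl⟩, _, ⟨i, rfl⟩, rfl⟩
      refine ⟨b + Pi.single i 1, ?_, ?_⟩
      · simp only [Set.mem_ofPred_eq, Pi.add_apply, Finset.sum_add_distrib] at hb ⊢
        simpa using hb
      · rw [← monom_mul_monom hy, monom_single, pow_one]

/-- The span of the monomials with all exponents below `l`. -/
abbrev restrictedSpan (R : Type*) {A : Type*} [CommRing R] [Ring A] [Algebra R A] (l : ℕ)
    (y : Fin (n + 1) → A) : Submodule R A :=
  Submodule.span R (Set.range fun b : Fin (n + 1) → Fin l => monom y fun i => (b i).val)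

/-- The span of the monomials `M_X M_y s M_D` in which `y` has exponents below `l`. -/
abbrev basisSpan (R : Type*) {A : Type*} [CommRing R] [Ring A] [Algebra R A] (l : ℕ)
    (w : Perm (Fin (n + 1)) →* A) (y X D : Fin (n + 1) → A) : Submodule R A :=
  adjoinSpan R (Set.range X) * (restrictedSpan R l y * permSpan R w) * adjoinSpan R (Set.range D)

/-- A leading-term statement for the filtration by degree in y: the perturbation c, a combination of
permutations, preserves each level when multiplied from the left. -/
theorem prodSub_sub_pow_mem (h : IsDegHecke k w y) (i : Fin (n + 1)) {c : A}
    (hc : c ∈ permSpan R w) (zs : List R) :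
    prodSub zs (y i + c) ∈ unitSpan R y ^ zs.length * permSpan R w ∧
    prodSub zs (y i + c) - y i ^ zs.length
      ∈ unitSpan R y ^ (zs.length - 1) * permSpan R w := by
  set U := unitSpan R y
  set S := permSpan R w
  have hUS : ∀ m, S * (U ^ m * S) ≤ U ^ m * S := fun m => by
    rw [← mul_assoc]
    refine (mul_le_mul' (mul_pow_le h.permSpan_mul_unitSpan_le m) le_rfl).trans ?_
    rw [mul_assoc, permSpan_mul_self]
  induction zs with
  | nil =>
    simpa using one_mem_permSpan
  | cons r zs ih =>
    obtain ⟨ih1, ih2⟩ := ih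
    have hd : c - algebraMap R A r ∈ S :=
      sub_mem hc (IsCyclotomic.algebraMap_mem_permSpan r)
    have h1 : (c - algebraMap R A r) * prodSub zs (y i + c) ∈ U ^ zs.length * S :=
      hUS _ (Submodule.mul_mem_mul hd ih1)
    have h2 : prodSub (r :: zs) (y i + c) = y i * prodSub zs (y i + c)
        + (c - algebraMap R A r) * prodSub zs (y i + c) := by
      rw [prodSub_cons, ← add_mul]
      congr 1
      abel
    have hle : U ^ zs.length * S ≤ U ^ (zs.length + 1) * S := by
      refine mul_le_mul' ?_ le_rfl
      rw [pow_succ]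
      exact le_mul_of_one_le_right' one_le_unitSpan
    have hy : ∀ m, ∀ x ∈ U ^ m * S, y i * x ∈ U ^ (m + 1) * S := by
      intro m x hx
      have := Submodule.mul_mem_mul (mem_unitSpan (R := R) (y := y) i) hx
      rwa [← mul_assoc, ← pow_succ'] at this
    rw [h2]
    refine ⟨add_mem (hy _ _ ih1) (hle h1), ?_⟩
    have h3 : y i * prodSub zs (y i + c) + (c - algebraMap R A r) * prodSub zs (y i + c)
        - y i ^ (r :: zs).length = y i * (prodSub zs (y i + c) - y i ^ zs.length)
          + (c - algebraMap R A r) * prodSub zs (y i + c) := by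
      rw [List.length_cons, pow_succ', mul_sub]
      abel
    rw [h3, List.length_cons, Nat.add_sub_cancel]
    refine add_mem ?_ h1
    -- For an empty tail the truncated exponent 0 - 1 is 0 and the bound on the tail gains nothing,
    -- but the difference itself is then zero.
    rcases zs with _ | ⟨r', zs⟩
    · simp
    · exact hy _ _ ih2

namespace IsCyclotomic

/-- Conjugate X₁D₁ = P(y₁) by (0, i), which carries y₁ to the corrected element at i, not to y_i
itself. -/
theorem X_mul_D (h : IsCyclotomic hb k z w y X D) (i : Fin (n + 1)) :
    X i * D i = prodSub (List.ofFn z) (balanced k w y i) := by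
  have h1 : w (swap 0 i) * (X 0 * D 0) = X i * D i * w (swap 0 i) := by
    rw [← mul_assoc, h.equiv_X, mul_assoc, h.equiv_D, swap_apply_left, mul_assoc]
  rw [h.X_D, mul_prodSub_of_mul_eq (b := balanced k w y i)] at h1
  · exact (permHom_mul_right_cancel w _ h1).symm
  · have := h.hecke.isEquivariant_balanced (swap 0 i) 0
    rwa [balanced_zero, swap_apply_left] at this

theorem pow_sub_X_mul_D_mem (h : IsCyclotomic hb k z w y X D) (i : Fin (n + 1)) :
    y i ^ l - X i * D i ∈ unitSpan R y ^ (l - 1) * permSpan R w := by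
  obtain ⟨c, hc, hci⟩ := exists_balanced_eq (R := R) (k := k) (w := w) (y := y) i
  have := (prodSub_sub_pow_mem h.hecke i hc (List.ofFn z)).2
  rw [List.length_ofFn] at this
  rw [h.X_mul_D, hci, ← neg_sub]
  exact neg_mem this

/-- Moving D past one y produces permutations. Placing the group span in front of D absorbs them, so
the exchange can be iterated without raising the degree. -/
theorem span_D_mul_pow_le (h : IsCyclotomic hb k z w y X D) (m : ℕ) :
    Submodule.span R (Set.range D) * unitSpan R y ^ m
      ≤ unitSpan R y ^ m * permSpan R w * Submodule.span R (Set.range D) := by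
  set S := permSpan R w
  set U := unitSpan R y
  set LD := Submodule.span R (Set.range D)
  have h1 : S * LD * U ≤ U * (S * LD) :=
    calc S * LD * U = S * (LD * U) := mul_assoc _ _ _
      _ ≤ S * (U * S * LD) := mul_le_mul' le_rfl h.span_D_mul_unitSpan_le
      _ = S * (U * S) * LD := by simp only [mul_assoc]
      _ ≤ U * S * LD := mul_le_mul' (unitSpan_permSpan_mul_self h.hecke) le_rfl
      _ = U * (S * LD) := mul_assoc _ _ _
  calc LD * U ^ m ≤ S * LD * U ^ m :=
        mul_le_mul' (le_mul_of_one_le_left' (Submodule.one_le.2 one_mem_permSpan)) le_rfl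
    _ ≤ U ^ m * (S * LD) := mul_pow_le h1 m
    _ = U ^ m * S * LD := (mul_assoc _ _ _).symm

theorem basisSpan_mul_permSpan_le (h : IsCyclotomic hb k z w y X D) :
    basisSpan R l w y X D * permSpan R w ≤ basisSpan R l w y X D := by
  have hD : adjoinSpan R (Set.range D) * permSpan R w
      ≤ permSpan R w * adjoinSpan R (Set.range D) := by
    refine adjoinSpan_mul_le ?_
    rintro _ ⟨i, rfl⟩ v hv
    exact mul_le_mul' le_rfl (span_le_adjoinSpan _)
      (h.equiv_D.mul_permSpan_le (Submodule.mul_mem_mul (Submodule.subset_span ⟨i, rfl⟩) hv))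
  rw [basisSpan, mul_assoc _ (adjoinSpan R (Set.range D))]
  refine (mul_le_mul' le_rfl hD).trans (le_of_eq ?_)
  simp only [← mul_assoc]
  rw [mul_assoc _ (permSpan R w) (permSpan R w), permSpan_mul_self]

/-- Induction on the total degree m. If some exponent is at least l, replace y_i^l by X_i D_i plus
terms of degree at most l - 1; both resulting terms involve y-degree below m, which for the second
needs l ≥ 1. -/
theorem monom_mem_basisSpan (h : IsCyclotomic hb k z w y X D) (hl : 1 ≤ l) (m : ℕ) :
    ∀ b : Fin (n + 1) → ℕ, ∑ i, b i = m → monom y b ∈ basisSpan R l w y X D := by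
  induction m using Nat.strong_induction_on with
  | _ m ih =>
    intro b hb
    have hyc : ∀ i j, Commute (y i) (y j) := h.hecke.y_comm
    have hV : ∀ m' < m, unitSpan R y ^ m' * permSpan R w ≤ basisSpan R l w y X D := by
      intro m' hm'
      refine le_trans (mul_le_mul' ?_ le_rfl) h.basisSpan_mul_permSpan_le
      refine (unitSpan_pow_le hyc m').trans (Submodule.span_le.2 ?_)
      rintro _ ⟨b', hb', rfl⟩
      exact ih _ (lt_of_le_of_lt hb' hm') b' rfl
    by_cases hlt : ∀ i, b i < l
    · have h1 : monom y b ∈ restrictedSpan R l y :=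
        Submodule.subset_span ⟨fun i => ⟨b i, hlt i⟩, rfl⟩
      have h2 := Submodule.mul_mem_mul (Submodule.mul_mem_mul
        (Submodule.one_le.1 (one_le_adjoinSpan (R := R) (Set.range X)))
        (Submodule.mul_mem_mul h1 (one_mem_permSpan (R := R) (w := w))))
        (Submodule.one_le.1 (one_le_adjoinSpan (R := R) (Set.range D)))
      simpa using h2
    · push Not at hlt
      obtain ⟨i, hi⟩ := hlt
      set b' : Fin (n + 1) → ℕ := b - Pi.single i l with hb'
      have hbb : b = Pi.single i l + b' := by
        ext j
        rcases eq_or_ne j i with rfl | hj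
        · simp [hb', hi]
        · simp [hb', hj]
      have hsum : l + ∑ j, b' j = m := by
        rw [← hb, hbb]
        simp [Finset.sum_add_distrib]
      have h1 : monom y b = X i * (D i * monom y b') + (y i ^ l - X i * D i) * monom y b' := by
        rw [hbb, ← monom_mul_monom hyc, monom_single, sub_mul, mul_assoc]
        abel
      rw [h1]
      refine add_mem ?_ ?_
      · have h2 : X i * (D i * monom y b') ∈ adjoinSpan R (Set.range X)
            * (unitSpan R y ^ (∑ j, b' j) * permSpan R w * Submodule.span R (Set.range D)) :=
          Submodule.mul_mem_mul (X_mem i) (h.span_D_mul_pow_le _ (Submodule.mul_mem_mul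
            (Submodule.subset_span ⟨i, rfl⟩) (monom_mem_pow b')))
        refine (?_ : _ ≤ basisSpan R l w y X D) h2
        refine (mul_le_mul' le_rfl (mul_le_mul' (hV _ (by omega)) (span_le_adjoinSpan _))).trans
          (le_of_eq ?_)
        rw [basisSpan]
        simp only [← mul_assoc]
        rw [adjoinSpan_mul_self, mul_assoc _ (adjoinSpan R (Set.range D)), adjoinSpan_mul_self]
      · have h2 := Submodule.mul_mem_mul (h.pow_sub_X_mul_D_mem i) (monom_mem_pow (R := R) (y := y) b')
        refine (?_ : _ ≤ basisSpan R l w y X D) h2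
        refine le_trans ?_ (hV (l - 1 + ∑ j, b' j) (by omega))
        rw [mul_assoc]
        refine (mul_le_mul' le_rfl (mul_pow_le h.hecke.permSpan_mul_unitSpan_le _)).trans
          (le_of_eq ?_)
        rw [pow_add, mul_assoc]

theorem basisSpan_eq_top (h : IsCyclotomic hb k z w y X D) (hl : 1 ≤ l)
    (hgen : Algebra.adjoin R (Set.range w ∪ Set.range y ∪ Set.range X ∪ Set.range D) = ⊤) :
    basisSpan R l w y X D = ⊤ := by
  rw [eq_top_iff, ← h.triangular_eq_top hgen]
  have h1 : heckeSpan R w y ≤ basisSpan R l w y X D := by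
    refine h.hecke.heckeSpan_le.trans (le_trans (mul_le_mul' ?_ le_rfl) h.basisSpan_mul_permSpan_le)
    refine (adjoinSpan_range_le_span_monom h.hecke.y_comm).trans (Submodule.span_le.2 ?_)
    rintro _ ⟨b, rfl⟩
    exact h.monom_mem_basisSpan hl _ b rfl
  refine (mul_le_mul' (mul_le_mul' le_rfl h1) le_rfl).trans (le_of_eq ?_)
  rw [basisSpan]
  simp only [← mul_assoc]
  rw [adjoinSpan_mul_self, mul_assoc _ (adjoinSpan R (Set.range D)), adjoinSpan_mul_self]

/-- The monomials `M_X M_y s M_D`, with restricted `M_y`, span. -/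
theorem span_monomials_eq_top (h : IsCyclotomic hb k z w y X D) (hl : 1 ≤ l)
    (hgen : Algebra.adjoin R (Set.range w ∪ Set.range y ∪ Set.range X ∪ Set.range D) = ⊤) :
    Submodule.span R (Set.range fun p : (Fin (n + 1) → ℕ) × (Fin (n + 1) → Fin l)
      × Perm (Fin (n + 1)) × (Fin (n + 1) → ℕ) =>
      monom X p.1 * monom y (fun i => (p.2.1 i).val) * w p.2.2.1 * monom D p.2.2.2) = ⊤ := by
  rw [eq_top_iff, ← h.basisSpan_eq_top hl hgen]
  refine (mul_le_mul' (mul_le_mul' (adjoinSpan_range_le_span_monom h.X_comm) le_rfl)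
    (adjoinSpan_range_le_span_monom h.D_comm)).trans ?_
  simp only [Submodule.span_mul_span]
  refine Submodule.span_mono ?_
  rintro _ ⟨_, ⟨_, ⟨a, rfl⟩, _, ⟨_, ⟨b, rfl⟩, _, ⟨σ, rfl⟩, rfl⟩, rfl⟩, _, ⟨c, rfl⟩, rfl⟩
  exact ⟨(a, b, σ, c), by simp only [mul_assoc]⟩

end IsCyclotomic

end Restricted

end CycDAHA

namespace CycDAHA

open Equiv

/-! ### The presented algebra satisfies the cyclotomic relations. -/

section Presentation

variable {R : Type} [CommRing R] {n : ℕ} (hb k : R) {l : ℕ} (z : Fin l → R)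

/-- The symmetric group in the presented algebra. -/
def presPerm : Perm (Fin (n + 1)) →* CycPres R (n + 1) hb k z where
  toFun σ := CycPres.gen R hb k z (.s σ)
  map_one' := by
    simpa [CycPres.gen] using RingQuot.mkAlgHom_rel R (CycRel.s_one (R := R) (hb := hb) (k := k))
  map_mul' σ τ := by
    simpa [CycPres.gen] using
      RingQuot.mkAlgHom_rel R (CycRel.s_mul (R := R) (hb := hb) (k := k) (z := z) σ τ)

theorem mkAlgHom_sumSwap : RingQuot.mkAlgHom R (CycRel R (n + 1) hb k z) (sumSwap R (n + 1))
    = ∑ j ∈ Finset.univ.erase 0, presPerm hb k z (swap 0 j) := by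
  simp [sumSwap, presPerm, CycPres.gen]

set_option linter.unusedSimpArgs false in
theorem isCyclotomic_pres : IsCyclotomic hb k z (presPerm (n := n) hb k z)
    (fun i => CycPres.gen R hb k z (.y i)) (fun i => CycPres.gen R hb k z (.X i))
    (fun i => CycPres.gen R hb k z (.D i)) := by
  have rel : ∀ {a b}, CycRel R (n + 1) hb k z a b → RingQuot.mkAlgHom R (CycRel R (n + 1) hb k z) a
      = RingQuot.mkAlgHom R (CycRel R (n + 1) hb k z) b := fun h => RingQuot.mkAlgHom_rel R h
  refine ⟨⟨fun i hi => ?_, fun i j hi h₁ h₂ => ?_, fun i j => ?_⟩, fun σ i => ?_, fun i j => ?_,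
    fun i hi => ?_, ?_, fun σ i => ?_, fun i j => ?_, fun i hi => ?_, ?_, ?_, fun i hi => ?_, ?_⟩
  · have := rel (.s_y i hi)
    simp only [map_mul, map_add, map_sub, map_neg, map_smul, AlgHom.commutes, map_prodSub,
      map_sumInsert, mkAlgHom_sumSwap] at this
    exact this
  · have := rel (.s_y_comm i j hi h₁ h₂)
    simp only [map_mul, map_add, map_sub, map_neg, map_smul, AlgHom.commutes, map_prodSub,
      map_sumInsert, mkAlgHom_sumSwap] at this
    exact this
  · have := rel (.y_comm i j)
    simp only [map_mul, map_add, map_sub, map_neg, map_smul, AlgHom.commutes, map_prodSub,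
      map_sumInsert, mkAlgHom_sumSwap] at this
    exact this
  · have := rel (.s_X σ i)
    simp only [map_mul, map_add, map_sub, map_neg, map_smul, AlgHom.commutes, map_prodSub,
      map_sumInsert, mkAlgHom_sumSwap] at this
    exact this
  · have := rel (.X_comm i j)
    simp only [map_mul, map_add, map_sub, map_neg, map_smul, AlgHom.commutes, map_prodSub,
      map_sumInsert, mkAlgHom_sumSwap] at this
    exact this
  · have := rel (.y_X i hi)
    simp only [map_mul, map_add, map_sub, map_neg, map_smul, AlgHom.commutes, map_prodSub,
      map_sumInsert, mkAlgHom_sumSwap] at this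
    exact this
  · have := rel .y_X_zero
    simp only [map_mul, map_add, map_sub, map_neg, map_smul, AlgHom.commutes, map_prodSub,
      map_sumInsert, mkAlgHom_sumSwap] at this
    exact this
  · have := rel (.s_D σ i)
    simp only [map_mul, map_add, map_sub, map_neg, map_smul, AlgHom.commutes, map_prodSub,
      map_sumInsert, mkAlgHom_sumSwap] at this
    exact this
  · have := rel (.D_comm i j)
    simp only [map_mul, map_add, map_sub, map_neg, map_smul, AlgHom.commutes, map_prodSub,
      map_sumInsert, mkAlgHom_sumSwap] at this
    exact this
  · have := rel (.y_D i hi)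
    simp only [map_mul, map_add, map_sub, map_neg, map_smul, AlgHom.commutes, map_prodSub,
      map_sumInsert, mkAlgHom_sumSwap] at this
    exact this
  · have := rel .y_D_zero
    simp only [map_mul, map_add, map_sub, map_neg, map_smul, AlgHom.commutes, map_prodSub,
      map_sumInsert, mkAlgHom_sumSwap] at this
    exact this
  · have := rel .D_X_zero
    simp only [map_mul, map_add, map_sub, map_neg, map_smul, AlgHom.commutes, map_prodSub,
      map_sumInsert, mkAlgHom_sumSwap] at this
    exact this
  · have := rel (.D_X i hi)
    simp only [map_mul, map_add, map_sub, map_neg, map_smul, AlgHom.commutes, map_prodSub,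
      map_sumInsert, mkAlgHom_sumSwap] at this
    exact this
  · have := rel .X_D
    simp only [map_mul, map_add, map_sub, map_neg, map_smul, AlgHom.commutes, map_prodSub,
      map_sumInsert, mkAlgHom_sumSwap] at this
    exact this

theorem adjoin_pres_eq_top : Algebra.adjoin R (Set.range (presPerm (n := n) hb k z)
    ∪ Set.range (fun i => CycPres.gen R hb k z (.y i))
    ∪ Set.range (fun i => CycPres.gen R hb k z (.X i))
    ∪ Set.range (fun i => CycPres.gen R hb k z (.D i))) = ⊤ := by
  refine CycPres.eq_top_of_gen_mem _ fun g => Algebra.subset_adjoin ?_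
  rcases g with σ | i | i | i
  · exact Or.inl (Or.inl (Or.inl ⟨σ, rfl⟩))
  · exact Or.inl (Or.inl (Or.inr ⟨i, rfl⟩))
  · exact Or.inl (Or.inr ⟨i, rfl⟩)
  · exact Or.inr ⟨i, rfl⟩

end Presentation

end CycDAHA

namespace CycDAHA

open Equiv

/-! ### The extended affine symmetric group and its relations. -/

section AffinePermutations

/-- The extended affine symmetric group: permutations of `ℤ` commuting with the shift by `N`. -/
def affPerm (N : ℕ) : Subgroup (Perm ℤ) where
  carrier := {g | ∀ i, g (i + N) = g i + N}
  one_mem' _ := rfl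
  mul_mem' {a b} ha hb i := by
    change a (b (i + N)) = a (b i) + N
    rw [hb, ha]
  inv_mem' {a} ha i := by
    rw [Perm.inv_eq_iff_eq, ha]
    simp

variable {N : ℕ}

namespace affPerm

theorem apply_add_mul (g : affPerm N) (i m : ℤ) : g.1 (i + N * m) = g.1 i + N * m := by
  induction m using Int.induction_on with
  | zero => simp
  | succ m ih => rw [mul_add, mul_one, ← add_assoc, g.2, ih, add_assoc]
  | pred m ih =>
    have := g.2 (i + N * (-m - 1))
    rw [show i + N * (-(m : ℤ) - 1) + N = i + N * (-m) by ring, ih] at this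
    linarith

variable (N) in
/-- The shift by `1`. -/
def shift : affPerm N := ⟨Equiv.addRight 1, fun i => by simp [add_right_comm]⟩

@[simp]
theorem shift_apply (i : ℤ) : (shift N).1 i = i + 1 := rfl

/-- The underlying function of an affine simple reflection. -/
def reflFun (N : ℕ) (j i : ℤ) : ℤ :=
  if N = 1 then i else if (N : ℤ) ∣ i - j then i + 1 else if (N : ℤ) ∣ i - j - 1 then i - 1 else i

theorem not_dvd_one (hN : N ≠ 1) : ¬ (N : ℤ) ∣ 1 := by
  rw [show (1 : ℤ) = ((1 : ℕ) : ℤ) by rfl, Int.natCast_dvd_natCast, Nat.dvd_one]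
  exact hN

theorem not_dvd_add_one (hN : N ≠ 1) {a : ℤ} (h : (N : ℤ) ∣ a) : ¬ (N : ℤ) ∣ a + 1 :=
  fun h' => not_dvd_one hN ((dvd_add_right h).1 h')

theorem reflFun_of_dvd (hN : N ≠ 1) {j i : ℤ} (h : (N : ℤ) ∣ i - j) : reflFun N j i = i + 1 := by
  rw [reflFun, if_neg hN, if_pos h]

theorem reflFun_of_dvd' (hN : N ≠ 1) {j i : ℤ} (h : (N : ℤ) ∣ i - j - 1) :
    reflFun N j i = i - 1 := by
  have := not_dvd_add_one hN h
  rw [sub_add_cancel] at this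
  rw [reflFun, if_neg hN, if_neg this, if_pos h]

theorem reflFun_of_not_dvd {j i : ℤ} (h : ¬ (N : ℤ) ∣ i - j)
    (h' : ¬ (N : ℤ) ∣ i - j - 1) : reflFun N j i = i := by
  rw [reflFun, if_neg h, if_neg h', ite_self]

theorem reflFun_involutive (j : ℤ) : Function.Involutive (reflFun N j) := by
  intro i
  by_cases hN : N = 1
  · simp [reflFun, hN]
  by_cases h : (N : ℤ) ∣ i - j
  · rw [reflFun_of_dvd hN h, reflFun_of_dvd' hN (by convert h using 1; ring)]
    ring
  by_cases h' : (N : ℤ) ∣ i - j - 1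
  · rw [reflFun_of_dvd' hN h', reflFun_of_dvd hN (by convert h' using 1; ring)]
    ring
  · rw [reflFun_of_not_dvd h h', reflFun_of_not_dvd h h']

variable (N) in
/-- The affine simple reflections. -/
def refl (j : ℤ) : affPerm N := ⟨(reflFun_involutive (N := N) j).toPerm, fun i => by
  have h1 : i + N - j = i - j + N := by ring
  have h2 : i - j + N - 1 = i - j - 1 + N := by ring
  simp only [Function.Involutive.coe_toPerm, reflFun, h1, h2, dvd_add_self_right]
  split_ifs <;> ring⟩

theorem refl_apply (j i : ℤ) : (refl N j).1 i = reflFun N j i := rfl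

theorem refl_mul_self (j : ℤ) : refl N j * refl N j = 1 :=
  Subtype.ext (Equiv.ext fun i => reflFun_involutive j i)

theorem refl_apply_left (hN : N ≠ 1) (j : ℤ) : (refl N j).1 j = j + 1 :=
  reflFun_of_dvd hN (by simp)

theorem refl_apply_right (hN : N ≠ 1) (j : ℤ) : (refl N j).1 (j + 1) = j := by
  rw [refl_apply, reflFun_of_dvd' hN (by simp), add_sub_cancel_right]

theorem refl_eq_one (hN : N = 1) (j : ℤ) : refl N j = 1 :=
  Subtype.ext (Equiv.ext fun i => by
    change reflFun N j i = i
    rw [reflFun, if_pos hN])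

theorem refl_add (j : ℤ) : refl N (j + N) = refl N j :=
  Subtype.ext (Equiv.ext fun i => by
    have h1 : i - (j + N) = i - j - N := by ring
    have h2 : i - j - N - 1 = i - j - 1 - N := by ring
    change reflFun N (j + N) i = reflFun N j i
    simp only [reflFun, h1, h2, dvd_sub_self_right])

theorem shift_mul_refl (j : ℤ) : shift N * refl N j = refl N (j + 1) * shift N :=
  Subtype.ext (Equiv.ext fun i => by
    change reflFun N j i + 1 = reflFun N (j + 1) (i + 1)
    have h1 : i + 1 - (j + 1) = i - j := by ring
    simp only [reflFun, h1]
    split_ifs <;> ring)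

theorem not_dvd_of_lt {a : ℤ} (h0 : 0 < a) (h : a < N) : ¬ (N : ℤ) ∣ a :=
  fun hd => absurd (Int.le_of_dvd h0 hd) (by omega)

theorem refl_braid (hN : 2 < N) (j : ℤ) :
    refl N j * refl N (j + 1) * refl N j = refl N (j + 1) * refl N j * refl N (j + 1) := by
  have hN1 : N ≠ 1 := by omega
  have e1 : (refl N j).1 (j + 1 + 1) = j + 1 + 1 := by
    refine reflFun_of_not_dvd ?_ ?_
    · rw [show j + 1 + 1 - j = 2 by ring]; exact not_dvd_of_lt (by norm_num) (by omega)
    · rw [show j + 1 + 1 - j - 1 = 1 by ring]; exact not_dvd_one hN1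
  have e2 : (refl N (j + 1)).1 j = j := by
    refine reflFun_of_not_dvd ?_ ?_
    · rw [show j - (j + 1) = -1 by ring, dvd_neg]; exact not_dvd_one hN1
    · rw [show j - (j + 1) - 1 = -2 by ring, dvd_neg]
      exact not_dvd_of_lt (by norm_num) (by omega)
  refine Subtype.ext (Equiv.ext fun i => ?_)
  change (refl N j).1 ((refl N (j + 1)).1 ((refl N j).1 i))
    = (refl N (j + 1)).1 ((refl N j).1 ((refl N (j + 1)).1 i))
  -- Affine permutations commute with translation by N, so it suffices to follow j, j+1 and j+2;
  -- both reflections fix every other residue class.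
  have hi : (∃ m, i = j + N * m) ∨ (∃ m, i = j + 1 + N * m) ∨ (∃ m, i = j + 1 + 1 + N * m) ∨
      ((refl N j).1 i = i ∧ (refl N (j + 1)).1 i = i) := by
    by_cases h1 : (N : ℤ) ∣ i - j
    · obtain ⟨m, hm⟩ := h1
      exact Or.inl ⟨m, by linarith⟩
    by_cases h2 : (N : ℤ) ∣ i - j - 1
    · obtain ⟨m, hm⟩ := h2
      exact Or.inr (Or.inl ⟨m, by linarith⟩)
    by_cases h3 : (N : ℤ) ∣ i - (j + 1) - 1
    · obtain ⟨m, hm⟩ := h3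
      exact Or.inr (Or.inr (Or.inl ⟨m, by linarith⟩))
    · refine Or.inr (Or.inr (Or.inr ⟨reflFun_of_not_dvd h1 h2, reflFun_of_not_dvd ?_ h3⟩))
      rwa [← sub_sub]
  rcases hi with ⟨m, rfl⟩ | ⟨m, rfl⟩ | ⟨m, rfl⟩ | ⟨h1, h2⟩
  · simp only [apply_add_mul, refl_apply_left hN1, e1, e2]
  · simp only [apply_add_mul, refl_apply_left hN1, refl_apply_right hN1, e1, e2]
  · simp only [apply_add_mul, refl_apply_right hN1, e1, e2]
  · simp only [h1, h2]

theorem refl_comm {i j : ℤ} (h0 : ¬ (N : ℤ) ∣ j - i) (h1 : ¬ (N : ℤ) ∣ j - i - 1)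
    (h2 : ¬ (N : ℤ) ∣ i - j - 1) : refl N i * refl N j = refl N j * refl N i := by
  by_cases hN : N = 1
  · simp [refl_eq_one hN]
  have h0' : ¬ (N : ℤ) ∣ i - j := fun h => h0 (by rw [← neg_sub]; exact (dvd_neg).2 h)
  have fix : ∀ {a b c : ℤ}, ¬ (N : ℤ) ∣ c - b → ¬ (N : ℤ) ∣ c - b - 1 → (N : ℤ) ∣ a - c →
      reflFun N b a = a := by
    intro a b c h h' hd
    refine reflFun_of_not_dvd ?_ ?_
    · intro hh
      refine h ?_
      have := dvd_sub hh hd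
      rwa [show a - b - (a - c) = c - b by ring] at this
    · intro hh
      refine h' ?_
      have := dvd_sub hh hd
      rwa [show a - b - 1 - (a - c) = c - b - 1 by ring] at this
  have key : ∀ {i j : ℤ}, ¬ (N : ℤ) ∣ j - i → ¬ (N : ℤ) ∣ i - j → ¬ (N : ℤ) ∣ j - i - 1 →
      ¬ (N : ℤ) ∣ i - j - 1 → ∀ x, ((N : ℤ) ∣ x - i ∨ (N : ℤ) ∣ x - i - 1) →
      reflFun N i (reflFun N j x) = reflFun N j (reflFun N i x) := by
    intro i j h0 h0' h1 h2 x hx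
    have h3 : ¬ (N : ℤ) ∣ i + 1 - j := by
      intro h
      refine h1 ((dvd_neg).1 ?_)
      rwa [show -(j - i - 1) = i + 1 - j by ring]
    have h4 : ¬ (N : ℤ) ∣ i + 1 - j - 1 := by rwa [show i + 1 - j - 1 = i - j by ring]
    rcases hx with hx | hx
    · rw [fix h0' h2 hx, reflFun_of_dvd hN hx,
        fix h3 h4 (by rwa [show x + 1 - (i + 1) = x - i by ring])]
    · rw [fix h3 h4 (by rwa [← sub_sub]), reflFun_of_dvd' hN hx,
        fix h0' h2 (by rwa [show x - 1 - i = x - i - 1 by ring])]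
  refine Subtype.ext (Equiv.ext fun x => ?_)
  change reflFun N i (reflFun N j x) = reflFun N j (reflFun N i x)
  by_cases hx : (N : ℤ) ∣ x - i ∨ (N : ℤ) ∣ x - i - 1
  · exact key h0 h0' h1 h2 x hx
  by_cases hx' : (N : ℤ) ∣ x - j ∨ (N : ℤ) ∣ x - j - 1
  · exact (key h0' h0 h2 h1 x hx').symm
  · push Not at hx hx'
    rw [reflFun_of_not_dvd hx.1 hx.2, reflFun_of_not_dvd hx'.1 hx'.2,
      reflFun_of_not_dvd hx.1 hx.2]

end affPerm

end AffinePermutations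

end CycDAHA

namespace CycDAHA

open Equiv

noncomputable section

namespace affPerm

/-! ### Demazure-Lusztig operators. -/

section Operators

variable {R : Type} {E : Type*} [CommRing R] [CommRing E] [Algebra R E] {N : ℕ}

variable (R E) in
/-- Translation of functions on the extended affine symmetric group. -/
def transOp (x : affPerm N) : Module.End R (affPerm N → E) where
  toFun f g := f (g * x)
  map_add' _ _ := rfl
  map_smul' _ _ := rfl

theorem transOp_apply (x g : affPerm N) (f : affPerm N → E) : transOp R E x f g = f (g * x) := rfl

theorem transOp_mul (x x' : affPerm N) : transOp R E x * transOp R E x' = transOp R E (x * x') := by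
  ext f g
  simp only [Module.End.mul_apply, transOp_apply, mul_assoc]

theorem transOp_one : transOp R E (1 : affPerm N) = 1 := by
  ext f g
  simp [transOp_apply]

variable [Algebra ℚ E] (N)

/-- The value `-h m / N`. -/
def lam (h : E) (m : ℤ) : E := -(h * algebraMap ℚ E (m / N))

/-- The value `t N / m`. -/
def beta (t : E) (m : ℤ) : E := t * algebraMap ℚ E (N / m)

variable {N} {h t : E}

theorem beta_neg (m : ℤ) : beta N t (-m) = -beta N t m := by
  simp [beta, div_neg]

/-- The partial fraction identity 1/(ab) = (1/a + 1/b)/(a + b), on which the braid relation rests.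
-/
theorem beta_mul_beta {a b : ℤ} (ha : a ≠ 0) (hb : b ≠ 0) (hab : a + b ≠ 0) :
    beta N t a * beta N t b = (beta N t a + beta N t b) * beta N t (a + b) := by
  have ha' : (a : ℚ) ≠ 0 := by exact_mod_cast ha
  have hb' : (b : ℚ) ≠ 0 := by exact_mod_cast hb
  have hab' : (a + b : ℚ) ≠ 0 := by exact_mod_cast hab
  have key : (N / a : ℚ) * (N / b) = (N / a + N / b) * (N / (a + b : ℤ)) := by
    push_cast
    field_simp
    ring
  have key' := congrArg (algebraMap ℚ E) key
  simp only [map_mul, map_add] at key'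
  simp only [beta]
  linear_combination t * t * key'

/-- The normalization that produces k = ħt: the denominator in `beta` cancels against the difference
of two eigenvalues of y. Taking k to be a multiple of ħ is what avoids dividing by ħ. -/
theorem beta_mul_lam_sub (hN : N ≠ 0) {a b : ℤ} (hab : b - a ≠ 0) :
    beta N t (b - a) * (lam N h a - lam N h b) = h * t := by
  have hab' : ((b - a : ℤ) : ℚ) ≠ 0 := by exact_mod_cast hab
  have hN' : (N : ℚ) ≠ 0 := by exact_mod_cast hN
  have key : (N / (b - a : ℤ) : ℚ) * (b / N - a / N) = 1 := by
    push_cast at hab' ⊢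
    field_simp
  have key' := congrArg (algebraMap ℚ E) key
  simp only [map_mul, map_sub, map_one] at key'
  simp only [beta, lam]
  linear_combination h * t * key'

theorem lam_add_mul (hN : N ≠ 0) (a m : ℤ) :
    lam N h (a + N * m) = lam N h a - h * algebraMap ℚ E m := by
  have hN' : (N : ℚ) ≠ 0 := by exact_mod_cast hN
  have key : ((a + N * m : ℤ) : ℚ) / N = a / N + m := by
    push_cast
    field_simp
  simp only [lam, key, map_add]
  ring

/-- The factor 1/N in `lam` is chosen so that one full period shifts the value by -h, as demanded by
π y_N = (y₁ - ħ)π. -/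
theorem lam_add_natCast (hN : N ≠ 0) (a : ℤ) : lam N h (a + N) = lam N h a - h := by
  have := lam_add_mul (h := h) hN a 1
  simpa using this

variable (R) in
/-- The multiplication operators representing `y_i`. -/
def yOp (h : E) (i : ℤ) : Module.End R (affPerm N → E) where
  toFun f g := lam N h (g.1 i) * f g
  map_add' _ _ := funext fun _ => mul_add _ _ _
  map_smul' _ _ := funext fun _ => mul_smul_comm _ _ _

variable (R) in
/-- The Demazure-Lusztig operators representing `s_j`. -/
def sOp (t : E) (j : ℤ) : Module.End R (affPerm N → E) where
  toFun f g := (1 - beta N t (g.1 (j + 1) - g.1 j)) * f (g * refl N j)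
    + beta N t (g.1 (j + 1) - g.1 j) * f g
  map_add' _ _ := funext fun _ => by simp only [Pi.add_apply]; ring
  map_smul' _ _ := funext fun _ => by
    simp only [Pi.smul_apply, RingHom.id_apply, mul_smul_comm, smul_add]

theorem yOp_apply (i : ℤ) (g : affPerm N) (f : affPerm N → E) :
    yOp R h i f g = lam N h (g.1 i) * f g := rfl

theorem sOp_apply (j : ℤ) (g : affPerm N) (f : affPerm N → E) :
    sOp R t j f g = (1 - beta N t (g.1 (j + 1) - g.1 j)) * f (g * refl N j)
      + beta N t (g.1 (j + 1) - g.1 j) * f g := rfl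

theorem mul_apply (g x : affPerm N) (i : ℤ) : (g * x).1 i = g.1 (x.1 i) := rfl

theorem mul_refl_mul_refl (g : affPerm N) (j : ℤ) : g * refl N j * refl N j = g := by
  rw [mul_assoc, refl_mul_self, mul_one]

theorem sub_ne_zero_of_ne (g : affPerm N) {i j : ℤ} (hij : i ≠ j) : g.1 i - g.1 j ≠ 0 :=
  sub_ne_zero.2 fun hh => hij (g.1.injective hh)

theorem sOp_eq_one (hN : N = 1) (j : ℤ) : sOp (N := N) R t j = 1 := by
  ext f g
  simp only [sOp_apply, refl_eq_one hN, mul_one, Module.End.one_apply]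
  ring

/-- As `beta` is odd and the reflection reverses the sign of its argument, the identity amounts to
(1 - β)(1 + β) + β² = 1. -/
theorem sOp_mul_self (j : ℤ) : sOp (N := N) R t j * sOp R t j = 1 := by
  by_cases hN : N = 1
  · rw [sOp_eq_one hN, one_mul]
  ext f g
  have h1 : beta N t ((g * refl N j).1 (j + 1) - (g * refl N j).1 j)
      = -beta N t (g.1 (j + 1) - g.1 j) := by
    rw [mul_apply, mul_apply, refl_apply_left hN, refl_apply_right hN, ← neg_sub, beta_neg]
  simp only [Module.End.mul_apply, Module.End.one_apply, sOp_apply, h1, mul_refl_mul_refl]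
  ring

theorem sOp_add (j : ℤ) : sOp (N := N) R t (j + N) = sOp R t j := by
  ext f g
  have h1 : g.1 (j + N + 1) = g.1 (j + 1) + N := by rw [add_right_comm, g.2]
  have h2 : g.1 (j + N) = g.1 j + N := g.2 j
  simp only [sOp_apply, refl_add, h1, h2, add_sub_add_right_eq_sub]

theorem shift_mul_sOp (j : ℤ) :
    transOp R E (shift N) * sOp R t j = sOp R t (j + 1) * transOp R E (shift N) := by
  ext f g
  simp only [Module.End.mul_apply, sOp_apply, transOp_apply, mul_apply, shift_apply, mul_assoc,
    shift_mul_refl]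

theorem yOp_comm (i j : ℤ) : yOp (N := N) R h i * yOp R h j = yOp R h j * yOp R h i := by
  ext f g
  simp only [Module.End.mul_apply, yOp_apply]
  ring

theorem yOp_add (hN : N ≠ 0) (i : ℤ) (f : affPerm N → E) :
    yOp R h (i + N) f = yOp R h i f - h • f := by
  ext g
  have h2 : g.1 (i + N) = g.1 i + N := g.2 i
  simp only [yOp_apply, h2, lam_add_natCast hN, Pi.sub_apply, Pi.smul_apply, smul_eq_mul]
  ring

theorem shift_mul_yOp (i : ℤ) :
    transOp R E (shift N) * yOp R h i = yOp R h (i + 1) * transOp R E (shift N) := by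
  ext f g
  simp only [Module.End.mul_apply, yOp_apply, transOp_apply, mul_apply, shift_apply]

theorem sOp_mul_yOp (hN : N ≠ 1) (hN0 : N ≠ 0) (j : ℤ) (f : affPerm N → E) :
    sOp R t j (yOp R h j f) = yOp R h (j + 1) (sOp R t j f) + (h * t) • f := by
  ext g
  have h1 := beta_mul_lam_sub (h := h) (t := t) hN0 (sub_ne_zero_of_ne g (show j + 1 ≠ j by simp))
  simp only [yOp_apply, sOp_apply, Pi.add_apply, Pi.smul_apply, smul_eq_mul, mul_apply,
    refl_apply_left hN]
  linear_combination f g * h1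

theorem sOp_mul_yOp_comm {i j : ℤ} (h1 : ¬ (N : ℤ) ∣ j - i) (h2 : ¬ (N : ℤ) ∣ j - i - 1) :
    sOp (N := N) R t i * yOp R h j = yOp R h j * sOp R t i := by
  ext f g
  have h3 : (refl N i).1 j = j := reflFun_of_not_dvd h1 h2
  simp only [Module.End.mul_apply, yOp_apply, sOp_apply, mul_apply, h3]
  ring

theorem sOp_comm {i j : ℤ} (h0 : ¬ (N : ℤ) ∣ j - i) (h1 : ¬ (N : ℤ) ∣ j - i - 1)
    (h2 : ¬ (N : ℤ) ∣ i - j - 1) : sOp (N := N) R t i * sOp R t j = sOp R t j * sOp R t i := by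
  have h0' : ¬ (N : ℤ) ∣ i - j := fun h => h0 (by rw [← neg_sub]; exact (dvd_neg).2 h)
  have e1 : (refl N i).1 j = j := reflFun_of_not_dvd h0 h1
  have e2 : (refl N j).1 i = i := reflFun_of_not_dvd h0' h2
  have e3 : (refl N i).1 (j + 1) = j + 1 := by
    refine reflFun_of_not_dvd ?_ (by rwa [show j + 1 - i - 1 = j - i by ring])
    intro hh
    refine h2 ((dvd_neg).1 ?_)
    rwa [show -(i - j - 1) = j + 1 - i by ring]
  have e4 : (refl N j).1 (i + 1) = i + 1 := by
    refine reflFun_of_not_dvd ?_ (by rwa [show i + 1 - j - 1 = i - j by ring])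
    intro hh
    refine h1 ((dvd_neg).1 ?_)
    rwa [show -(j - i - 1) = i + 1 - j by ring]
  ext f g
  simp only [Module.End.mul_apply, sOp_apply, mul_apply, e1, e2, e3, e4, mul_assoc,
    refl_comm h0 h1 h2]
  ring

/-- The terms with the longest translation match by the braid relation in the group; the remaining
difference is a multiple of the partial fraction identity. -/
theorem sOp_braid (hN : 2 < N) (j : ℤ) :
    sOp (N := N) R t j * sOp R t (j + 1) * sOp R t j
      = sOp R t (j + 1) * sOp R t j * sOp R t (j + 1) := by
  have hN1 : N ≠ 1 := by omega
  have e1 : (refl N j).1 (j + 1 + 1) = j + 1 + 1 := by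
    refine reflFun_of_not_dvd ?_ ?_
    · rw [show j + 1 + 1 - j = 2 by ring]; exact not_dvd_of_lt (by norm_num) (by omega)
    · rw [show j + 1 + 1 - j - 1 = 1 by ring]; exact not_dvd_one hN1
  have e2 : (refl N (j + 1)).1 j = j := by
    refine reflFun_of_not_dvd ?_ ?_
    · rw [show j - (j + 1) = -1 by ring, dvd_neg]; exact not_dvd_one hN1
    · rw [show j - (j + 1) - 1 = -2 by ring, dvd_neg]
      exact not_dvd_of_lt (by norm_num) (by omega)
  have hb := refl_braid hN j
  simp only [mul_assoc] at hb
  ext f g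
  have hab := sub_ne_zero_of_ne g (show j + 1 ≠ j by simp)
  have hbc := sub_ne_zero_of_ne g (show j + 1 + 1 ≠ j + 1 by simp)
  have hac := sub_ne_zero_of_ne g (show j + 1 + 1 ≠ j by omega)
  have key := beta_mul_beta (N := N) (t := t) hab hbc (by convert hac using 1; ring)
  rw [show g.1 (j + 1) - g.1 j + (g.1 (j + 1 + 1) - g.1 (j + 1))
    = g.1 (j + 1 + 1) - g.1 j by ring] at key
  have n1 : beta N t (g.1 j - g.1 (j + 1)) = -beta N t (g.1 (j + 1) - g.1 j) := by
    rw [← neg_sub, beta_neg]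
  have n2 : beta N t (g.1 (j + 1) - g.1 (j + 1 + 1)) = -beta N t (g.1 (j + 1 + 1) - g.1 (j + 1)) := by
    rw [← neg_sub, beta_neg]
  simp only [Module.End.mul_apply, sOp_apply, mul_apply, e1, e2, refl_apply_left hN1,
    refl_apply_right hN1, mul_assoc, hb, refl_mul_self, mul_one, n1, n2]
  set a := beta N t (g.1 (j + 1) - g.1 j)
  set b := beta N t (g.1 (j + 1 + 1) - g.1 (j + 1))
  set c := beta N t (g.1 (j + 1 + 1) - g.1 j)
  linear_combination ((a - b) * f g + (1 - a) * f (g * refl N j)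
    - (1 - b) * f (g * refl N (j + 1))) * key

/-! ### The representation of the degenerate DAHA. -/

section Representation

variable (n : ℕ) (h t : E)

variable (R) in
/-- The operators representing the generators of the degenerate DAHA. -/
def genOp : DegGen (n + 1) → Module.End R (affPerm (n + 1) → E)
  | .pi => transOp R E (shift (n + 1))
  | .piInv => transOp R E (shift (n + 1))⁻¹
  | .s i => sOp R t i.val
  | .y i => yOp R h i.val

variable {n h t}

theorem natCast_dvd_val_sub {i j : Fin (n + 1)} (h : ((n + 1 : ℕ) : ℤ) ∣ (j.val : ℤ) - i.val) :
    j = i := by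
  have hi := i.2
  have hj := j.2
  have h0 : (j.val : ℤ) - i.val = 0 :=
    Int.eq_zero_of_abs_lt_dvd h (abs_lt.2 ⟨by omega, by omega⟩)
  ext
  omega

theorem exists_val_add_one (i : Fin (n + 1)) :
    ((i + 1).val : ℤ) = i.val + 1 ∧ i.val + 1 < n + 1
      ∨ ((i + 1).val : ℤ) + ((n + 1 : ℕ) : ℤ) = i.val + 1 ∧ i.val = n := by
  rw [Fin.val_add_one]
  have := i.2
  split_ifs with hi
  · right
    subst hi
    simp
  · left
    rw [Fin.ext_iff, Fin.val_last] at hi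
    refine ⟨by simp, by omega⟩

theorem natCast_dvd_val_sub_sub {i j : Fin (n + 1)}
    (h : ((n + 1 : ℕ) : ℤ) ∣ (j.val : ℤ) - i.val - 1) : j = i + 1 := by
  refine natCast_dvd_val_sub ?_
  rcases exists_val_add_one i with ⟨h1, -⟩ | ⟨h1, -⟩
  · rwa [h1, ← sub_sub]
  · rw [eq_sub_of_add_eq h1, sub_sub_eq_add_sub, add_sub_right_comm, ← sub_sub]
    exact dvd_add_self_right.2 h

theorem sOp_val_add_one (i : Fin (n + 1)) :
    sOp (N := n + 1) R t ((i + 1).val : ℤ) = sOp R t (i.val + 1) := by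
  rcases exists_val_add_one i with ⟨h1, -⟩ | ⟨h1, -⟩
  · rw [h1]
  · rw [← h1, sOp_add]

/-- Indices in `Fin (n + 1)` are lifted to integers, where the relations are uniform. At the
wraparound, periodicity returns the index n + 1 to 0, and this creates the -ħ. -/
theorem lift_genOp_rel {hb k : R} (hh : algebraMap R E hb = h) (hk : algebraMap R E k = h * t)
    ⦃a b : DegFree R (n + 1)⦄ (hab : DegRel R (n + 1) hb k a b) :
    FreeAlgebra.lift R (genOp R n h t) a = FreeAlgebra.lift R (genOp R n h t) b := by
  cases hab <;> simp only [map_mul, map_add, map_sub, map_one, FreeAlgebra.lift_ι_apply, genOp,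
    AlgHom.commutes]
  case pi_piInv => rw [transOp_mul, mul_inv_cancel, transOp_one]
  case piInv_pi => rw [transOp_mul, inv_mul_cancel, transOp_one]
  case s_sq i => exact sOp_mul_self _
  case s_one h i => exact sOp_eq_one h _
  case s_braid h i =>
    rw [sOp_val_add_one]
    exact sOp_braid h _
  case s_comm i j h₁ h₂ =>
    rcases eq_or_ne i j with rfl | hij
    · rfl
    exact sOp_comm (fun hd => hij (natCast_dvd_val_sub hd).symm)
      (fun hd => h₁ (natCast_dvd_val_sub_sub hd)) (fun hd => h₂ (natCast_dvd_val_sub_sub hd))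
  case pi_s i => rw [sOp_val_add_one, shift_mul_sOp]
  case y_comm i j => exact yOp_comm _ _
  case pi_y i hi =>
    rcases exists_val_add_one i with ⟨h1, -⟩ | ⟨-, h1⟩
    · rw [h1, shift_mul_yOp]
    · omega
  case pi_y_last i hi =>
    have h1 : ((0 : Fin (n + 1)).val : ℤ) + ((n + 1 : ℕ) : ℤ) = i.val + 1 := by
      have hi : i.val = n := by omega
      simp [hi]
    rw [shift_mul_yOp, ← h1]
    refine LinearMap.ext fun f => ?_
    simp only [Module.End.mul_apply, yOp_add (Nat.succ_ne_zero n), LinearMap.sub_apply,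
      Module.algebraMap_end_apply, ← hh, algebraMap_smul]
  case s_y i hi =>
    rcases exists_val_add_one i with ⟨h1, -⟩ | ⟨-, h1⟩
    · rw [h1]
      refine LinearMap.ext fun f => ?_
      simp only [Module.End.mul_apply, LinearMap.add_apply, Module.algebraMap_end_apply,
        sOp_mul_yOp (show n + 1 ≠ 1 by omega) (Nat.succ_ne_zero n), ← hk, algebraMap_smul]
    · omega
  case s_y_last hN i hi =>
    have h1 : ((0 : Fin (n + 1)).val : ℤ) + ((n + 1 : ℕ) : ℤ) = i.val + 1 := by
      have hi : i.val = n := by omega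
      simp [hi]
    refine LinearMap.ext fun f => ?_
    simp only [Module.End.mul_apply, LinearMap.add_apply, LinearMap.sub_apply,
      Module.algebraMap_end_apply, sOp_mul_yOp (show n + 1 ≠ 1 by omega) (Nat.succ_ne_zero n),
      ← h1, yOp_add (Nat.succ_ne_zero n), ← hh, algebraMap_smul]
    rw [hh, ← hk, algebraMap_smul]
  case s_y_comm i j h₁ h₂ =>
    exact sOp_mul_yOp_comm (fun hd => h₁ (natCast_dvd_val_sub hd))
      (fun hd => h₂ (natCast_dvd_val_sub_sub hd))

/-- The representation of the degenerate DAHA by difference operators with rational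
coefficients on functions on the extended affine symmetric group. -/
def rep {hb k : R} (hh : algebraMap R E hb = h) (hk : algebraMap R E k = h * t) :
    RingQuot (DegRel R (n + 1) hb k) →ₐ[R] Module.End R (affPerm (n + 1) → E) :=
  RingQuot.liftAlgHom R ⟨FreeAlgebra.lift R (genOp R n h t), lift_genOp_rel hh hk⟩

end Representation

end Operators

end affPerm

end

end CycDAHA

namespace CycDAHA

open Equiv

/-! ### The affine group as translations times finite permutations. -/

namespace affPerm

variable {n : ℕ}

theorem ext_fin {g g' : affPerm (n + 1)} (h : ∀ i : Fin (n + 1), g.1 i.val = g'.1 i.val) :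
    g = g' := by
  refine Subtype.ext (Equiv.ext fun a => ?_)
  obtain ⟨p, rfl⟩ := (Int.divModEquiv (n + 1)).symm.surjective a
  have h1 : (Int.divModEquiv (n + 1)).symm p = p.2.val + ((n + 1 : ℕ) : ℤ) * p.1 := by
    simp [Int.divModEquiv, mul_comm, add_comm]
  rw [h1, apply_add_mul, apply_add_mul, h]

theorem divModEquiv_symm_add (p : ℤ × Fin (n + 1)) :
    (Int.divModEquiv (n + 1)).symm p + ((n + 1 : ℕ) : ℤ)
      = (Int.divModEquiv (n + 1)).symm (p.1 + 1, p.2) := by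
  simp only [Int.divModEquiv_symm_apply]
  ring

theorem divModEquiv_symm_zero (i : Fin (n + 1)) :
    (Int.divModEquiv (n + 1)).symm (0, i) = i.val := by
  simp

/-- The element acting on residues by a permutation and preserving quotients. -/
def hat (σ : Perm (Fin (n + 1))) : affPerm (n + 1) :=
  ⟨(Int.divModEquiv (n + 1)).symm.permCongr ((Equiv.refl ℤ).prodCongr σ), fun i => by
    obtain ⟨p, rfl⟩ := (Int.divModEquiv (n + 1)).symm.surjective i
    rw [divModEquiv_symm_add]
    simp only [permCongr_apply, symm_symm, apply_symm_apply]
    exact (divModEquiv_symm_add ((Equiv.refl ℤ).prodCongr σ p)).symm⟩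

/-- The translation adding `(n + 1) d_i` on the residue class of `i`. -/
def trans (d : Fin (n + 1) → ℤ) : affPerm (n + 1) :=
  ⟨(Int.divModEquiv (n + 1)).symm.permCongr
    ((prodComm _ _).permCongr (sigmaEquivProd _ _ |>.permCongr
      (Equiv.sigmaCongrRight fun i => Equiv.addRight (d i)))), fun i => by
    obtain ⟨p, rfl⟩ := (Int.divModEquiv (n + 1)).symm.surjective i
    rw [divModEquiv_symm_add]
    simp only [permCongr_apply, symm_symm, apply_symm_apply]
    rw [divModEquiv_symm_add]
    congr 1
    exact Prod.ext (add_right_comm _ _ _) rfl⟩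

@[simp]
theorem hat_apply (σ : Perm (Fin (n + 1))) (i : Fin (n + 1)) : (hat σ).1 i.val = (σ i).val := by
  rw [← divModEquiv_symm_zero i, hat]
  simp only [permCongr_apply, symm_symm, apply_symm_apply]
  exact divModEquiv_symm_zero _

@[simp]
theorem trans_apply (d : Fin (n + 1) → ℤ) (i : Fin (n + 1)) :
    (trans d).1 i.val = i.val + ((n + 1 : ℕ) : ℤ) * d i := by
  rw [← divModEquiv_symm_zero i, trans]
  simp only [permCongr_apply, symm_symm, apply_symm_apply]
  simp [mul_comm, add_comm]

theorem hat_one : hat (1 : Perm (Fin (n + 1))) = 1 := ext_fin fun i => by simp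

theorem hat_mul (σ τ : Perm (Fin (n + 1))) : hat (σ * τ) = hat σ * hat τ :=
  ext_fin fun i => by simp

theorem trans_zero : trans (0 : Fin (n + 1) → ℤ) = 1 := ext_fin fun i => by simp

theorem trans_add (d d' : Fin (n + 1) → ℤ) : trans (d + d') = trans d * trans d' :=
  ext_fin fun i => by
    rw [mul_apply, trans_apply, trans_apply, apply_add_mul, trans_apply, Pi.add_apply]
    ring

theorem hat_mul_trans (σ : Perm (Fin (n + 1))) (d : Fin (n + 1) → ℤ) :
    hat σ * trans d = trans (d ∘ σ.symm) * hat σ :=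
  ext_fin fun i => by
    rw [mul_apply, mul_apply, trans_apply, apply_add_mul, hat_apply, trans_apply]
    simp

/-- Comparing the images of 0, …, n modulo n + 1 gives the permutations, and then the quotients give
the translations. -/
theorem trans_mul_hat_injective {d d' : Fin (n + 1) → ℤ} {σ σ' : Perm (Fin (n + 1))}
    (h : trans d * hat σ = trans d' * hat σ') : d = d' ∧ σ = σ' := by
  have h1 : ∀ i : Fin (n + 1), ((σ i).val : ℤ) + ((n + 1 : ℕ) : ℤ) * d (σ i)
      = (σ' i).val + ((n + 1 : ℕ) : ℤ) * d' (σ' i) := fun i => by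
    have := congrArg (fun g : affPerm (n + 1) => g.1 i.val) h
    simpa only [mul_apply, hat_apply, trans_apply] using this
  have h2 : σ = σ' := Equiv.ext fun i => by
    refine natCast_dvd_val_sub ⟨d' (σ' i) - d (σ i), ?_⟩
    linear_combination h1 i
  subst h2
  refine ⟨funext fun i => ?_, rfl⟩
  have h3 := h1 (σ.symm i)
  rw [apply_symm_apply] at h3
  have h4 : ((n + 1 : ℕ) : ℤ) ≠ 0 := by exact_mod_cast Nat.succ_ne_zero n
  exact mul_left_cancel₀ h4 (add_left_cancel h3)

theorem hat_swap (i : Fin (n + 1)) (hi : i.val + 1 < n + 1) :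
    hat (swap i (i + 1)) = refl (n + 1) i.val := by
  have hi1 : (i + 1).val = i.val + 1 := Fin.val_add_one_of_lt' hi
  have hn : n + 1 ≠ 1 := by omega
  refine ext_fin fun j => ?_
  rw [hat_apply]
  rcases eq_or_ne j i with rfl | h1
  · rw [swap_apply_left, refl_apply_left hn, hi1, Nat.cast_add_one]
  rcases eq_or_ne j (i + 1) with rfl | h2
  · rw [swap_apply_right, hi1, Nat.cast_add_one, refl_apply_right hn]
  · rw [swap_apply_of_ne_of_ne h1 h2, refl_apply, reflFun_of_not_dvd]
    · exact fun hd => h1 (natCast_dvd_val_sub hd)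
    · exact fun hd => h2 (natCast_dvd_val_sub_sub hd)

/-- The counterpart in the group of π = X₁ s₁⋯s_{N-1}, showing that X₁ specializes to a translation.
-/
theorem shift_eq : shift (n + 1) = trans (Pi.single 0 1) * hat (finRotate (n + 1)) := by
  refine ext_fin fun i => ?_
  rw [mul_apply, hat_apply, trans_apply, shift_apply, finRotate_apply]
  rcases exists_val_add_one i with ⟨h1, h2⟩ | ⟨h1, h2⟩
  · have h3 : i + 1 ≠ 0 := fun h => by
      rw [h] at h1
      simp at h1
      omega
    rw [h1, Pi.single_eq_of_ne h3]
    ring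
  · have h3 : i + 1 = 0 := by
      ext
      simp only [Fin.val_zero]
      omega
    rw [← h1, h3, Pi.single_eq_same]
    ring

end affPerm

end CycDAHA

namespace CycDAHA

open Equiv

noncomputable section

namespace affPerm

/-! ### Weights of monomials at the specialization t = 0. -/

section Weights

variable {R : Type} {E A : Type*} [CommRing R] [CommRing E] [Algebra R E] [CommRing A]
  (ε : E →+* A) {n : ℕ}

/-- An operator on functions on the extended affine symmetric group which becomes, after
specialization along `ε`, a translation multiplied by a function. -/
def IsWeighted (T : Module.End R (affPerm (n + 1) → E)) (c : affPerm (n + 1) → A)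
    (x : affPerm (n + 1)) : Prop :=
  ∀ f g, ε (T f g) = c g * ε (f (g * x))

variable {ε} {T T' : Module.End R (affPerm (n + 1) → E)} {c c' : affPerm (n + 1) → A}
  {x x' : affPerm (n + 1)}

theorem IsWeighted.one : IsWeighted ε (1 : Module.End R (affPerm (n + 1) → E)) 1 1 :=
  fun f g => by simp

theorem IsWeighted.mul (h : IsWeighted ε T c x) (h' : IsWeighted ε T' c' x') :
    IsWeighted ε (T * T') (fun g => c g * c' (g * x)) (x * x') := fun f g => by
  rw [Module.End.mul_apply, h, h', mul_assoc, mul_assoc]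

theorem IsWeighted.trans_mul_trans (h : IsWeighted ε T 1 x) (h' : IsWeighted ε T' 1 x') :
    IsWeighted ε (T * T') 1 (x * x') := by
  have := h.mul h'
  simp only [Pi.one_apply, mul_one] at this
  exact this

theorem IsWeighted.inv (h : IsWeighted ε T 1 x) (hT : T * T' = 1) :
    IsWeighted ε T' 1 x⁻¹ := fun f g => by
  have := h (T' f) (g * x⁻¹)
  rw [← Module.End.mul_apply, hT, inv_mul_cancel_right] at this
  simpa using this.symm

theorem isWeighted_transOp (x : affPerm (n + 1)) : IsWeighted ε (transOp R E x) 1 x :=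
  fun f g => by simp [transOp_apply]

variable [Algebra ℚ A] {η : A}

theorem lam_mul_trans (g : affPerm (n + 1)) (d : Fin (n + 1) → ℤ) (i : Fin (n + 1)) :
    lam (n + 1) η ((g * trans d).1 i.val) = lam (n + 1) η (g.1 i.val) - η * d i := by
  rw [mul_apply, trans_apply, apply_add_mul, lam_add_mul (Nat.succ_ne_zero n), map_intCast]

theorem lam_mul_hat (g : affPerm (n + 1)) (σ : Perm (Fin (n + 1))) (i : Fin (n + 1)) :
    lam (n + 1) η ((g * hat σ).1 i.val) = lam (n + 1) η (g.1 (σ i).val) := by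
  rw [mul_apply, hat_apply]

/-- Each application translates by δ and so shifts the i-th value by -ηδ; the r-th factor is
evaluated after r such shifts. -/
theorem IsWeighted.pow {q : A → A} {i : Fin (n + 1)} {δ : ℤ}
    (hT : IsWeighted ε T (fun g => q (lam (n + 1) η (g.1 i.val))) (trans (Pi.single i δ)))
    (m : ℕ) : IsWeighted ε (T ^ m)
      (fun g => ∏ r ∈ Finset.range m, q (lam (n + 1) η (g.1 i.val) - η * (r * δ)))
      (trans (Pi.single i (m * δ))) := by
  induction m with
  | zero =>
    simp only [pow_zero, Finset.range_zero, Finset.prod_empty, Nat.cast_zero, zero_mul,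
      Pi.single_zero, trans_zero]
    exact IsWeighted.one
  | succ m ih =>
    have := ih.mul hT
    rw [pow_succ]
    convert this using 1
    · funext g
      rw [Finset.prod_range_succ, lam_mul_trans, Pi.single_eq_same]
      push_cast
      rfl
    · rw [← trans_add, ← Pi.single_add]
      push_cast
      rw [add_mul, one_mul]

/-- Translation in the coordinate i leaves the values at j ≠ i unchanged, so for distinct indices
the weights simply multiply. -/
theorem IsWeighted.list_prod {u : Fin (n + 1) → Module.End R (affPerm (n + 1) → E)}
    {F : Fin (n + 1) → A → A} {d : Fin (n + 1) → ℤ}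
    (hu : ∀ i, IsWeighted ε (u i) (fun g => F i (lam (n + 1) η (g.1 i.val)))
      (trans (Pi.single i (d i)))) (L : List (Fin (n + 1))) (hL : L.Nodup) :
    IsWeighted ε (L.map u).prod
      (fun g => (L.map fun i => F i (lam (n + 1) η (g.1 i.val))).prod)
      (trans fun i => if i ∈ L then d i else 0) := by
  induction L with
  | nil =>
    simp only [List.map_nil, List.prod_nil, List.not_mem_nil, if_false]
    exact trans_zero (n := n) ▸ IsWeighted.one
  | cons i L ih =>
    rw [List.nodup_cons] at hL
    have := (hu i).mul (ih hL.2)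
    rw [List.map_cons, List.prod_cons]
    convert this using 1
    · funext g
      rw [List.map_cons, List.prod_cons]
      congr 2
      refine List.map_congr_left fun j hj => ?_
      have hji : j ≠ i := fun hh => hL.1 (hh ▸ hj)
      rw [lam_mul_trans, Pi.single_eq_of_ne hji, Int.cast_zero, mul_zero, sub_zero]
    · rw [← trans_add]
      congr 1
      funext j
      rw [Pi.add_apply]
      rcases eq_or_ne j i with rfl | hji
      · simp [hL.1]
      · simp [hji]

theorem IsWeighted.monom {u : Fin (n + 1) → Module.End R (affPerm (n + 1) → E)}
    {q : A → A} {δ : ℤ}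
    (hu : ∀ i, IsWeighted ε (u i) (fun g => q (lam (n + 1) η (g.1 i.val)))
      (trans (Pi.single i δ))) (a : Fin (n + 1) → ℕ) :
    IsWeighted ε (monom u a)
      (fun g => ∏ i, ∏ r ∈ Finset.range (a i),
        q (lam (n + 1) η (g.1 i.val) - η * (r * δ)))
      (trans fun i => a i * δ) := by
  have := IsWeighted.list_prod (u := fun i => u i ^ a i)
    (F := fun i v => ∏ r ∈ Finset.range (a i), q (v - η * (r * δ)))
    (fun i => (hu i).pow (a i)) (List.finRange (n + 1)) (List.nodup_finRange _)
  rw [CycDAHA.monom, List.ofFn_eq_map]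
  convert this using 1
  · funext g
    rw [Fin.prod_univ_def]
  · simp

variable [Algebra ℚ E] {h t : E}

theorem map_lam (m : ℤ) : ε (lam (n + 1) h m) = lam (n + 1) (ε h) m := by
  simp only [lam, map_neg, map_mul]
  congr 2
  exact DFunLike.congr_fun (Subsingleton.elim (ε.comp (algebraMap ℚ E)) (algebraMap ℚ A)) _

theorem isWeighted_yOp (i : ℤ) :
    IsWeighted ε (yOp (N := n + 1) R h i) (fun g => lam (n + 1) (ε h) (g.1 i)) 1 := fun f g => by
  rw [yOp_apply, map_mul, map_lam, mul_one]

theorem isWeighted_sOp (ht : ε t = 0) (j : ℤ) :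
    IsWeighted ε (sOp (N := n + 1) R t j) 1 (refl (n + 1) j) := fun f g => by
  simp [sOp_apply, beta, ht]

end Weights

section Weights

variable {R : Type} {E A : Type*} [CommRing R] [CommRing E] [Algebra R E] [CommRing A]
  [Algebra ℚ E] [Algebra ℚ A] {ε : E →+* A} {n : ℕ} {h t : E} {hb k : R}
  (hh : algebraMap R E hb = h) (hk : algebraMap R E k = h * t)
  {w : Perm (Fin (n + 1)) →* DegDAHA R (n + 1) hb k}

theorem rep_gen (g : DegGen (n + 1)) : rep hh hk (DegDAHA.gen R hb k g) = genOp R n h t g := by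
  rw [rep, DegDAHA.gen, RingQuot.liftAlgHom_mkAlgHom_apply, FreeAlgebra.lift_ι_apply]

theorem isWeighted_y (i : Fin (n + 1)) :
    IsWeighted ε (rep hh hk (DegDAHA.y R hb k i)) (fun g => lam (n + 1) (ε h) (g.1 i.val)) 1 := by
  rw [DegDAHA.y, rep_gen]
  exact isWeighted_yOp _

theorem isWeighted_permHom (ht : ε t = 0) (hw : DegDAHA.ExtendsS w) (σ : Perm (Fin (n + 1))) :
    IsWeighted ε (rep hh hk (w σ)) 1 (hat σ) := by
  induction σ using perm_induction with
  | one =>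
    rw [map_one, map_one, hat_one]
    exact IsWeighted.one
  | mul σ τ hσ hτ =>
    rw [map_mul, map_mul, hat_mul]
    exact hσ.trans_mul_trans hτ
  | adj i hi =>
    rw [hw i hi, hat_swap i hi]
    change IsWeighted ε (rep hh hk (DegDAHA.gen R hb k (.s i))) _ _
    rw [rep_gen]
    exact isWeighted_sOp ht _

theorem isWeighted_X_zero (ht : ε t = 0) (hw : DegDAHA.ExtendsS w) :
    IsWeighted ε (rep hh hk (DegDAHA.X w 0)) 1 (trans (Pi.single 0 1)) := by
  have h1 : DegDAHA.X w 0 = DegDAHA.pi R (n + 1) hb k * w (finRotate (n + 1))⁻¹ := by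
    rw [DegDAHA.X_zero, ← hw.X₁_mul, mul_assoc, permHom_mul_inv, mul_one]
  have h2 : IsWeighted ε (rep hh hk (DegDAHA.pi R (n + 1) hb k)) 1 (shift (n + 1)) := by
    change IsWeighted ε (rep hh hk (DegDAHA.gen R hb k .pi)) _ _
    rw [rep_gen]
    exact isWeighted_transOp _
  have h3 := h2.trans_mul_trans (isWeighted_permHom hh hk ht hw (finRotate (n + 1))⁻¹)
  rw [shift_eq, mul_assoc, ← hat_mul, mul_inv_cancel, hat_one, mul_one] at h3
  rwa [h1, map_mul]

theorem isWeighted_conj_swap (ht : ε t = 0) (hw : DegDAHA.ExtendsS w)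
    {a : DegDAHA R (n + 1) hb k} {q : A → A} {δ : ℤ}
    (ha : IsWeighted ε (rep hh hk a) (fun g => q (lam (n + 1) (ε h) (g.1 (0 : Fin (n + 1)).val)))
      (trans (Pi.single 0 δ))) (i : Fin (n + 1)) :
    IsWeighted ε (rep hh hk (w (swap 0 i) * a * w (swap 0 i)))
      (fun g => q (lam (n + 1) (ε h) (g.1 i.val))) (trans (Pi.single i δ)) := by
  have hσ := isWeighted_permHom hh hk ht hw (swap 0 i)
  have := (hσ.mul ha).mul hσ
  rw [map_mul, map_mul]
  convert this using 1
  · funext g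
    rw [lam_mul_hat, swap_apply_left]
    simp
  · rw [hat_mul_trans, mul_assoc, ← hat_mul, swap_mul_self, hat_one, mul_one]
    congr 1
    funext j
    simp only [symm_swap, Function.comp_apply, Pi.single_apply]
    congr 1
    rw [eq_iff_iff, swap_apply_eq_iff, swap_apply_left]

theorem isWeighted_X (ht : ε t = 0) (hw : DegDAHA.ExtendsS w) (i : Fin (n + 1)) :
    IsWeighted ε (rep hh hk (DegDAHA.X w i)) 1 (trans (Pi.single i 1)) := by
  have h0 := isWeighted_X_zero hh hk ht hw
  rw [DegDAHA.X_zero] at h0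
  exact isWeighted_conj_swap hh hk ht hw (q := 1) h0 i

variable (ε) in
/-- The polynomial with the given specialized roots. -/
def rootPoly (L : List R) : Polynomial A :=
  (L.map fun z => Polynomial.X - Polynomial.C (ε (algebraMap R E z))).prod

theorem isWeighted_prodSub (L : List R) (i : Fin (n + 1)) :
    IsWeighted ε (rep hh hk (prodSub L (DegDAHA.y R hb k i)))
      (fun g => (rootPoly ε L).eval (lam (n + 1) (ε h) (g.1 i.val))) 1 := by
  induction L with
  | nil =>
    rw [prodSub_nil, map_one]
    simp only [rootPoly, List.map_nil, List.prod_nil, Polynomial.eval_one]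
    exact IsWeighted.one
  | cons z L ih =>
    have h1 : IsWeighted ε (rep hh hk (DegDAHA.y R hb k i - algebraMap R _ z))
        (fun g => lam (n + 1) (ε h) (g.1 i.val) - ε (algebraMap R E z)) 1 := fun f g => by
      rw [map_sub, AlgHom.commutes, LinearMap.sub_apply, Pi.sub_apply, map_sub,
        isWeighted_y hh hk, Module.algebraMap_end_apply, Pi.smul_apply, Algebra.smul_def, map_mul]
      simp only [mul_one]
      ring
    rw [prodSub_cons, map_mul]
    convert h1.mul ih using 1
    · funext g
      simp [rootPoly]
    · rw [mul_one]

/-- D₁ first applies P(y₁) and then X₁⁻¹; the translation by -1 is what shifts the argument of P by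
ħ. -/
theorem isWeighted_D (ht : ε t = 0) (hw : DegDAHA.ExtendsS w) {l : ℕ} (z : Fin l → R)
    (i : Fin (n + 1)) :
    IsWeighted ε (rep hh hk (DegDAHA.D z w i))
      (fun g => (rootPoly ε (List.ofFn z)).eval (lam (n + 1) (ε h) (g.1 i.val) + ε h))
      (trans (Pi.single i (-1))) := by
  refine isWeighted_conj_swap hh hk ht hw
    (q := fun v => (rootPoly ε (List.ofFn z)).eval (v + ε h)) ?_ i
  have h1 := isWeighted_X_zero hh hk ht hw
  rw [DegDAHA.X_zero] at h1
  have h2 := h1.inv (T' := rep hh hk (((DegDAHA.X₁ R (n + 1) hb k)⁻¹ : (DegDAHA R (n + 1) hb k)ˣ)))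
    (by rw [← map_mul, Units.mul_inv, map_one])
  have h3 : (trans (Pi.single 0 1) : affPerm (n + 1))⁻¹ = trans (Pi.single 0 (-1)) := by
    rw [inv_eq_iff_mul_eq_one, ← trans_add, ← Pi.single_add, add_neg_cancel, Pi.single_zero,
      trans_zero]
  rw [h3] at h2
  have := h2.mul (isWeighted_prodSub hh hk (List.ofFn z) 0)
  rw [← map_mul, mul_one, ← DegDAHA.D₁] at this
  convert this using 1
  funext g
  rw [lam_mul_trans]
  simp

/-- The weight separates into polynomials in the single values at i. Since M_D stands to the right
of σ, its exponent at the value i is the one of index σ⁻¹ i. -/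
theorem isWeighted_monomials (ht : ε t = 0) (hw : DegDAHA.ExtendsS w) {l : ℕ} (z : Fin l → R)
    (a b c : Fin (n + 1) → ℕ) (σ : Perm (Fin (n + 1))) :
    IsWeighted ε (rep hh hk (monom (DegDAHA.X w) a * monom (DegDAHA.y R hb k) b * w σ
        * monom (DegDAHA.D z w) c))
      (fun g => ∏ i, ((lam (n + 1) (ε h) (g.1 i.val) - ε h * a i) ^ b i
        * ∏ r ∈ Finset.range (c (σ.symm i)), (rootPoly ε (List.ofFn z)).eval
          (lam (n + 1) (ε h) (g.1 i.val) - ε h * a i + ε h * r + ε h)))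
      (trans (fun i => (a i : ℤ) - c (σ.symm i)) * hat σ) := by
  have hX := IsWeighted.monom (η := ε h) (q := 1) (isWeighted_X hh hk ht hw) a
  have hy := IsWeighted.monom (ε := ε) (η := ε h) (q := id) (δ := 0)
    (u := fun i => rep hh hk (DegDAHA.y R hb k i)) (fun i => by
      rw [Pi.single_zero, trans_zero]
      exact isWeighted_y hh hk i) b
  have hD := IsWeighted.monom (η := ε h)
    (q := fun v => (rootPoly ε (List.ofFn z)).eval (v + ε h)) (isWeighted_D hh hk ht hw z) c
  have := ((hX.mul hy).mul (isWeighted_permHom hh hk ht hw σ)).mul hD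
  simp only [← monom_map, ← map_mul] at this
  convert this using 1
  · funext g
    simp only [← mul_assoc, lam_mul_hat, lam_mul_trans]
    rw [Finset.prod_mul_distrib, ← Equiv.prod_comp σ fun i => ∏ r ∈ Finset.range (c (σ.symm i)), _]
    simp [sub_eq_add_neg]
  · have h0 : (trans fun _ : Fin (n + 1) => (0 : ℤ)) = 1 := trans_zero
    simp only [mul_zero, mul_one, h0, mul_assoc, hat_mul_trans]
    rw [← mul_assoc, ← trans_add]
    congr 2
    funext i
    simp [sub_eq_add_neg]

end Weights

end affPerm

end

end CycDAHA

namespace CycDAHA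

open Equiv

/-! ### Independence of products of one-variable polynomials on infinite grids. -/

section PolynomialIndependence

open Polynomial

variable {A : Type*} [CommRing A] [IsDomain A]

/-- Induction on the number of variables. With the other variables fixed, the sum is a polynomial in
the first one with infinitely many roots, hence zero. Polynomials of distinct degrees being
independent, the terms with a prescribed first exponent already sum to zero. -/
theorem eq_zero_of_sum_mul_prod_eval_eq_zero {ι : Type*} {N : ℕ} {Q : Fin N → ℕ → A[X]}
    (hQ : ∀ i m, (Q i m).degree = m) {S : Fin N → Set A} (hS : ∀ i, (S i).Infinite)
    {s : Finset ι} {e : ι → Fin N → ℕ} (he : Set.InjOn e s) {a : ι → A}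
    (h : ∀ v : Fin N → A, (∀ i, v i ∈ S i) → ∑ p ∈ s, a p * ∏ i, (Q i (e p i)).eval (v i) = 0) :
    ∀ p ∈ s, a p = 0 := by
  induction N generalizing ι s a with
  | zero =>
    intro p hp
    have hs : s = {p} := by
      refine Finset.eq_singleton_iff_unique_mem.2 ⟨hp, fun q hq => he hq hp (Subsingleton.elim _ _)⟩
    simpa [hs] using h Fin.elim0 fun i => i.elim0
  | succ N ih =>
    intro p hp
    refine ih (Q := fun i => Q i.succ) (fun i m => hQ _ m) (S := fun i => S i.succ)
      (fun i => hS _) (s := s.filter fun q => e q 0 = e p 0) (e := fun q i => e q i.succ) ?_ ?_ p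
      (by simp [hp])
    · intro q hq q' hq' hqq
      simp only [Finset.coe_filter, Set.mem_ofPred_eq] at hq hq'
      refine he hq.1 hq'.1 (funext fun i => ?_)
      refine Fin.cases ?_ (fun i => ?_) i
      · rw [hq.2, hq'.2]
      · exact congrFun hqq i
    · intro v hv
      have hF : ∑ q ∈ s, C (a q * ∏ i, (Q i.succ (e q i.succ)).eval (v i)) * Q 0 (e q 0) = 0 := by
        refine eq_zero_of_infinite_isRoot _ ((hS 0).mono fun x hx => ?_)
        have := h (Fin.cons x v) fun i => Fin.cases hx hv i
        simp only [Fin.prod_univ_succ, Fin.cons_zero, Fin.cons_succ] at this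
        simp only [Set.mem_ofPred_eq, IsRoot.def, eval_finsetSum, eval_mul, eval_C]
        rw [← this]
        exact Finset.sum_congr rfl fun q _ => by ring
      rw [← Finset.sum_fiberwise_of_maps_to (g := fun q => e q 0) (t := s.image fun q => e q 0)
        fun q hq => Finset.mem_image_of_mem _ hq] at hF
      have hli : LinearIndependent A (Q 0) :=
        Polynomial.Sequence.linearIndependent ⟨Q 0, hQ 0⟩
      have := linearIndependent_iff'.1 hli (s.image fun q => e q 0)
        (fun m => ∑ q ∈ s with e q 0 = m, a q * ∏ i, (Q i.succ (e q i.succ)).eval (v i)) ?_ (e p 0)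
        (Finset.mem_image_of_mem _ hp)
      · exact this
      · rw [← hF]
        refine Finset.sum_congr rfl fun m _ => ?_
        rw [Finset.sum_smul]
        refine Finset.sum_congr rfl fun q hq => ?_
        rw [(Finset.mem_filter.1 hq).2, smul_eq_C_mul]

end PolynomialIndependence

noncomputable section

/-! ### Vanishing at t = 0 of the coefficients of a linear relation. -/

namespace affPerm

open Polynomial

variable {R : Type} {E A : Type*} [CommRing R] [CommRing E] [Algebra R E] [CommRing A]

section

variable {ε : E →+* A}

theorem rootPoly_monic (L : List R) : (rootPoly ε L).Monic := by
  induction L with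
  | nil => simp [rootPoly]
  | cons z L ih =>
    rw [rootPoly, List.map_cons, List.prod_cons]
    exact (monic_X_sub_C _).mul ih

theorem natDegree_rootPoly [Nontrivial A] (L : List R) :
    (rootPoly ε L).natDegree = L.length := by
  induction L with
  | nil => simp [rootPoly]
  | cons z L ih =>
    have h1 : rootPoly ε (z :: L) = (X - C (ε (algebraMap R E z))) * rootPoly ε L := by
      rw [rootPoly, List.map_cons, List.prod_cons, ← rootPoly]
    rw [h1, (monic_X_sub_C _).natDegree_mul (rootPoly_monic L), natDegree_X_sub_C, ih,
      List.length_cons, add_comm]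

end

/-- The weight polynomials of the monomials. -/
def weightPoly (η : A) (P : A[X]) (l : ℕ) (d : ℤ) (m : ℕ) : A[X] :=
  (X - C (η * (d + (m / l : ℕ)))) ^ (m % l)
    * ∏ r ∈ Finset.range (m / l), P.comp (X + C (-(η * (d + (m / l : ℕ))) + η * r + η))

/-- The degree is m % l + l (m / l) = m. So encoding the exponents of y and D as remainder and
quotient of one integer makes distinct exponents give distinct degrees. -/
theorem degree_weightPoly [IsDomain A] (η : A) {P : A[X]} (hP : P.Monic) (d : ℤ) (m : ℕ) :
    (weightPoly η P P.natDegree d m).degree = m := by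
  have h1 : ∀ c : A, (P.comp (X + C c)).Monic := fun c => hP.comp_X_add_C c
  have h2 : ∀ c : A, (P.comp (X + C c)).natDegree = P.natDegree := fun c => by
    rw [natDegree_comp, natDegree_X_add_C, mul_one]
  have h3 := (monic_X_sub_C (η * (d + (m / P.natDegree : ℕ)))).pow (m % P.natDegree)
  have h4 := monic_prod_of_monic (Finset.range (m / P.natDegree))
    (fun r : ℕ => P.comp (X + C (-(η * (d + (m / P.natDegree : ℕ))) + η * r + η)))
    fun r _ => h1 _
  rw [weightPoly, degree_eq_natDegree (h3.mul h4).ne_zero, h3.natDegree_mul h4,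
    (monic_X_sub_C _).natDegree_pow, natDegree_X_sub_C, natDegree_prod_of_monic _ _ fun r _ => h1 _]
  simp only [h2, Finset.sum_const, Finset.card_range, smul_eq_mul, mul_one]
  rw [mul_comm, Nat.mod_add_div]

variable [Algebra ℚ E] [Algebra ℚ A] {ε : E →+* A} {n : ℕ} {h t : E} {hb k : R}
  (hh : algebraMap R E hb = h) (hk : algebraMap R E k = h * t)
  {w : Perm (Fin (n + 1)) →* DegDAHA R (n + 1) hb k}

/-- The monomials `M_X M_y s M_D`, with the exponents of `M_y` and `M_D` recorded as the
remainders and quotients by `l` of a tuple of integers. -/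
def divModMonom {l : ℕ} (z : Fin l → R) (w : Perm (Fin (n + 1)) →* DegDAHA R (n + 1) hb k)
    (p : (Fin (n + 1) → ℕ) × (Fin (n + 1) → ℕ) × Perm (Fin (n + 1))) :
    DegDAHA R (n + 1) hb k :=
  monom (DegDAHA.X w) p.1 * monom (DegDAHA.y R hb k) (fun i => p.2.1 i % l) * w p.2.2
    * monom (DegDAHA.D z w) (fun i => p.2.1 (p.2.2 i) / l)

variable [IsDomain A]

theorem lam_fiber_infinite {η : A} (hη : η ≠ 0) (i : ℤ) :
    (Set.range fun m : ℤ => lam (n + 1) η (i + ((n + 1 : ℕ) : ℤ) * m)).Infinite := by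
  have : CharZero A := algebraRat.charZero A
  refine Set.infinite_range_of_injective fun m m' hm => ?_
  simp only [lam_add_mul (Nat.succ_ne_zero n), map_intCast, sub_right_inj] at hm
  exact_mod_cast mul_left_cancel₀ hη hm

/-- Isolate the monomials with one given translation part. Among them the exponents of X are
determined by `e`, so the weight polynomials have distinct degree tuples. Evaluation at all
translations gives infinitely many values in each variable. -/
theorem map_coeff_eq_zero_of_sum_eq_zero (ht : ε t = 0) (hε : ε h ≠ 0) (hw : DegDAHA.ExtendsS w)
    {l : ℕ} (z : Fin l → R)
    (s : Finset ((Fin (n + 1) → ℕ) × (Fin (n + 1) → ℕ) × Perm (Fin (n + 1))))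
    (u : (Fin (n + 1) → ℕ) × (Fin (n + 1) → ℕ) × Perm (Fin (n + 1)) → E)
    (hu : ∀ f g, ∑ p ∈ s, u p * rep hh hk (divModMonom z w p) f g = 0) :
    ∀ p ∈ s, ε (u p) = 0 := by
  classical
  rintro ⟨a₀, e₀, σ₀⟩ hp₀
  set P := rootPoly (R := R) ε (List.ofFn z) with hP
  have hPl : P.natDegree = l := by rw [hP, natDegree_rootPoly, List.length_ofFn]
  let d : Fin (n + 1) → ℤ := fun i => (a₀ i : ℤ) - (e₀ i / l : ℕ)
  let x : (Fin (n + 1) → ℕ) × (Fin (n + 1) → ℕ) × Perm (Fin (n + 1)) → affPerm (n + 1) :=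
    fun p => trans (fun i => (p.1 i : ℤ) - (p.2.1 i / l : ℕ)) * hat p.2.2
  have hx : ∀ p, x p = trans d * hat σ₀ →
      (∀ i, (p.1 i : ℤ) = d i + (p.2.1 i / l : ℕ)) ∧ p.2.2 = σ₀ := fun p hp => by
    obtain ⟨h1, h2⟩ := trans_mul_hat_injective hp
    exact ⟨fun i => by rw [← congrFun h1 i]; ring, h2⟩
  refine eq_zero_of_sum_mul_prod_eval_eq_zero (Q := fun i => weightPoly (ε h) P l (d i))
    (fun i m => by rw [← hPl]; exact degree_weightPoly _ (rootPoly_monic _) _ _)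
    (fun i => lam_fiber_infinite (n := n) hε i.val) (s := s.filter fun p => x p = trans d * hat σ₀)
    (e := fun p => p.2.1)
    (a := fun p => ε (u p)) ?_ ?_ ⟨a₀, e₀, σ₀⟩ (by simp [hp₀, x, d])
  · rintro ⟨a, e, σ⟩ hp ⟨a', e', σ'⟩ hp' hee
    simp only [Finset.coe_filter, Set.mem_ofPred_eq] at hp hp' hee
    obtain ⟨h1, h2⟩ := hx _ hp.2
    obtain ⟨h1', h2'⟩ := hx _ hp'.2
    simp only at h1 h2 h1' h2'
    subst hee h2 h2'
    have : a = a' := funext fun i => by exact_mod_cast (h1 i).trans (h1' i).symm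
    rw [this]
  · intro v hv
    choose m hm using hv
    -- The test function is a delta function placed so that, evaluated at `trans m`, it sees exactly
    -- the monomials translating by `trans d * hat σ₀`.
    have h1 := congrArg ε (hu (Pi.single (trans m * (trans d * hat σ₀)) 1) (trans m))
    rw [map_sum, map_zero] at h1
    rw [Finset.sum_filter]
    refine (Finset.sum_congr rfl fun p _ => ?_).trans h1
    rw [map_mul, divModMonom, isWeighted_monomials hh hk ht hw]
    simp only [apply_symm_apply]
    split_ifs with hp
    · have hp' := hp
      simp only [x] at hp'
      obtain ⟨h2, h3⟩ := hx p hp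
      rw [hp', Pi.single_eq_same, map_one, mul_one]
      congr 1
      refine Finset.prod_congr rfl fun i _ => ?_
      have h4 : (p.1 i : A) = d i + (p.2.1 i / l : ℕ) := by
        have := congrArg (Int.cast : ℤ → A) (h2 i)
        rwa [Int.cast_natCast, Int.cast_add, Int.cast_natCast] at this
      rw [trans_apply, ← hm i, h4, weightPoly, eval_mul, eval_pow, eval_prod]
      simp only [eval_sub, eval_X, eval_C, eval_comp, eval_add]
      congr 1
      refine Finset.prod_congr rfl fun r _ => ?_
      congr 1
      ring
    · have h2 : trans m * x p ≠ trans m * (trans d * hat σ₀) := fun h => hp (mul_left_cancel h)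
      simp only [x] at h2
      rw [Pi.single_eq_of_ne h2, map_zero, mul_zero, mul_zero]

end affPerm

end

end CycDAHA

namespace CycDAHA

open Equiv

noncomputable section

/-! ### From t = 0 to indeterminate parameters. -/

namespace affPerm

open Polynomial

section

variable {R : Type} {A : Type*} [CommRing R] [CommRing A] [Algebra R A[X]] [IsDomain A]
  [Algebra ℚ A] {n : ℕ} {a : A} {hb k : R}
  {w : Perm (Fin (n + 1)) →* DegDAHA R (n + 1) hb k}

/-- Induction on the order in t: all constant coefficients vanish, so the whole relation is
divisible by t, and since the values lie in a domain the quotient is again a relation. -/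
theorem coeff_eq_zero_of_sum_eq_zero (hh : algebraMap R A[X] hb = C a)
    (hk : algebraMap R A[X] k = C a * X) (ha : a ≠ 0) (hw : DegDAHA.ExtendsS w)
    {l : ℕ} (z : Fin l → R)
    (s : Finset ((Fin (n + 1) → ℕ) × (Fin (n + 1) → ℕ) × Perm (Fin (n + 1))))
    (m : ℕ) (u : (Fin (n + 1) → ℕ) × (Fin (n + 1) → ℕ) × Perm (Fin (n + 1)) → A[X])
    (hu : ∀ f g, ∑ p ∈ s, u p * rep hh hk (divModMonom z w p) f g = 0) :
    ∀ p ∈ s, (u p).coeff m = 0 := by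
  induction m generalizing u with
  | zero =>
    exact map_coeff_eq_zero_of_sum_eq_zero (ε := constantCoeff) hh hk (by simp) (by simpa) hw z s
      u hu
  | succ m ih =>
    have h0 := map_coeff_eq_zero_of_sum_eq_zero (ε := constantCoeff) hh hk (by simp) (by simpa)
      hw z s u hu
    have h1 : ∀ p ∈ s, u p = X * (u p).divX := fun p hp => by
      have h2 : (u p).coeff 0 = 0 := h0 p hp
      conv_lhs => rw [← X_mul_divX_add (u p), h2, C_0, add_zero]
    intro p hp
    rw [← coeff_divX]
    refine ih (fun p => (u p).divX) (fun f g => ?_) p hp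
    refine (mul_eq_zero.1 ((hu f g).symm.trans ?_).symm).resolve_left X_ne_zero
    rw [Finset.mul_sum]
    refine Finset.sum_congr rfl fun p hp => ?_
    rw [← mul_assoc, ← h1 p hp]

theorem linearIndependent_divModMonom (hinj : Function.Injective (algebraMap R A[X]))
    (hh : algebraMap R A[X] hb = C a)
    (hk : algebraMap R A[X] k = C a * X) (ha : a ≠ 0) (hw : DegDAHA.ExtendsS w)
    {l : ℕ} (z : Fin l → R) : LinearIndependent R (divModMonom z w) := by
  rw [linearIndependent_iff']
  intro s r hr p hp
  refine hinj (Polynomial.ext fun m => ?_)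
  rw [map_zero, coeff_zero]
  refine coeff_eq_zero_of_sum_eq_zero hh hk ha hw z s m (fun p => algebraMap R A[X] (r p))
    (fun f g => ?_) p hp
  have := congrFun (LinearMap.congr_fun (congrArg (rep hh hk) hr) f) g
  rw [map_zero, map_sum, LinearMap.sum_apply, Finset.sum_apply] at this
  rw [LinearMap.zero_apply, Pi.zero_apply] at this
  rw [← this]
  refine Finset.sum_congr rfl fun p _ => ?_
  rw [map_smul, LinearMap.smul_apply, Pi.smul_apply, Algebra.smul_def]

end

/-- The values of the parameters in the ring over which the representation is defined. -/
def paramValue (l : ℕ) : Param l → (MvPolynomial (Option (Fin l)) ℂ)[X]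
  | .hb => C (MvPolynomial.X none)
  | .k => C (MvPolynomial.X none) * X
  | .z i => C (MvPolynomial.X (some i))

/-- Every point with ħ ≠ 0 lifts along k = ħt by taking t = k/ħ. So an element of the kernel
vanishes wherever ħ ≠ 0, and multiplying it by ħ makes it vanish everywhere. -/
theorem aeval_paramValue_injective (l : ℕ) :
    Function.Injective (MvPolynomial.aeval (R := ℂ) (paramValue l)) := by
  rw [injective_iff_map_eq_zero]
  intro p hp
  have h1 : hbVar l * p = 0 := by
    refine MvPolynomial.funext fun v => ?_
    rw [map_mul, map_zero, hbVar, MvPolynomial.eval_X]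
    by_cases hv : v .hb = 0
    · rw [hv, zero_mul]
    let φ : MvPolynomial (Option (Fin l)) ℂ →ₐ[ℂ] ℂ :=
      MvPolynomial.aeval fun j => j.elim (v .hb) fun i => v (.z i)
    let ψ : (MvPolynomial (Option (Fin l)) ℂ)[X] →+* ℂ := eval₂RingHom φ.toRingHom (v .k / v .hb)
    have h2 : (ψ.comp (MvPolynomial.aeval (R := ℂ) (paramValue l)).toRingHom) = MvPolynomial.eval v := by
      refine MvPolynomial.ringHom_ext (fun c => ?_) fun i => ?_
      · simp [ψ, φ, Polynomial.algebraMap_apply]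
      · rcases i with _ | _ | i
        · simp [ψ, φ, paramValue]
        · simp [ψ, φ, paramValue]
          field_simp
        · simp [ψ, φ, paramValue]
    rw [← h2]
    simp [hp]
  exact (mul_eq_zero.1 h1).resolve_left (MvPolynomial.X_ne_zero _)

end affPerm

theorem linearIndependent_monomials {n l : ℕ} {w : Perm (Fin (n + 1)) →* HH (n + 1) l}
    (hw : DegDAHA.ExtendsS w) :
    LinearIndependent (PRing l) (affPerm.divModMonom (zVar l) w) := by
  let _ : Algebra (PRing l) (Polynomial (MvPolynomial (Option (Fin l)) ℂ)) :=
    (MvPolynomial.aeval (R := ℂ) (affPerm.paramValue l)).toRingHom.toAlgebra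
  have halg : ∀ i : Param l, algebraMap (PRing l) (Polynomial (MvPolynomial (Option (Fin l)) ℂ))
      (MvPolynomial.X i) = affPerm.paramValue l i := fun i => MvPolynomial.aeval_X _ i
  exact affPerm.linearIndependent_divModMonom (affPerm.aeval_paramValue_injective l)
    (halg .hb) (halg .k) (MvPolynomial.X_ne_zero _) hw _

end

end CycDAHA

namespace CycDAHA

open Equiv

/-! ### Spanning families with independent images. -/

section LinearIndependent

variable {R M M' ι : Type*} [CommRing R] [AddCommGroup M] [AddCommGroup M'] [Module R M]
  [Module R M']

theorem eq_zero_of_mem_span_of_linearIndependent {f : M →ₗ[R] M'} {v : ι → M}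
    {u : ι → M'} (hu : LinearIndependent R u) (huv : ∀ i, f (v i) = u i) {x : M}
    (hx : x ∈ Submodule.span R (Set.range v)) (h : f x = 0) : x = 0 := by
  rw [← Finsupp.range_linearCombination] at hx
  obtain ⟨c, rfl⟩ := hx
  have h1 : Finsupp.linearCombination R u c = 0 := by
    rw [← h, Finsupp.apply_linearCombination]
    exact congrArg (fun u => Finsupp.linearCombination R u c) (funext fun i => (huv i).symm)
  rw [linearIndependent_iff.1 hu c h1, map_zero]

theorem linearIndependent_of_map_eq {f : M →ₗ[R] M'} {v : ι → M} {u : ι → M'}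
    (hu : LinearIndependent R u) (huv : ∀ i, f (v i) = u i) : LinearIndependent R v :=
  LinearIndependent.of_comp f (by rwa [show f ∘ v = u from funext huv])

end LinearIndependent

/-! ### The case l = 0. -/

namespace IsCyclotomic

variable {R A : Type*} [CommRing R] [Ring A] [Algebra R A] {n : ℕ} {hb k : R} {z : Fin 0 → R}
  {w : Perm (Fin (n + 1)) →* A} {y X D : Fin (n + 1) → A}

theorem X_mul_D_eq_one (h : IsCyclotomic hb k z w y X D) (i : Fin (n + 1)) : X i * D i = 1 := by
  rw [h.X_mul_D, List.ofFn_zero, prodSub_nil]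

theorem commute_D_X (h : IsCyclotomic hb k z w y X D) (i j : Fin (n + 1)) :
    Commute (D i) (X j) := by
  have h0 : ∀ m, D 0 * X m = X m * D 0 := fun m => by
    rw [← sub_eq_zero]
    rcases eq_or_ne m 0 with rfl | hm
    · rw [h.D_X_zero, sumInsert, Finset.univ_eq_empty, Finset.sum_empty]
    · rw [h.D_X m hm, sumInsert, Finset.univ_eq_empty, Finset.sum_empty, smul_zero]
  refine permHom_mul_right_cancel w (swap 0 i) ?_
  have h1 := h.equiv_D (swap 0 i) 0
  have h2 := h.equiv_X (swap 0 i) (swap 0 i j)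
  rw [swap_apply_left] at h1
  rw [swap_apply_self] at h2
  rw [mul_assoc, ← h2, ← mul_assoc, ← h1, mul_assoc, h0, ← mul_assoc, h2, mul_assoc, h1, mul_assoc]

theorem monom_X_mul_monom_D (h : IsCyclotomic hb k z w y X D) (c : Fin (n + 1) → ℕ) :
    monom X c * monom D c = 1 := by
  rw [monom, monom, prod_ofFn_mul_prod_ofFn fun i j => ((h.commute_D_X j i).symm.pow_pow _ _)]
  have h1 : ∀ i, X i ^ c i * D i ^ c i = 1 := fun i => by
    rw [← (h.commute_D_X i i).symm.mul_pow, h.X_mul_D_eq_one, one_pow]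
  simp only [h1, List.ofFn_const, List.prod_replicate, one_pow]

theorem monom_D_mul_monom_X (h : IsCyclotomic hb k z w y X D) (c : Fin (n + 1) → ℕ) :
    monom D c * monom X c = 1 := by
  rw [monom, monom, prod_ofFn_mul_prod_ofFn fun i j => ((h.commute_D_X i j).pow_pow _ _)]
  have h1 : ∀ i, D i ^ c i * X i ^ c i = 1 := fun i => by
    rw [← (h.commute_D_X i i).mul_pow, (h.commute_D_X i i).eq, h.X_mul_D_eq_one, one_pow]
  simp only [h1, List.ofFn_const, List.prod_replicate, one_pow]

theorem X_mul_heckeSpan_mul_monom_X_mem (h : IsCyclotomic hb k z w y X D) {v : A}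
    (hv : v ∈ adjoinSpan R (Set.range X) * heckeSpan R w y) (c : Fin (n + 1) → ℕ) :
    v * monom X c ∈ adjoinSpan R (Set.range X) * heckeSpan R w y := by
  have h1 : monom X c ∈ Algebra.adjoin R (Set.range X) := by
    refine list_prod_mem fun a ha => ?_
    obtain ⟨i, rfl⟩ := List.mem_ofFn.1 ha
    exact pow_mem (Algebra.subset_adjoin (Set.mem_range_self i)) _
  refine (?_ : _ ≤ adjoinSpan R (Set.range X) * heckeSpan R w y) (Submodule.mul_mem_mul hv
    (show monom X c ∈ adjoinSpan R (Set.range X) from h1))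
  rw [mul_assoc]
  refine (mul_le_mul' le_rfl h.heckeSpan_mul_X_le).trans (le_of_eq ?_)
  rw [← mul_assoc, adjoinSpan_mul_self]

/-- Clearing denominators: D_i is inverse to X_i, so by the triangular decomposition a large enough
monomial in the X_i removes every D from the right. For a sum the two monomials are multiplied
together. -/
theorem exists_mul_monom_X_mem (h : IsCyclotomic hb k z w y X D)
    (hgen : Algebra.adjoin R (Set.range w ∪ Set.range y ∪ Set.range X ∪ Set.range D) = ⊤) (p : A) :
    ∃ c, p * monom X c ∈ adjoinSpan R (Set.range X) * heckeSpan R w y := by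
  have hp : p ∈ adjoinSpan R (Set.range X) * heckeSpan R w y * adjoinSpan R (Set.range D) := by
    rw [h.triangular_eq_top hgen]
    exact Submodule.mem_top
  have hadd : ∀ a b, (∃ c, a * monom X c ∈ adjoinSpan R (Set.range X) * heckeSpan R w y) →
      (∃ c, b * monom X c ∈ adjoinSpan R (Set.range X) * heckeSpan R w y) →
      ∃ c, (a + b) * monom X c ∈ adjoinSpan R (Set.range X) * heckeSpan R w y := by
    rintro a b ⟨c, hc⟩ ⟨d, hd⟩
    refine ⟨c + d, ?_⟩
    rw [add_mul]
    refine add_mem ?_ ?_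
    · rw [← monom_mul_monom h.X_comm, ← mul_assoc]
      exact h.X_mul_heckeSpan_mul_monom_X_mem hc d
    · rw [add_comm c, ← monom_mul_monom h.X_comm, ← mul_assoc]
      exact h.X_mul_heckeSpan_mul_monom_X_mem hd c
  induction hp using Submodule.mul_induction_on' with
  | mem_mul_mem v hv d hd =>
    have hd' := adjoinSpan_range_le_span_monom h.D_comm hd
    clear hd
    induction hd' using Submodule.span_induction with
    | mem d hd =>
      obtain ⟨c, rfl⟩ := hd
      refine ⟨c, ?_⟩
      rwa [mul_assoc, h.monom_D_mul_monom_X, mul_one]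
    | zero => exact ⟨0, by simp⟩
    | add d d' _ _ hd hd' =>
      rw [mul_add]
      exact hadd _ _ hd hd'
    | smul r d _ hd =>
      obtain ⟨c, hc⟩ := hd
      refine ⟨c, ?_⟩
      rw [mul_smul_comm, smul_mul_assoc]
      exact Submodule.smul_mem _ _ hc
  | add a _ b _ ha hb => exact hadd a b ha hb

theorem X_mul_heckeSpan_le_span_monomials (h : IsCyclotomic hb k z w y X D) :
    adjoinSpan R (Set.range X) * heckeSpan R w y ≤ Submodule.span R (Set.range
      fun p : (Fin (n + 1) → ℕ) × (Fin (n + 1) → ℕ) × Perm (Fin (n + 1)) =>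
        monom X p.1 * monom y p.2.1 * w p.2.2) := by
  refine (mul_le_mul' (adjoinSpan_range_le_span_monom h.X_comm) (h.hecke.heckeSpan_le.trans
    (mul_le_mul' (adjoinSpan_range_le_span_monom h.hecke.y_comm) le_rfl))).trans ?_
  simp only [Submodule.span_mul_span]
  refine Submodule.span_mono ?_
  rintro _ ⟨_, ⟨a, rfl⟩, _, ⟨_, ⟨b, rfl⟩, _, ⟨σ, rfl⟩, rfl⟩, rfl⟩
  exact ⟨(a, b, σ), mul_assoc _ _ _⟩

/-- An element of the kernel stays in the kernel after clearing denominators, where independence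
makes it zero; the monomial in the X_i has a right inverse and can be undone. -/
theorem injective_of_linearIndependent {M : Type*} [Ring M] [Algebra R M]
    (h : IsCyclotomic hb k z w y X D)
    (hgen : Algebra.adjoin R (Set.range w ∪ Set.range y ∪ Set.range X ∪ Set.range D) = ⊤)
    (f : A →ₐ[R] M) {u : (Fin (n + 1) → ℕ) × (Fin (n + 1) → ℕ) × Perm (Fin (n + 1)) → M}
    (hu : LinearIndependent R u)
    (hf : ∀ p, f (monom X p.1 * monom y p.2.1 * w p.2.2) = u p) : Function.Injective f := by
  rw [injective_iff_map_eq_zero]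
  intro p hp
  obtain ⟨c, hc⟩ := h.exists_mul_monom_X_mem hgen p
  have h1 := eq_zero_of_mem_span_of_linearIndependent (f := f.toLinearMap) hu hf
    (h.X_mul_heckeSpan_le_span_monomials hc) (by simp [hp])
  rw [← mul_one p, ← h.monom_X_mul_monom_D c, ← mul_assoc, h1, zero_mul]

end IsCyclotomic

/-! ### Independence of the basis monomials and injectivity. -/

section Main

variable {n l : ℕ} {w : Perm (Fin (n + 1)) →* HH (n + 1) l}

/-- Reindexes the encoded family by (b, c) ↦ b_i + l c_{σ⁻¹ i}; since b_i < l, division with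
remainder recovers both exponents. -/
theorem linearIndependent_basis_monomials (hw : DegDAHA.ExtendsS w) :
    LinearIndependent (PRing l) fun p : (Fin (n + 1) → ℕ) × (Fin (n + 1) → Fin l)
      × Perm (Fin (n + 1)) × (Fin (n + 1) → ℕ) =>
      monom (DegDAHA.X w) p.1 * monom (yElt l) (fun i => (p.2.1 i).val) * w p.2.2.1
        * monom (DegDAHA.D (zVar l) w) p.2.2.2 := by
  have h1 : ∀ (b : Fin (n + 1) → Fin l) (c : Fin (n + 1) → ℕ) (σ : Perm (Fin (n + 1)))
      (i : Fin (n + 1)), ((b i).val + l * c (σ.symm i)) % l = (b i).val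
        ∧ ((b i).val + l * c (σ.symm i)) / l = c (σ.symm i) := fun b c σ i => by
    have hb := (b i).2
    rw [Nat.add_mul_mod_self_left, Nat.mod_eq_of_lt hb, Nat.add_mul_div_left _ _ (by omega),
      Nat.div_eq_of_lt hb, zero_add]
    exact ⟨rfl, rfl⟩
  convert (linearIndependent_monomials hw).comp (fun p : (Fin (n + 1) → ℕ) ×
    (Fin (n + 1) → Fin l) × Perm (Fin (n + 1)) × (Fin (n + 1) → ℕ) =>
      (p.1, (fun i => (p.2.1 i).val + l * p.2.2.2 (p.2.2.1.symm i)), p.2.2.1)) ?_ using 1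
  · funext ⟨a, b, σ, c⟩
    have h2 : ∀ i, ((b (σ i)).val + l * c i) / l = c i := fun i => by
      simpa only [symm_apply_apply] using (h1 b c σ (σ i)).2
    simp only [Function.comp_apply, affPerm.divModMonom, (h1 b c σ _).1, symm_apply_apply, h2]
  · rintro ⟨a, b, σ, c⟩ ⟨a', b', σ', c'⟩ hpp
    simp only [Prod.mk.injEq] at hpp
    obtain ⟨rfl, h2, rfl⟩ := hpp
    have hb : b = b' := funext fun i => Fin.ext (by
      rw [← (h1 b c σ i).1, ← (h1 b' c' σ i).1, congrFun h2 i])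
    have hc : c = c' := funext fun i => by
      have h3 := (h1 b c σ (σ i)).2
      have h4 := (h1 b' c' σ (σ i)).2
      rw [symm_apply_apply] at h3 h4
      rw [← h3, ← h4]
      have := congrFun h2 (σ i)
      simp only [symm_apply_apply] at this
      rw [this]
    rw [hb, hc]

theorem presHom_monomial (hw : DegDAHA.ExtendsS w) (a b c : Fin (n + 1) → ℕ)
    (σ : Perm (Fin (n + 1))) :
    hw.presHom (zVar l) (monom (fun i => presGen l (.X i)) a * monom (fun i => presGen l (.y i)) b
      * presPerm (hbVar l) (kVar l) (zVar l) σ * monom (fun i => presGen l (.D i)) c)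
      = monom (DegDAHA.X w) a * monom (yElt l) b * w σ * monom (DegDAHA.D (zVar l) w) c := by
  have hσ : hw.presHom (zVar l) (presPerm (hbVar l) (kVar l) (zVar l) σ) = w σ :=
    hw.presHom_gen _ (.s σ)
  simp only [map_mul, monom_map, presGen, hw.presHom_gen, hσ]
  rfl

theorem linearIndependent_pres_monomials (hw : DegDAHA.ExtendsS w) :
    LinearIndependent (PRing l) fun p : (Fin (n + 1) → ℕ) × (Fin (n + 1) → Fin l)
      × Perm (Fin (n + 1)) × (Fin (n + 1) → ℕ) =>
      monom (fun i => presGen l (.X i)) p.1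
        * monom (fun i => presGen l (.y i)) (fun i => (p.2.1 i).val)
        * presPerm (hbVar l) (kVar l) (zVar l) p.2.2.1
        * monom (fun i => presGen l (.D i)) p.2.2.2 :=
  linearIndependent_of_map_eq (f := (hw.presHom (zVar l)).toLinearMap)
    (linearIndependent_basis_monomials hw) fun p => presHom_monomial hw p.1 _ p.2.2.2 p.2.2.1

theorem presHom_injective (hw : DegDAHA.ExtendsS w) :
    Function.Injective (hw.presHom (zVar l)) := by
  have hc := isCyclotomic_pres (n := n) (hbVar l) (kVar l) (zVar l)
  have hgen := adjoin_pres_eq_top (n := n) (hbVar l) (kVar l) (zVar l)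
  rcases Nat.eq_zero_or_pos l with rfl | hl
  · refine hc.injective_of_linearIndependent hgen _ (linearIndependent_monomials hw) ?_
    rintro ⟨a, b, σ⟩
    have := presHom_monomial hw a b 0 σ
    rw [monom_zero, mul_one] at this
    -- For l = 0 the conventions e % 0 = e and e / 0 = 0 make the encoded family exactly the
    -- monomials X^a y^b s, with no D.
    simp only [affPerm.divModMonom, Nat.mod_zero, Nat.div_zero]
    exact this
  · rw [injective_iff_map_eq_zero]
    intro p hp
    refine eq_zero_of_mem_span_of_linearIndependent (f := (hw.presHom (zVar l)).toLinearMap)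
      (linearIndependent_basis_monomials hw) ?_ (x := p)
      ((hc.span_monomials_eq_top hl hgen).symm ▸ Submodule.mem_top) hp
    rintro ⟨a, b, σ, c⟩
    exact presHom_monomial hw a _ c σ

end Main

end CycDAHA

theorem proposition2p14 (N l : ℕ) [NeZero N] :
    ∃ w : Equiv.Perm (Fin N) →* CycDAHA.HH N l,
      (∀ i : Fin N, i.val + 1 < N → w (Equiv.swap i (i + 1)) = CycDAHA.sElt l i) ∧
      (∃ Φ : CycDAHA.HHpres N l ≃ₐ[CycDAHA.PRing l] CycDAHA.HHcyc N l,
        (∀ σ : Equiv.Perm (Fin N), (Φ (CycDAHA.presGen l (.s σ)) : CycDAHA.HH N l) = w σ) ∧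
        (∀ i : Fin N, (Φ (CycDAHA.presGen l (.y i)) : CycDAHA.HH N l) = CycDAHA.yElt l i) ∧
        (∀ i : Fin N, (Φ (CycDAHA.presGen l (.X i)) : CycDAHA.HH N l) = CycDAHA.DegDAHA.X w i) ∧
        (∀ i : Fin N, (Φ (CycDAHA.presGen l (.D i)) : CycDAHA.HH N l) =
          CycDAHA.DegDAHA.D (CycDAHA.zVar l) w i)) ∧
      (1 ≤ l →
        (∃ B : Module.Basis
            ((Fin N → ℕ) × (Fin N → Fin l) × Equiv.Perm (Fin N) × (Fin N → ℕ))
            (CycDAHA.PRing l) (CycDAHA.HHcyc N l),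
          ∀ (a : Fin N → ℕ) (b : Fin N → Fin l) (σ : Equiv.Perm (Fin N)) (c : Fin N → ℕ),
            (B (a, b, σ, c) : CycDAHA.HH N l) =
              CycDAHA.monom (CycDAHA.DegDAHA.X w) a
                * CycDAHA.monom (CycDAHA.yElt l) (fun i => (b i).val)
                * w σ
                * CycDAHA.monom (CycDAHA.DegDAHA.D (CycDAHA.zVar l) w) c) ∧
        Module.Free (CycDAHA.PRing l) (CycDAHA.HHcyc N l)) := by
  obtain ⟨n, rfl⟩ : ∃ n, N = n + 1 := ⟨N - 1, by have := NeZero.pos N; omega⟩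
  obtain ⟨w, hw⟩ :=
    CycDAHA.DegDAHA.exists_symmHom (CycDAHA.PRing l) n (CycDAHA.hbVar l) (CycDAHA.kVar l)
  replace hw : CycDAHA.DegDAHA.ExtendsS w := hw
  let Φ : CycDAHA.HHpres (n + 1) l ≃ₐ[CycDAHA.PRing l] CycDAHA.HHcyc (n + 1) l :=
    (AlgEquiv.ofInjective _ (CycDAHA.presHom_injective hw)).trans
      (Subalgebra.equivOfEq _ _ (hw.range_presHom (CycDAHA.zVar l)))
  have hΦ : ∀ p, (Φ p : CycDAHA.HH (n + 1) l) = hw.presHom (CycDAHA.zVar l) p := fun p => rfl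
  refine ⟨w, hw, ⟨Φ, fun σ => hw.presHom_gen _ _, fun i => hw.presHom_gen _ _,
    fun i => hw.presHom_gen _ _, fun i => hw.presHom_gen _ _⟩, fun hl => ?_⟩
  -- The basis is built in the presented algebra, where spanning is known, and transported along the
  -- isomorphism.
  have hspan := (CycDAHA.isCyclotomic_pres (n := n) (CycDAHA.hbVar l) (CycDAHA.kVar l)
    (CycDAHA.zVar l)).span_monomials_eq_top hl (CycDAHA.adjoin_pres_eq_top _ _ _)
  let B := (Module.Basis.mk (CycDAHA.linearIndependent_pres_monomials hw) hspan.ge).map Φ.toLinearEquiv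
  refine ⟨⟨B, fun a b σ c => ?_⟩, Module.Free.of_basis B⟩
  rw [← CycDAHA.presHom_monomial hw, ← hΦ, Module.Basis.map_apply, Module.Basis.mk_apply]
  rfl
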